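/- Let $N\in\{1,2,3\}$ and let $\Omega\subset\mathbb{R}^N$ be a bounded domain whose boundary is of class $C^{4,\eta}$ for some $\eta\in(0,1)$. Let $X$ be one of the following spaces, with the norm of $W^{2,2}(\Omega)$: either $X=W^{2,2}_0(\Omega)$ (Dirichlet boundary condition $u=\partial u/\partial\nu=0$ on $\partial\Omega$), or $X=W^{2,2}(\Omega)\cap W^{1,2}_0(\Omega)$ (Navier boundary condition $u=\Delta u=0$ on $\partial\Omega$); in the second case assume also that $\Omega$ satisfies a uniform outer ball condition. For $\omega\in\mathbb{R}$ and $\kappa>0$ put $$\mathcal{E}_1(u)=\frac12\int_\Omega|\Delta u|^2\,dx+\frac{\omega^2}{2}\int_\Omega|\nabla u|^2\,dx-\frac{\kappa}{4}\int_\Omega|\nabla u|^4\,dx,\qquad u\in X,$$ and $$\mathcal{N}=\Big\{u\in X\setminus\{0\}:\ \int_\Omega|\Delta u|^2\,dx+\omega^2\int_\Omega|\nabla u|^2\,dx-\kappa\int_\Omega|\nabla u|^4\,dx=0\Big\}.$$ A function $u\in X$ is called a weak solution of $$\Delta^2u-\omega^2\Delta u+\kappa\,\mathrm{div}\big(|\nabla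 u|^2\nabla u\big)=0\qquad(*)$$ (under the chosen boundary condition) if for all $\varphi\in X$ $$\int_\Omega\Delta u\,\Delta\varphi\,dx+\omega^2\int_\Omega(\nabla u,\nabla\varphi)\,dx-\kappa\int_\Omega|\nabla u|^2(\nabla u,\nabla\varphi)\,dx=0.$$ A nonzero weak solution $u$ is called a ground state solution if $\mathcal{E}_1(u)\le\mathcal{E}_1(v)$ for every nonzero weak solution $v$. A critical point $u$ of $\mathcal{E}_1$ is said to be of saddle type if every neighbourhood of $u$ in $X$ contains $v,w$ with $\mathcal{E}_1(v)<\mathcal{E}_1(u)<\mathcal{E}_1(w)$. Then for all $\omega\in\mathbb{R}$ and all $\kappa>0$ the functional $\mathcal{E}_1$ is well defined on $X$ (that is, $\int_\Omega|\nabla v|^4\,dx<\infty$ for all $v\in X$), and $(*)$ has a ground state solution $u$ with $\mathcal{E}_1(u)>0$, which is a critical point of $\mathcal{E}_1$ (its Fréchet derivative at $u$ is zero) of saddle type. Moreover $u\in\mathcal{N}$ and $\mathcal{E}_1(u)=\min\{\mathcal{E}_1(v):v\in\mathcal{N}\}$. -/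

import Mathlib

open MeasureTheory Set TopologicalSpace Metric
open scoped NNReal ENNReal Topology Distributions

noncomputable section

namespace Zakharov

/-- The Euclidean space `ℝᴺ`. -/
abbrev Space (N : ℕ) : Type := EuclideanSpace ℝ (Fin N)

/-! ### Regularity of the boundary -/

/-- `f` is of class `C^{k,η}` on the open set `s`: it is `C^k` on `s` and its derivative of order
`k` is locally `η`-Hölder continuous there. -/
def IsCkHolderOn {N : ℕ} (k : ℕ) (η : ℝ≥0) (f : Space N → Space N) (s : Set (Space N)) : Prop :=
  ContDiffOn ℝ k f s ∧
    ∀ x ∈ s, ∃ t ∈ 𝓝 x, ∃ C : ℝ≥0, HolderOnWith C η (iteratedFDeriv ℝ k f) t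

/-- The boundary of `Ω` is of class `C^{k,η}`: each boundary point is the centre of a ball that
is mapped onto an open set by a homeomorphism `ψ`, with `ψ` and `ψ⁻¹` of class `C^{k,η}`, such
that the points of `Ω` are those sent to the open half-space `{y | 0 < y i}` and the points of the
boundary are those sent to the hyperplane `{y | y i = 0}`. -/
def HasCkHolderBoundary {N : ℕ} (k : ℕ) (η : ℝ≥0) (Ω : Set (Space N)) : Prop :=
  ∀ x₀ ∈ frontier Ω, ∃ r : ℝ, 0 < r ∧
    ∃ (ψ : OpenPartialHomeomorph (Space N) (Space N)) (i : Fin N),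
      ψ.source = ball x₀ r ∧
      IsCkHolderOn k η ψ ψ.source ∧ IsCkHolderOn k η ψ.symm ψ.target ∧
      ∀ x ∈ ψ.source, (x ∈ Ω ↔ 0 < ψ x i) ∧ (x ∈ frontier Ω ↔ ψ x i = 0)

/-- The uniform outer ball condition: there is one radius `r > 0` such that each boundary point
lies on the boundary of a ball of radius `r` contained in the complement of `Ω`. -/
def UniformOuterBall {N : ℕ} (Ω : Set (Space N)) : Prop :=
  ∃ r : ℝ, 0 < r ∧ ∀ y ∈ frontier Ω, ∃ z : Space N, dist y z = r ∧ Disjoint (ball z r) Ω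

/-! ### Sobolev spaces

An element of `W^{k,2}(Ω)` is represented by the family of its weak derivatives of order at most
`k` (each of them an element of `L²(Ω)`, and the one of order zero is the function itself).  The
weak derivatives are determined by the function, so this is the usual space with the norm
`(∑_{|α| ≤ k} ‖D^α u‖²_{L²})^{1/2}`. -/

/-- Derivatives of order at most `k`: an order `m ≤ k` and `m` coordinate directions. -/
abbrev JetIndex (N k : ℕ) : Type := Σ m : Fin (k + 1), (Fin m → Fin N)

/-- Families of elements of `L²(Ω)` indexed by the derivatives of order at most `k`, with the
Hilbert sum norm. -/
abbrev JetSpace {N : ℕ} (k : ℕ) (Ω : Opens (Space N)) : Type :=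
  PiLp 2 (fun _ : JetIndex N k => Lp ℝ 2 (volume.restrict (Ω : Set (Space N))))

/-- The classical derivative `∂_{α 0} ⋯ ∂_{α (m-1)} φ (x)`. -/
def classicalDeriv {N m : ℕ} (α : Fin m → Fin N) (φ : Space N → ℝ) (x : Space N) : ℝ :=
  iteratedFDeriv ℝ m φ x (fun a => EuclideanSpace.single (α a) 1)

/-- The index of the function itself. -/
def zeroIndex (N k : ℕ) : JetIndex N k := ⟨0, Fin.elim0⟩

section Aux

variable {N : ℕ} {Ω : Opens (Space N)}

lemma continuous_classicalDeriv {m : ℕ} (α : Fin m → Fin N) (φ : 𝓓(Ω, ℝ)) :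
    Continuous (classicalDeriv α φ) := by
  have h : Continuous (iteratedFDeriv ℝ m (φ : Space N → ℝ)) :=
    φ.contDiff.continuous_iteratedFDeriv (by exact_mod_cast le_top)
  exact (ContinuousMultilinearMap.apply ℝ (fun _ : Fin m => Space N) ℝ
    (fun a => EuclideanSpace.single (α a) 1)).continuous.comp h

lemma hasCompactSupport_classicalDeriv {m : ℕ} (α : Fin m → Fin N) (φ : 𝓓(Ω, ℝ)) :
    HasCompactSupport (classicalDeriv α φ) :=
  (φ.hasCompactSupport.iteratedFDeriv (𝕜 := ℝ) m).comp_left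
    (g := fun T : ContinuousMultilinearMap ℝ (fun _ : Fin m => Space N) ℝ =>
      T (fun a => EuclideanSpace.single (α a) 1)) rfl

lemma memLp_classicalDeriv {m : ℕ} (α : Fin m → Fin N) (φ : 𝓓(Ω, ℝ)) :
    MemLp (classicalDeriv α φ) 2 (volume.restrict (Ω : Set (Space N))) :=
  ((continuous_classicalDeriv α φ).memLp_of_hasCompactSupport
    (hasCompactSupport_classicalDeriv α φ)).restrict _

lemma memLp_testFunction (φ : 𝓓(Ω, ℝ)) :
    MemLp φ 2 (volume.restrict (Ω : Set (Space N))) :=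
  (φ.continuous.memLp_of_hasCompactSupport φ.hasCompactSupport).restrict _

lemma classicalDeriv_add {m : ℕ} (α : Fin m → Fin N) (φ χ : 𝓓(Ω, ℝ)) :
    classicalDeriv α (φ + χ : 𝓓(Ω, ℝ)) = classicalDeriv α φ + classicalDeriv α χ := by
  funext x
  have hφ : ContDiffAt ℝ m (φ : Space N → ℝ) x :=
    (φ.contDiff.of_le (by exact_mod_cast le_top)).contDiffAt
  have hχ : ContDiffAt ℝ m (χ : Space N → ℝ) x :=
    (χ.contDiff.of_le (by exact_mod_cast le_top)).contDiffAt
  have h := iteratedFDeriv_add_apply hφ hχ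
  have e : ((φ + χ : 𝓓(Ω, ℝ)) : Space N → ℝ) = (φ : Space N → ℝ) + χ := rfl
  simp [classicalDeriv, e, h]

lemma classicalDeriv_smul {m : ℕ} (α : Fin m → Fin N) (c : ℝ) (φ : 𝓓(Ω, ℝ)) :
    classicalDeriv α (c • φ : 𝓓(Ω, ℝ)) = c • classicalDeriv α φ := by
  funext x
  have hφ : ContDiffAt ℝ m (φ : Space N → ℝ) x :=
    (φ.contDiff.of_le (by exact_mod_cast le_top)).contDiffAt
  have h := iteratedFDeriv_const_smul_apply (a := c) hφ
  have e : ((c • φ : 𝓓(Ω, ℝ)) : Space N → ℝ) = c • (φ : Space N → ℝ) := rfl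
  simp [classicalDeriv, e, h]

end Aux

/-- The Sobolev space `W^{k,2}(Ω)`: `U α` is the weak derivative of order `α` of the function
`U (zeroIndex N k)`. -/
def sobolev {N : ℕ} (k : ℕ) (Ω : Opens (Space N)) : Submodule ℝ (JetSpace k Ω) where
  carrier := {U | ∀ (α : JetIndex N k) (φ : 𝓓(Ω, ℝ)),
    ∫ x in (Ω : Set (Space N)), U (zeroIndex N k) x * classicalDeriv α.2 φ x =
      (-1) ^ (α.1 : ℕ) * ∫ x in (Ω : Set (Space N)), U α x * φ x}
  add_mem' := by
    intro U V hU hV α φ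
    have key : ∀ (β : JetIndex N k) (g : Space N → ℝ),
        MemLp g 2 (volume.restrict (Ω : Set (Space N))) →
        ∫ x in (Ω : Set (Space N)), (U + V) β x * g x =
          (∫ x in (Ω : Set (Space N)), U β x * g x) + ∫ x in (Ω : Set (Space N)), V β x * g x := by
      intro β g hg
      have hU' : Integrable (fun x => U β x * g x) (volume.restrict (Ω : Set (Space N))) :=
        (Lp.memLp (U β)).integrable_mul hg
      have hV' : Integrable (fun x => V β x * g x) (volume.restrict (Ω : Set (Space N))) :=
        (Lp.memLp (V β)).integrable_mul hg
      rw [← integral_add hU' hV']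
      refine integral_congr_ae ?_
      filter_upwards [Lp.coeFn_add (U β) (V β)] with x hx
      rw [PiLp.add_apply, hx, Pi.add_apply]
      ring
    rw [key _ _ (memLp_classicalDeriv α.2 φ), key _ _ (memLp_testFunction φ), hU α φ, hV α φ]
    ring
  zero_mem' := by
    intro α φ
    have key : ∀ (β : JetIndex N k) (g : Space N → ℝ),
        ∫ x in (Ω : Set (Space N)), (0 : JetSpace k Ω) β x * g x = 0 := by
      intro β g
      rw [← integral_zero (Space N) ℝ (μ := volume.restrict (Ω : Set (Space N)))]
      refine integral_congr_ae ?_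
      filter_upwards [Lp.coeFn_zero ℝ 2 (volume.restrict (Ω : Set (Space N)))] with x hx
      rw [PiLp.zero_apply, hx, Pi.zero_apply, zero_mul]
    rw [key, key, mul_zero]
  smul_mem' := by
    intro c U hU α φ
    have key : ∀ (β : JetIndex N k) (g : Space N → ℝ),
        ∫ x in (Ω : Set (Space N)), (c • U) β x * g x =
          c * ∫ x in (Ω : Set (Space N)), U β x * g x := by
      intro β g
      rw [← integral_const_mul]
      refine integral_congr_ae ?_
      filter_upwards [Lp.coeFn_smul c (U β)] with x hx
      rw [PiLp.smul_apply, hx, Pi.smul_apply, smul_eq_mul, mul_assoc]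
    rw [key, key, hU α φ]
    ring

/-- The family of classical derivatives of a test function `φ ∈ C_0^∞(Ω)`. -/
def testJet {N : ℕ} (k : ℕ) (Ω : Opens (Space N)) : 𝓓(Ω, ℝ) →ₗ[ℝ] JetSpace k Ω where
  toFun φ := WithLp.toLp 2 fun α => (memLp_classicalDeriv α.2 φ).toLp (classicalDeriv α.2 φ)
  map_add' φ χ := by
    ext1 α
    simp only [PiLp.add_apply, classicalDeriv_add]
    exact MemLp.toLp_add _ _
  map_smul' c φ := by
    ext1 α
    simp only [PiLp.smul_apply, classicalDeriv_smul, RingHom.id_apply]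
    exact MemLp.toLp_const_smul c (memLp_classicalDeriv α.2 φ)

/-- `W^{k,2}_0(Ω)`: the closure of `C_0^∞(Ω)`. -/
def sobolevZero {N : ℕ} (k : ℕ) (Ω : Opens (Space N)) : Submodule ℝ (JetSpace k Ω) :=
  (LinearMap.range (testJet k Ω)).topologicalClosure

/-- Forgetting the derivatives of order `k + 1`: the map `W^{k+1,2}(Ω) → W^{k,2}(Ω)`. -/
def truncate {N : ℕ} (k : ℕ) (Ω : Opens (Space N)) : JetSpace (k + 1) Ω →ₗ[ℝ] JetSpace k Ω where
  toFun U := WithLp.toLp 2 fun α => U ⟨α.1.castSucc, α.2⟩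
  map_add' _ _ := rfl
  map_smul' _ _ := rfl

/-- The two types of boundary conditions. -/
inductive BoundaryCondition where
  /-- `u = ∂u/∂ν = 0` on `∂Ω` -/
  | dirichlet
  /-- `u = Δu = 0` on `∂Ω` -/
  | navier

/-- The working space `X`: it is `W^{2,2}_0(Ω)` for the Dirichlet condition, and
`W^{2,2}(Ω) ∩ W^{1,2}_0(Ω)` for the Navier condition. -/
def workingSpace {N : ℕ} (bc : BoundaryCondition) (Ω : Opens (Space N)) :
    Submodule ℝ (JetSpace 2 Ω) :=
  match bc with
  | .dirichlet => sobolevZero 2 Ω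
  | .navier => sobolev 2 Ω ⊓ (sobolevZero 1 Ω).comap (truncate 1 Ω)

/-! ### The variational problem -/

section Functionals

variable {N : ℕ} {Ω : Opens (Space N)}

/-- The weak gradient. -/
def grad (U : JetSpace 2 Ω) (x : Space N) : Space N :=
  WithLp.toLp 2 fun i => U ⟨1, fun _ => i⟩ x

/-- The weak Laplacian. -/
def lap (U : JetSpace 2 Ω) (x : Space N) : ℝ :=
  ∑ i : Fin N, U ⟨2, fun _ => i⟩ x

/-- The energy functional
`½ ∫ |Δu|² + (ω²/2) ∫ |∇u|² - (κ/4) ∫ |∇u|⁴`. -/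
def energy (ω κ : ℝ) (U : JetSpace 2 Ω) : ℝ :=
  1 / 2 * (∫ x in (Ω : Set (Space N)), lap U x ^ 2)
    + ω ^ 2 / 2 * (∫ x in (Ω : Set (Space N)), ‖grad U x‖ ^ 2)
    - κ / 4 * (∫ x in (Ω : Set (Space N)), ‖grad U x‖ ^ 4)

/-- The functional `Q(u) = ∫ |Δu|² + ω² ∫ |∇u|² - κ ∫ |∇u|⁴`. -/
def nehariFunctional (ω κ : ℝ) (U : JetSpace 2 Ω) : ℝ :=
  (∫ x in (Ω : Set (Space N)), lap U x ^ 2)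
    + ω ^ 2 * (∫ x in (Ω : Set (Space N)), ‖grad U x‖ ^ 2)
    - κ * (∫ x in (Ω : Set (Space N)), ‖grad U x‖ ^ 4)

variable (bc : BoundaryCondition)

/-- The Nehari manifold. -/
def nehari (ω κ : ℝ) : Set (workingSpace bc Ω) :=
  {u | u ≠ 0 ∧ nehariFunctional ω κ (u : JetSpace 2 Ω) = 0}

/-- Weak solutions in `X` of `Δ²u - ω²Δu + κ div(|∇u|²∇u) = 0`. -/
def IsWeakSolution (ω κ : ℝ) (u : workingSpace bc Ω) : Prop :=
  ∀ φ : workingSpace bc Ω,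
    (∫ x in (Ω : Set (Space N)), lap (u : JetSpace 2 Ω) x * lap (φ : JetSpace 2 Ω) x)
      + ω ^ 2 * (∫ x in (Ω : Set (Space N)),
          inner ℝ (grad (u : JetSpace 2 Ω) x) (grad (φ : JetSpace 2 Ω) x))
      - κ * (∫ x in (Ω : Set (Space N)), ‖grad (u : JetSpace 2 Ω) x‖ ^ 2 *
          inner ℝ (grad (u : JetSpace 2 Ω) x) (grad (φ : JetSpace 2 Ω) x)) = 0

/-- Ground state solutions: nonzero weak solutions of least energy among all nonzero weak
solutions. -/
def IsGroundState (ω κ : ℝ) (u : workingSpace bc Ω) : Prop :=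
  u ≠ 0 ∧ IsWeakSolution bc ω κ u ∧
    ∀ v : workingSpace bc Ω, v ≠ 0 → IsWeakSolution bc ω κ v →
      energy ω κ (u : JetSpace 2 Ω) ≤ energy ω κ (v : JetSpace 2 Ω)

end Functionals

/-- `u` is a critical point of saddle type of `J`: the (Fréchet) derivative of `J` vanishes at
`u`, and each neighbourhood of `u` contains points `v`, `w` with `J v < J u < J w`. -/
def IsSaddleCriticalPoint {X : Type*} [NormedAddCommGroup X] [NormedSpace ℝ X]
    (J : X → ℝ) (u : X) : Prop :=
  HasFDerivAt J (0 : X →L[ℝ] ℝ) u ∧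
    ∀ V ∈ 𝓝 u, ∃ v ∈ V, ∃ w ∈ V, J v < J u ∧ J u < J w

end Zakharov

end

/-!
The energy is `½ a(u,u) - (κ/4) ‖G u‖⁴`, where `a` is the quadratic form of `Δ² - ω² Δ` on the
working space and `G = ∇` takes values in `L⁴`. Two facts about the domain are needed: `a` is
coercive for the norm of `W^{2,2}`, and `G` is a compact map. Everything else is a general argument
in a Hilbert space.

*The Hilbert space argument* (`QuarticProblem.exists_groundState`). By compactness of `G` and weak
lower semicontinuity of `a`, the quotient `‖G v‖⁴ / a(v,v)²` attains its maximum `M > 0`. On the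
Nehari manifold `a(v,v) = κ ‖G v‖⁴` the energy equals `¼ a(v,v)`, and the bound
`‖G v‖⁴ ≤ M a(v,v)²` gives `a(v,v) ≥ 1/(κM)`. A maximiser of the quotient, multiplied by the scalar
that places it on the Nehari manifold, attains this lower bound, and the Euler–Lagrange equation of
the quotient turns into the weak form of the differential equation. Nonzero weak solutions lie on
the Nehari manifold, so the rescaled maximiser `u` is a ground state. The energy decreases from `u`
along the ray through `u`. It increases in suitable other directions: the space has infinite
dimension, so a compact map has no positive lower bound on its unit sphere, and there are unit
vectors on which the quartic part is negligible compared with `a`.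

*Coercivity* (`exists_norm_le_l2norm_lap`). For a function `U` in `W^{2,2}(Ω) ∩ W^{1,2}_0(Ω)` one
has to bound the second derivatives by the Laplacian, and no elliptic regularity theory is
available. The gradient of `U` is normal to the boundary, in the weak sense of `IsNormalGradient`.
If `ρ` is a defining function of `Ω` near a boundary point, then the tangential derivatives
`∂ₖρ ∂ⱼU - ∂ⱼρ ∂ₖU`, cut off and extended by zero, therefore are weakly differentiable on the whole
space: integration by parts along the tangential field `∂ⱼρ ∂ₖ - ∂ₖρ ∂ⱼ` produces no boundary
terms (`integral_tangential_deriv`, `IsNormalGradient.integral_extension`). Mollifying such a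
function with a kernel supported in a cone of inward directions gives test functions supported in
`Ω`, and in the energy identity tested with them only `∇U` and `ΔU` remain
(`exists_sum_l2norm_derivMul_le`). This bounds all second derivatives except the
normal-normal one, which the Laplacian supplies (`abs_le_of_tangential`). Compactness of the closure
of `Ω` turns the local estimates into a global one (`exists_l2norm_deriv_le`); the lower order terms
are absorbed with the Poincaré inequality and Green's formula.

*Compactness* (`exists_eLpNorm_four_le`, `tendsto_eLpNorm_four_of_weak`). Mollification along inward
cones also approximates functions of `W^{1,2}(Ω)` inside `Ω` without extending them. By the
`L²`-to-`L⁴` bound for averages over balls, mollifications at the scales `δ` and `δ/2` differ in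
`L⁴` by a multiple of `δ^(1-N/4)` times the norm of the gradient. For `N ≤ 3` these differences are
summable, so that the mollifications converge in `L⁴` at a uniform rate, while at a fixed scale they
turn weak convergence in `L²` into convergence in `L⁴`.
-/

noncomputable section

namespace Zakharov

open Filter

/-! ### The `L²` seminorm of real functions -/

section L2

variable {α : Type*} [MeasurableSpace α] {μ : Measure α}

/-- The real-valued `L²` seminorm; it is meaningful for functions satisfying `MemLp f 2 μ`. -/
def l2norm (μ : Measure α) (f : α → ℝ) : ℝ := (eLpNorm f 2 μ).toReal

lemma l2norm_nonneg (f : α → ℝ) : 0 ≤ l2norm μ f := ENNReal.toReal_nonneg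

lemma l2norm_congr {f g : α → ℝ} (h : f =ᵐ[μ] g) : l2norm μ f = l2norm μ g := by
  rw [l2norm, l2norm, eLpNorm_congr_ae h]

lemma l2norm_add_le {f g : α → ℝ} (hf : MemLp f 2 μ) (hg : MemLp g 2 μ) :
    l2norm μ (fun x => f x + g x) ≤ l2norm μ f + l2norm μ g := by
  rw [l2norm, l2norm, l2norm, ← ENNReal.toReal_add hf.2.ne hg.2.ne]
  exact ENNReal.toReal_mono (ENNReal.add_lt_top.2 ⟨hf.2, hg.2⟩).ne
    (eLpNorm_add_le hf.1 hg.1 (by norm_num))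

lemma l2norm_sub_le {f g : α → ℝ} (hf : MemLp f 2 μ) (hg : MemLp g 2 μ) :
    l2norm μ (fun x => f x - g x) ≤ l2norm μ f + l2norm μ g := by
  rw [l2norm, l2norm, l2norm, ← ENNReal.toReal_add hf.2.ne hg.2.ne]
  exact ENNReal.toReal_mono (ENNReal.add_lt_top.2 ⟨hf.2, hg.2⟩).ne
    (eLpNorm_sub_le hf.1 hg.1 (by norm_num))

lemma l2norm_sum_le {ι : Type*} (s : Finset ι) {f : ι → α → ℝ} (hf : ∀ i ∈ s, MemLp (f i) 2 μ) :
    l2norm μ (fun x => ∑ i ∈ s, f i x) ≤ ∑ i ∈ s, l2norm μ (f i) := by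
  classical
  induction s using Finset.induction_on with
  | empty => simp [l2norm]
  | insert a s ha ih =>
    simp only [Finset.sum_insert ha]
    refine (l2norm_add_le (hf a (by simp))
      (memLp_finsetSum s fun i hi => hf i (by simp [hi]))).trans ?_
    gcongr
    exact ih fun i hi => hf i (by simp [hi])

lemma l2norm_le_mul {f g : α → ℝ} {A : ℝ} (hA : 0 ≤ A) (hg : MemLp g 2 μ)
    (h : ∀ᵐ x ∂μ, |f x| ≤ A * |g x|) : l2norm μ f ≤ A * l2norm μ g := by
  have := eLpNorm_le_mul_eLpNorm_of_ae_le_mul (f := f) (g := g) (c := A)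
    (by simpa only [Real.norm_eq_abs] using h) 2
  have h2 := ENNReal.toReal_mono (ENNReal.mul_lt_top ENNReal.ofReal_lt_top hg.2).ne this
  rwa [ENNReal.toReal_mul, ENNReal.toReal_ofReal hA] at h2

lemma l2norm_mono_measure {ν : Measure α} {f : α → ℝ} (hf : MemLp f 2 μ) (h : ν ≤ μ) :
    l2norm ν f ≤ l2norm μ f :=
  ENNReal.toReal_mono hf.2.ne (eLpNorm_mono_measure f h)

lemma l2norm_sq {f : α → ℝ} (hf : MemLp f 2 μ) : l2norm μ f ^ 2 = ∫ x, f x ^ 2 ∂μ := by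
  have h := hf.eLpNorm_eq_integral_rpow_norm (by norm_num) (by norm_num)
  have h0 : 0 ≤ ∫ x, f x ^ 2 ∂μ := integral_nonneg fun x => sq_nonneg _
  simp only [ENNReal.toReal_ofNat, Real.rpow_ofNat, Real.norm_eq_abs, sq_abs] at h
  rw [l2norm, h, ENNReal.toReal_ofReal (by positivity), ← Real.rpow_natCast, ← Real.rpow_mul h0]
  norm_num

lemma abs_integral_mul_le {f g : α → ℝ} (hf : MemLp f 2 μ) (hg : MemLp g 2 μ) :
    |∫ x, f x * g x ∂μ| ≤ l2norm μ f * l2norm μ g := by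
  have h1 : |∫ x, f x * g x ∂μ| ≤ ∫ x, |f x| * |g x| ∂μ := by
    simpa [abs_mul] using abs_integral_le_integral_abs (f := fun x => f x * g x) (μ := μ)
  refine h1.trans ?_
  have h2 := integral_mul_norm_le_Lp_mul_Lq (μ := μ) (f := f) (g := g)
    (p := 2) (q := 2) Real.HolderConjugate.two_two (by simpa using hf) (by simpa using hg)
  refine h2.trans (le_of_eq ?_)
  have key : ∀ f : α → ℝ, MemLp f 2 μ → (∫ a, ‖f a‖ ^ (2 : ℝ) ∂μ) ^ (1 / (2 : ℝ)) = l2norm μ f := by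
    intro f hf
    have := l2norm_sq hf
    simp only [Real.norm_eq_abs, Real.rpow_ofNat, sq_abs]
    rw [← this, ← Real.sqrt_eq_rpow, Real.sqrt_sq (l2norm_nonneg f)]
  rw [key f hf, key g hg]

lemma l2norm_union_le {s t : Set α} {f : α → ℝ} (hf : MemLp f 2 μ) :
    l2norm (μ.restrict (s ∪ t)) f ≤ l2norm (μ.restrict s) f + l2norm (μ.restrict t) f := by
  have h : l2norm (μ.restrict (s ∪ t)) f ^ 2
      ≤ l2norm (μ.restrict s) f ^ 2 + l2norm (μ.restrict t) f ^ 2 := by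
    rw [l2norm_sq (hf.restrict _), l2norm_sq (hf.restrict _), l2norm_sq (hf.restrict _),
      ← integral_add_measure (hf.restrict _).integrable_sq (hf.restrict _).integrable_sq]
    exact integral_mono_measure (Measure.restrict_union_le s t)
      (Eventually.of_forall fun x => sq_nonneg _)
      ((hf.restrict _).integrable_sq.add_measure (hf.restrict _).integrable_sq)
  have h1 := l2norm_nonneg (μ := μ.restrict s) f
  have h2 := l2norm_nonneg (μ := μ.restrict t) f
  nlinarith [l2norm_nonneg (μ := μ.restrict (s ∪ t)) f]

end L2

/-! ### Weak derivatives of functions -/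

section WeakDeriv

variable {N : ℕ}

/-- The classical partial derivative `∂ᵢ φ`. -/
def pd (i : Fin N) (φ : Space N → ℝ) (x : Space N) : ℝ :=
  fderiv ℝ φ x (EuclideanSpace.single i 1)

lemma continuous_pd {φ : Space N → ℝ} (hφ : ContDiff ℝ 1 φ) (i : Fin N) : Continuous (pd i φ) :=
  (hφ.continuous_fderiv (by norm_num)).clm_apply continuous_const

lemma contDiff_pd {n m : WithTop ℕ∞} {φ : Space N → ℝ} (hφ : ContDiff ℝ n φ) (h : m + 1 ≤ n)
    (i : Fin N) : ContDiff ℝ m (pd i φ) :=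
  (hφ.fderiv_right h).clm_apply contDiff_const

lemma hasCompactSupport_pd {φ : Space N → ℝ} (hφ : HasCompactSupport φ) (i : Fin N) :
    HasCompactSupport (pd i φ) :=
  hφ.fderiv_apply ℝ _

lemma tsupport_pd_subset (φ : Space N → ℝ) (i : Fin N) : tsupport (pd i φ) ⊆ tsupport φ :=
  tsupport_fderiv_apply_subset ℝ _

lemma pd_mul {φ χ : Space N → ℝ} {x : Space N} (hφ : DifferentiableAt ℝ φ x)
    (hχ : DifferentiableAt ℝ χ x) (i : Fin N) :
    pd i (fun y => φ y * χ y) x = pd i φ x * χ x + φ x * pd i χ x := by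
  simp only [pd]
  rw [fderiv_fun_mul hφ hχ]
  simp
  ring

lemma pd_pd_comm {φ : Space N → ℝ} (hφ : ContDiff ℝ 2 φ) (i j : Fin N) (x : Space N) :
    pd i (pd j φ) x = pd j (pd i φ) x := by
  have h : ∀ k l : Fin N, pd k (pd l φ) x
      = fderiv ℝ (fderiv ℝ φ) x (EuclideanSpace.single k 1) (EuclideanSpace.single l 1) := by
    intro k l
    have hd : DifferentiableAt ℝ (fderiv ℝ φ) x :=
      (hφ.fderiv_right (m := 1) (by norm_num)).differentiable (by norm_num) x
    have e : pd l φ = fun y => fderiv ℝ φ y (EuclideanSpace.single l 1) := rfl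
    rw [pd, e, fderiv_clm_apply hd (differentiableAt_const _)]
    simp
  rw [h, h]
  exact (hφ.contDiffAt.isSymmSndFDerivAt (by simp)) _ _

/-- Integrals of products are integrated by parts if one factor has compact support. -/
lemma integral_mul_pd {φ χ : Space N → ℝ} (hφ : ContDiff ℝ 1 φ) (hχ : ContDiff ℝ 1 χ)
    (hc : HasCompactSupport χ) (i : Fin N) :
    ∫ x, φ x * pd i χ x = -∫ x, pd i φ x * χ x := by
  refine integral_mul_fderiv_eq_neg_fderiv_mul_of_integrable ?_ ?_ ?_
    (fun x _ => hφ.differentiable (by norm_num) x) (fun x _ => hχ.differentiable (by norm_num) x)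
  · exact ((continuous_pd hφ i).mul hχ.continuous).integrable_of_hasCompactSupport hc.mul_left
  · exact (hφ.continuous.mul (continuous_pd hχ i)).integrable_of_hasCompactSupport
      (hasCompactSupport_pd hc i).mul_left
  · exact (hφ.continuous.mul hχ.continuous).integrable_of_hasCompactSupport hc.mul_left

/-- `g` is the weak `i`-th partial derivative of `w` on `Ω`. The test functions are those of class
`C¹`, so that products of test functions with `C¹` coefficients are again admissible. -/
def HasWeakDeriv (Ω : Set (Space N)) (w g : Space N → ℝ) (i : Fin N) : Prop :=
  ∀ φ : Space N → ℝ, ContDiff ℝ 1 φ → HasCompactSupport φ → tsupport φ ⊆ Ω →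
    ∫ x in Ω, w x * pd i φ x = -∫ x in Ω, g x * φ x

/-- A `C¹` function with compact support in an open set `Ω` is the uniform limit, together with
its partial derivatives, of smooth functions with compact support in `Ω`. -/
lemma exists_smooth_approx {Ω : Set (Space N)} (hΩ : IsOpen Ω) {φ : Space N → ℝ}
    (hφ : ContDiff ℝ 1 φ) (hc : HasCompactSupport φ) (hs : tsupport φ ⊆ Ω) {ε : ℝ} (hε : 0 < ε) :
    ∃ χ : Space N → ℝ, ContDiff ℝ (⊤ : ℕ∞) χ ∧ HasCompactSupport χ ∧ tsupport χ ⊆ Ω ∧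
      (∀ x, |χ x - φ x| ≤ ε) ∧ ∀ i x, |pd i χ x - pd i φ x| ≤ ε := by
  have huc : UniformContinuous φ := hc.uniformContinuous_of_continuous hφ.continuous
  have huc' : UniformContinuous (fderiv ℝ φ) :=
    (hc.fderiv ℝ).uniformContinuous_of_continuous (hφ.continuous_fderiv (by norm_num))
  obtain ⟨δ₁, hδ₁, h1⟩ := Metric.uniformContinuous_iff.1 huc ε hε
  obtain ⟨δ₂, hδ₂, h2⟩ := Metric.uniformContinuous_iff.1 huc' ε hε
  obtain ⟨δ₃, hδ₃, h3⟩ := hc.isCompact.exists_cthickening_subset_open hΩ hs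
  let δ := min (min δ₁ δ₂) δ₃
  have hδ : 0 < δ := lt_min (lt_min hδ₁ hδ₂) hδ₃
  let ρ : ContDiffBump (0 : Space N) := ⟨δ / 2, δ, by positivity, by linarith⟩
  let L := ContinuousLinearMap.lsmul ℝ ℝ (E := ℝ)
  let χ : Space N → ℝ := convolution (ρ.normed volume) φ L volume
  have hρ : LocallyIntegrable (ρ.normed (volume : Measure (Space N))) volume :=
    ρ.continuous_normed.locallyIntegrable
  have hsupp : tsupport χ ⊆ cthickening δ (tsupport φ) := by
    refine closure_minimal (fun x hx => ?_) isClosed_cthickening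
    obtain ⟨a, ha, b, hb, rfl⟩ := support_convolution_subset L hx
    rw [ρ.support_normed_eq] at ha
    refine mem_cthickening_of_dist_le _ b _ _ (subset_tsupport _ hb) ?_
    simpa using (mem_ball_zero_iff.1 ha).le
  have hcχ : HasCompactSupport χ := hc.isCompact.cthickening.of_isClosed_subset
    (isClosed_tsupport _) hsupp
  refine ⟨χ, ρ.hasCompactSupport_normed.contDiff_convolution_left L ρ.contDiff_normed
    hφ.continuous.locallyIntegrable, hcχ, ?_, ?_, ?_⟩
  · refine (hsupp.trans (cthickening_mono (min_le_right _ _) _)).trans h3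
  · intro x
    have := ContDiffBump.dist_normed_convolution_le (φ := ρ) (μ := volume) (g := φ) (x₀ := x)
      (ε := ε) hφ.continuous.aestronglyMeasurable (fun y hy => (h1 (lt_of_lt_of_le
        (mem_ball.1 hy) ((min_le_left _ _).trans (min_le_left _ _)))).le)
    rwa [Real.dist_eq] at this
  · intro i x
    have hd := hc.hasFDerivAt_convolution_right (L := L) hρ hφ x
    have e : pd i χ x = convolution (ρ.normed volume) (fun y => pd i φ y) L volume x := by
      rw [pd, hd.fderiv, convolution_precompR_apply _ hρ (hc.fderiv ℝ)
        (hφ.continuous_fderiv (by norm_num))]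
      rfl
    rw [e]
    have := ContDiffBump.dist_normed_convolution_le (φ := ρ) (μ := volume) (g := pd i φ) (x₀ := x)
      (ε := ε) (continuous_pd hφ i).aestronglyMeasurable (fun y hy => ?_)
    · rwa [Real.dist_eq] at this
    · have h4 := (h2 (lt_of_lt_of_le
        (mem_ball.1 hy) ((min_le_left _ _).trans (min_le_right _ _)))).le
      rw [dist_eq_norm] at h4 ⊢
      refine le_trans ?_ h4
      have := (fderiv ℝ φ y - fderiv ℝ φ x).le_opNorm (EuclideanSpace.single i 1)
      simpa [pd] using this

/-- It suffices to test weak derivatives with smooth functions. -/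
lemma HasWeakDeriv.of_smooth {Ω : Set (Space N)} (hΩ : IsOpen Ω) {w g : Space N → ℝ} {i : Fin N}
    (hw : IntegrableOn w Ω) (hg : IntegrableOn g Ω)
    (h : ∀ φ : 𝓓((⟨Ω, hΩ⟩ : Opens (Space N)), ℝ),
      ∫ x in Ω, w x * pd i φ x = -∫ x in Ω, g x * φ x) : HasWeakDeriv Ω w g i := by
  intro φ hφ hc hs
  have hz : ∀ n : ℕ, ∃ χ : 𝓓((⟨Ω, hΩ⟩ : Opens (Space N)), ℝ),
      (∀ x, |χ x - φ x| ≤ 1 / ((n : ℝ) + 1)) ∧ ∀ i x, |pd i χ x - pd i φ x| ≤ 1 / ((n : ℝ) + 1) := by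
    intro n
    obtain ⟨χ, h1, h2, h3, h4, h5⟩ := exists_smooth_approx hΩ hφ hc hs
      (ε := 1 / ((n : ℝ) + 1)) (by positivity)
    exact ⟨⟨χ, h1, h2, h3⟩, h4, h5⟩
  choose χ h1 h2 using hz
  have key : ∀ (v : Space N → ℝ) (f : Space N → ℝ) (F : ℕ → Space N → ℝ), IntegrableOn v Ω →
      Continuous f → HasCompactSupport f → (∀ n, Continuous (F n)) →
      (∀ n x, |F n x - f x| ≤ 1 / ((n : ℝ) + 1)) →
      Tendsto (fun n => ∫ x in Ω, v x * F n x) atTop (𝓝 (∫ x in Ω, v x * f x)) := by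
    intro v f F hv hf hfc hF hFf
    obtain ⟨C, hC⟩ := hf.bounded_above_of_compact_support hfc
    refine tendsto_integral_of_dominated_convergence (fun x => ‖v x‖ * (C + 1)) ?_ ?_ ?_ ?_
    · exact fun n => hv.1.mul (hF n).aestronglyMeasurable
    · exact hv.norm.mul_const _
    · intro n
      refine Eventually.of_forall fun x => ?_
      rw [norm_mul]
      gcongr
      have e : F n x = f x + (F n x - f x) := by ring
      rw [e]
      refine (norm_add_le _ _).trans (add_le_add (hC x) ((hFf n x).trans ?_))
      rw [div_le_one (by positivity)]
      linarith [(Nat.cast_nonneg n : (0 : ℝ) ≤ n)]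
    · refine Eventually.of_forall fun x => Tendsto.const_mul _ ?_
      rw [tendsto_iff_norm_sub_tendsto_zero]
      exact squeeze_zero (fun _ => norm_nonneg _) (fun n => hFf n x)
        tendsto_one_div_add_atTop_nhds_zero_nat
  have k1 := key w (pd i φ) (fun n => pd i (χ n)) hw (continuous_pd hφ i)
    (hasCompactSupport_pd hc i)
    (fun n => continuous_pd ((χ n).contDiff.of_le (by exact_mod_cast le_top)) i) (fun n => h2 n i)
  have k2 := (key g φ (fun n => χ n) hg hφ.continuous hc (fun n => (χ n).continuous) h1).neg
  refine tendsto_nhds_unique k1 (k2.congr fun n => (h (χ n)).symm)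

end WeakDeriv

/-! ### Convolution inequalities and mollification -/

section Convolution

lemma lintegral_mul_sq_le {α : Type*} [MeasurableSpace α] {μ : Measure α} {F k : α → ℝ≥0∞}
    (hF : AEMeasurable F μ) (hk : AEMeasurable k μ) :
    (∫⁻ y, F y * k y ∂μ) ^ 2 ≤ (∫⁻ y, F y ^ 2 * k y ∂μ) * ∫⁻ y, k y ∂μ := by
  have h := ENNReal.lintegral_mul_le_Lp_mul_Lq μ (p := 2) (q := 2) Real.HolderConjugate.two_two
    (f := fun y => F y * k y ^ (1 / 2 : ℝ)) (g := fun y => k y ^ (1 / 2 : ℝ))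
    (hF.mul (hk.pow_const _)) (hk.pow_const _)
  have e0 : ∀ a : ℝ≥0∞, (a ^ (1 / 2 : ℝ)) ^ (2 : ℝ) = a := fun a => by
    rw [← ENNReal.rpow_mul]; norm_num
  have e1 : ∀ a : ℝ≥0∞, a ^ (1 / 2 : ℝ) * a ^ (1 / 2 : ℝ) = a := fun a => by
    rw [← ENNReal.rpow_add_of_nonneg _ _ (by norm_num) (by norm_num)]; norm_num
  simp only [Pi.mul_apply, mul_assoc, e1, ENNReal.mul_rpow_of_nonneg _ _ (zero_le_two (α := ℝ)),
    e0, ENNReal.rpow_ofNat] at h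
  calc (∫⁻ y, F y * k y ∂μ) ^ 2
      ≤ ((∫⁻ y, F y ^ 2 * k y ∂μ) ^ (1 / 2 : ℝ) * (∫⁻ y, k y ∂μ) ^ (1 / 2 : ℝ)) ^ 2 := by gcongr
    _ = _ := by
        rw [mul_pow, ← ENNReal.rpow_two, ← ENNReal.rpow_two, e0, e0]

variable {N : ℕ}

/-- Young's inequality `‖F ⋆ k‖₂ ≤ ‖k‖₁ ‖F‖₂` for nonnegative functions. -/
lemma lintegral_convolution_sq_le {F k : Space N → ℝ≥0∞} (hF : Measurable F) (hk : Measurable k) :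
    ∫⁻ x, (∫⁻ y, F y * k (x - y)) ^ 2 ≤ (∫⁻ z, k z) ^ 2 * ∫⁻ y, F y ^ 2 := by
  have h1 : ∀ x : Space N, ∫⁻ y, k (x - y) = ∫⁻ z, k z := fun x =>
    lintegral_sub_left_eq_self k x
  have h2 : ∀ y : Space N, ∫⁻ x, k (x - y) = ∫⁻ z, k z := fun y =>
    lintegral_sub_right_eq_self k y
  calc ∫⁻ x, (∫⁻ y, F y * k (x - y)) ^ 2
      ≤ ∫⁻ x, (∫⁻ y, F y ^ 2 * k (x - y)) * ∫⁻ z, k z := by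
        refine lintegral_mono fun x => ?_
        rw [← h1 x]
        exact lintegral_mul_sq_le hF.aemeasurable
          (hk.comp (measurable_const.sub measurable_id)).aemeasurable
    _ = (∫⁻ x, ∫⁻ y, F y ^ 2 * k (x - y)) * ∫⁻ z, k z := by
        refine lintegral_mul_const _ ?_
        exact Measurable.lintegral_prod_right'
          (f := fun p : Space N × Space N => F p.2 ^ 2 * k (p.1 - p.2))
          (((hF.comp measurable_snd).pow_const 2).mul
            (hk.comp (measurable_fst.sub measurable_snd)))
    _ = (∫⁻ y, ∫⁻ x, F y ^ 2 * k (x - y)) * ∫⁻ z, k z := by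
        rw [lintegral_lintegral_swap]
        exact (((hF.comp measurable_snd).pow_const 2).mul
            (hk.comp (measurable_fst.sub measurable_snd))).aemeasurable
    _ = (∫⁻ y, F y ^ 2 * ∫⁻ z, k z) * ∫⁻ z, k z := by
        congr 1
        refine lintegral_congr fun y => ?_
        have hkm : Measurable fun x => k (x - y) := hk.comp (measurable_id.sub measurable_const)
        rw [lintegral_const_mul _ hkm, h2]
    _ = _ := by
        rw [lintegral_mul_const _ (hF.pow_const 2)]
        ring

/-- The `L²`-to-`L⁴` bound for integration over balls of a fixed radius. -/
lemma lintegral_ball_average_pow_four_le {F : Space N → ℝ≥0∞} (hF : Measurable F) (r : ℝ) :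
    ∫⁻ x, (∫⁻ y in closedBall x r, F y) ^ 4
      ≤ volume (closedBall (0 : Space N) r) ^ 3 * (∫⁻ y, F y ^ 2) ^ 2 := by
  set b := volume (closedBall (0 : Space N) r) with hb
  set k : Space N → ℝ≥0∞ := (closedBall (0 : Space N) r).indicator 1 with hk
  have hkm : Measurable k := measurable_one.indicator measurableSet_closedBall
  have hki : ∫⁻ z, k z = b := by
    rw [hk, lintegral_indicator_one measurableSet_closedBall]
  have e : ∀ x, ∫⁻ y in closedBall x r, F y = ∫⁻ y, F y * k (x - y) := by
    intro x
    rw [← lintegral_indicator measurableSet_closedBall]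
    refine lintegral_congr fun y => ?_
    by_cases hy : y ∈ closedBall x r
    · have : x - y ∈ closedBall (0 : Space N) r := by
        rw [mem_closedBall_zero_iff, ← dist_eq_norm, dist_comm]; exact hy
      simp [hk, hy, this]
    · have : x - y ∉ closedBall (0 : Space N) r := by
        rw [mem_closedBall_zero_iff, ← dist_eq_norm, dist_comm]; exact hy
      simp [hk, hy, this]
  have hsq : ∀ x, (∫⁻ y in closedBall x r, F y) ^ 2 ≤ b * ∫⁻ y, F y ^ 2 := by
    intro x
    rw [e x]
    have hkx : Measurable fun y => k (x - y) := hkm.comp (measurable_const.sub measurable_id)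
    refine (lintegral_mul_sq_le hF.aemeasurable hkx.aemeasurable).trans ?_
    rw [lintegral_sub_left_eq_self k x, hki, mul_comm]
    gcongr with y
    have : k (x - y) ≤ 1 := by
      rw [hk]; exact indicator_le_self' (fun _ _ => zero_le_one) _
    calc F y ^ 2 * k (x - y) ≤ F y ^ 2 * 1 := by gcongr
      _ = _ := mul_one _
  calc ∫⁻ x, (∫⁻ y in closedBall x r, F y) ^ 4
      ≤ ∫⁻ x, (b * ∫⁻ y, F y ^ 2) * (∫⁻ y, F y * k (x - y)) ^ 2 := by
        refine lintegral_mono fun x => ?_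
        have e2 : (∫⁻ y in closedBall x r, F y) ^ 4
          = (∫⁻ y in closedBall x r, F y) ^ 2 * (∫⁻ y in closedBall x r, F y) ^ 2 := by ring
        rw [e2]
        nth_rw 2 [e x]
        gcongr
        exact hsq x
    _ = (b * ∫⁻ y, F y ^ 2) * ∫⁻ x, (∫⁻ y, F y * k (x - y)) ^ 2 := by
        refine lintegral_const_mul _ (Measurable.pow_const ?_ 2)
        exact Measurable.lintegral_prod_right'
          (f := fun p : Space N × Space N => F p.2 * k (p.1 - p.2))
          ((hF.comp measurable_snd).mul (hkm.comp (measurable_fst.sub measurable_snd)))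
    _ ≤ (b * ∫⁻ y, F y ^ 2) * (b ^ 2 * ∫⁻ y, F y ^ 2) := by
        gcongr
        rw [← hki]
        exact lintegral_convolution_sq_le hF hkm
    _ = _ := by ring

/-- The rescaled kernel `ε⁻ᴺ η(z / ε)`. -/
def scaled (η : Space N → ℝ) (ε : ℝ) (z : Space N) : ℝ := (ε ^ N)⁻¹ * η (ε⁻¹ • z)

/-- The mollification of `f` at scale `ε` by the profile `η`. The support of `η` need not contain
the origin, so that the mollification at `x` may use values of `f` on one side of `x` only. -/
def mollify (η : Space N → ℝ) (ε : ℝ) (f : Space N → ℝ) (x : Space N) : ℝ :=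
  ∫ y, f y * scaled η ε (x - y)

lemma continuous_scaled {η : Space N → ℝ} (hη : Continuous η) (ε : ℝ) : Continuous (scaled η ε) :=
  continuous_const.mul (hη.comp (continuous_const_smul _))

lemma contDiff_scaled {n : WithTop ℕ∞} {η : Space N → ℝ} (hη : ContDiff ℝ n η) (ε : ℝ) :
    ContDiff ℝ n (scaled η ε) :=
  contDiff_const.mul (hη.comp (contDiff_const_smul _))

lemma hasCompactSupport_scaled {η : Space N → ℝ} (hη : HasCompactSupport η) {ε : ℝ} (hε : 0 < ε) :
    HasCompactSupport (scaled η ε) :=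
  (hη.comp_smul (inv_ne_zero hε.ne')).mul_left

lemma mollify_eq_integral_smul (η : Space N → ℝ) {ε : ℝ} (hε : 0 < ε) (f : Space N → ℝ)
    (x : Space N) : mollify η ε f x = ∫ ζ, f (x - ε • ζ) * η ζ := by
  have h1 : mollify η ε f x = ∫ z, f (x - z) * scaled η ε z := by
    rw [mollify, ← integral_sub_left_eq_self _ volume x]
    simp
  have h2 := Measure.integral_comp_inv_smul (volume : Measure (Space N))
    (fun ζ => f (x - ε • ζ) * η ζ) ε
  simp only [smul_inv_smul₀ hε.ne', finrank_euclideanSpace, Fintype.card_fin, smul_eq_mul,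
    abs_of_pos (pow_pos hε N)] at h2
  rw [h1]
  simp only [scaled]
  have h3 : ∫ z, f (x - z) * ((ε ^ N)⁻¹ * η (ε⁻¹ • z))
      = (ε ^ N)⁻¹ * ∫ z, f (x - z) * η (ε⁻¹ • z) := by
    rw [← integral_const_mul]
    congr 1 with z
    ring
  rw [h3, h2, inv_mul_cancel_left₀ (pow_pos hε N).ne']

lemma continuous_mollify {η : Space N → ℝ} (hη : Continuous η) (hc : HasCompactSupport η)
    {ε : ℝ} (hε : 0 < ε) {f : Space N → ℝ} (hf : LocallyIntegrable f) :
    Continuous (mollify η ε f) :=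
  (hasCompactSupport_scaled hc hε).continuous_convolution_right (ContinuousLinearMap.mul ℝ ℝ) hf
    (continuous_scaled hη ε)

lemma tendsto_translation_sub {f : Space N → ℝ} (hf : MemLp f 2) :
    Tendsto (fun z : Space N => eLpNorm (fun x => f (x - z) - f x) 2) (𝓝 0) (𝓝 0) := by
  let F : Lp ℝ 2 (volume : Measure (Space N)) := hf.toLp f
  let T : Space N → C(Space N, Space N) := fun z => ⟨fun x => x - z, by fun_prop⟩
  have hT : Continuous T := by
    refine ContinuousMap.continuous_of_continuous_uncurry _ ?_
    simp only [T, Function.uncurry_def, ContinuousMap.coe_mk]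
    fun_prop
  have hmp : ∀ z, MeasurePreserving (T z) volume volume := fun z =>
    measurePreserving_sub_right volume z
  have h := (tendsto_const_nhds (x := F) (f := 𝓝 (0 : Space N))).compMeasurePreservingLp
    (hT.tendsto 0) hmp (hmp 0) ENNReal.ofNat_ne_top
  have h0 : Lp.compMeasurePreserving (T 0) (hmp 0) F = F := by
    refine Lp.ext ?_
    filter_upwards [Lp.coeFn_compMeasurePreserving F (hmp 0)] with x hx
    rw [hx]
    simp [T]
  rw [h0, Lp.tendsto_Lp_iff_tendsto_eLpNorm'] at h
  refine h.congr fun z => eLpNorm_congr_ae ?_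
  filter_upwards [Lp.coeFn_compMeasurePreserving F (hmp z), hf.coeFn_toLp,
    (hmp z).quasiMeasurePreserving.ae (hf.coeFn_toLp)] with x h1 h2 h3
  simp only [Pi.sub_apply]
  rw [h1, h2]
  simpa [T] using h3

lemma tendsto_mollify_of_measurable {η : Space N → ℝ} (hη : Continuous η) (hc : HasCompactSupport η)
    (h0 : ∀ z, 0 ≤ η z) (h1 : ∫ z, η z = 1) {f : Space N → ℝ} (hfm : Measurable f)
    (hf : MemLp f 2) :
    Tendsto (fun ε => eLpNorm (fun x => mollify η ε f x - f x) 2) (𝓝[>] 0) (𝓝 0) := by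
  have hint : Integrable η := hη.integrable_of_hasCompactSupport hc
  have hk : ∫⁻ z, ENNReal.ofReal (η z) = 1 := by
    rw [← ofReal_integral_eq_lintegral_ofReal hint (Eventually.of_forall h0), h1, ENNReal.ofReal_one]
  obtain ⟨R, hR⟩ := hc.isCompact.isBounded.exists_norm_le
  have hloc : LocallyIntegrable f := hf.locallyIntegrable (by norm_num)
  have key : ∀ ε : ℝ, 0 < ε → ∫⁻ x, ‖mollify η ε f x - f x‖ₑ ^ 2
      ≤ ∫⁻ ζ, (∫⁻ x, ‖f (x - ε • ζ) - f x‖ₑ ^ 2) * ENNReal.ofReal (η ζ) := by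
    intro ε hε
    have hint2 : ∀ x, Integrable fun ζ => f (x - ε • ζ) * η ζ := by
      intro x
      have h2 : Integrable fun y => f y * scaled η ε (x - y) := by
        have := (hasCompactSupport_scaled hc hε).convolutionExists_right
          (ContinuousLinearMap.mul ℝ ℝ) hloc (continuous_scaled hη ε) x
        simpa [ConvolutionExistsAt] using this
      have h3 : Integrable fun z => f (x - z) * scaled η ε z := by
        have := h2.comp_sub_left x
        simpa using this
      have h4 := (h3.comp_smul hε.ne').const_mul (ε ^ N)
      refine h4.congr (Eventually.of_forall fun z => ?_)
      simp only [scaled, inv_smul_smul₀ hε.ne']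
      field_simp
    have hm1 : Measurable fun p : Space N × Space N => ‖f (p.1 - ε • p.2) - f p.1‖ₑ :=
      ((hfm.comp (measurable_fst.sub (measurable_snd.const_smul ε))).sub
        (hfm.comp measurable_fst)).enorm
    calc ∫⁻ x, ‖mollify η ε f x - f x‖ₑ ^ 2
        ≤ ∫⁻ x, ∫⁻ ζ, ‖f (x - ε • ζ) - f x‖ₑ ^ 2 * ENNReal.ofReal (η ζ) := by
          refine lintegral_mono fun x => ?_
          have e : mollify η ε f x - f x = ∫ ζ, (f (x - ε • ζ) - f x) * η ζ := by
            have : f x = ∫ ζ, f x * η ζ := by rw [integral_const_mul, h1, mul_one]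
            simp only [sub_mul]
            rw [mollify_eq_integral_smul η hε, integral_sub (hint2 x) (hint.const_mul _), ← this]
          have h3 : ‖mollify η ε f x - f x‖ₑ
              ≤ ∫⁻ ζ, ‖f (x - ε • ζ) - f x‖ₑ * ENNReal.ofReal (η ζ) := by
            rw [e]
            refine (enorm_integral_le_lintegral_enorm _).trans (le_of_eq ?_)
            refine lintegral_congr fun ζ => ?_
            rw [enorm_mul, Real.enorm_of_nonneg (h0 ζ)]
          calc _ ≤ (∫⁻ ζ, ‖f (x - ε • ζ) - f x‖ₑ * ENNReal.ofReal (η ζ)) ^ 2 := by gcongr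
            _ ≤ _ := lintegral_mul_sq_le (hm1.comp measurable_prodMk_left).aemeasurable
                hη.measurable.ennreal_ofReal.aemeasurable
            _ = _ := by rw [hk, mul_one]
      _ = ∫⁻ ζ, ∫⁻ x, ‖f (x - ε • ζ) - f x‖ₑ ^ 2 * ENNReal.ofReal (η ζ) := by
          rw [lintegral_lintegral_swap]
          exact ((hm1.pow_const 2).mul
            (hη.measurable.ennreal_ofReal.comp measurable_snd)).aemeasurable
      _ = _ := by
          refine lintegral_congr fun ζ => ?_
          rw [lintegral_mul_const]
          exact (hm1.comp measurable_prodMk_right).pow_const 2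
  have e2 : ∀ g : Space N → ℝ, eLpNorm g 2 volume = (∫⁻ x, ‖g x‖ₑ ^ 2) ^ (1 / 2 : ℝ) := by
    intro g
    rw [eLpNorm_eq_lintegral_rpow_enorm_toReal (by norm_num) (by norm_num)]
    simp
  have hmain : Tendsto (fun ε : ℝ => ∫⁻ x, ‖mollify η ε f x - f x‖ₑ ^ 2) (𝓝[>] 0) (𝓝 0) := by
    have ht : Tendsto (fun z : Space N => ∫⁻ x, ‖f (x - z) - f x‖ₑ ^ 2) (𝓝 0) (𝓝 0) := by
      have := (tendsto_translation_sub hf).ennrpow_const 2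
      simp only [e2, ← ENNReal.rpow_mul] at this
      norm_num at this
      simpa using this
    rw [ENNReal.tendsto_nhds_zero] at ht ⊢
    intro τ hτ
    obtain ⟨δ, hδ, hδ'⟩ := Metric.eventually_nhds_iff.1 (ht τ hτ)
    have hR0 : 0 < |R| + 1 := by positivity
    filter_upwards [Ioo_mem_nhdsGT (div_pos hδ hR0)] with ε hε
    refine (key ε hε.1).trans ?_
    calc _ ≤ ∫⁻ ζ, τ * ENNReal.ofReal (η ζ) := by
          refine lintegral_mono fun ζ => ?_
          by_cases hζ : ζ ∈ tsupport η
          · gcongr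
            refine hδ' ?_
            rw [dist_zero_right, norm_smul, Real.norm_of_nonneg hε.1.le]
            have h5 := (hR ζ hζ).trans (le_abs_self R)
            calc ε * ‖ζ‖ ≤ ε * (|R| + 1) := by
                  have := hε.1
                  gcongr
                  linarith
              _ < δ := by rw [← lt_div_iff₀ hR0]; exact hε.2
          · simp [image_eq_zero_of_notMem_tsupport hζ]
      _ = τ := by rw [lintegral_const_mul _ hη.measurable.ennreal_ofReal, hk, mul_one]
  simp only [e2]
  have := hmain.ennrpow_const (1 / 2)
  simpa using this

/-- Mollifications of a function in `L²(ℝᴺ)` converge to it in `L²(ℝᴺ)`. -/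
theorem tendsto_mollify {η : Space N → ℝ} (hη : Continuous η) (hc : HasCompactSupport η)
    (h0 : ∀ z, 0 ≤ η z) (h1 : ∫ z, η z = 1) {f : Space N → ℝ} (hf : MemLp f 2) :
    Tendsto (fun ε => eLpNorm (fun x => mollify η ε f x - f x) 2) (𝓝[>] 0) (𝓝 0) := by
  have hae := hf.1.aemeasurable.ae_eq_mk
  refine (tendsto_mollify_of_measurable hη hc h0 h1 hf.1.aemeasurable.measurable_mk
    (hf.ae_eq hae)).congr fun ε => eLpNorm_congr_ae ?_
  filter_upwards [hae] with x hx
  rw [← hx]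
  congr 1
  refine integral_congr_ae ?_
  filter_upwards [hae] with y hy
  rw [hy]

end Convolution

/-! ### Defining functions and inward cones at boundary points -/

section Geometry

variable {N : ℕ}

/-- Near a boundary point a domain of class `C^{k,η}` is a superlevel set of a globally defined
function of class `C^k` whose differential does not vanish at that point. -/
lemma HasCkHolderBoundary.exists_definingFunction {k : ℕ} (hk : 1 ≤ k) {η : ℝ≥0}
    {Ω : Set (Space N)} (h : HasCkHolderBoundary k η Ω) {x₀ : Space N} (hx₀ : x₀ ∈ frontier Ω) :
    ∃ (r : ℝ) (ρ : Space N → ℝ), 0 < r ∧ ContDiff ℝ k ρ ∧ fderiv ℝ ρ x₀ ≠ 0 ∧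
      ∀ x ∈ ball x₀ r, (x ∈ Ω ↔ 0 < ρ x) ∧ (x ∈ frontier Ω ↔ ρ x = 0) := by
  obtain ⟨r, hr, ψ, i, hsrc, ⟨hψ, -⟩, ⟨hψ', -⟩, hiff⟩ := h x₀ hx₀
  let χ : ContDiffBump x₀ := ⟨r / 3, r / 2, by positivity, by linarith⟩
  have hk0 : (k : WithTop ℕ∞) ≠ 0 := by
    have : k ≠ 0 := by omega
    exact_mod_cast this
  have hx₀s : x₀ ∈ ψ.source := by rw [hsrc]; exact mem_ball_self hr
  have hψi : ContDiffOn ℝ k (fun x => ψ x i) ψ.source :=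
    (contDiff_apply ℝ ℝ i |>.comp (PiLp.contDiff_ofLp (p := 2))).comp_contDiffOn hψ
  let ρ : Space N → ℝ := fun x => χ x * ψ x i
  have hρeq : ∀ x ∈ ball x₀ (r / 3), ρ x = ψ x i := by
    intro x hx
    simp only [ρ, χ.one_of_mem_closedBall (ball_subset_closedBall hx), one_mul]
  refine ⟨r / 3, ρ, by positivity, ?_, ?_, ?_⟩
  · rw [contDiff_iff_contDiffAt]
    intro x
    by_cases hx : x ∈ ψ.source
    · exact χ.contDiffAt.mul (hψi.contDiffAt (ψ.open_source.mem_nhds hx))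
    · have hx' : x ∉ tsupport χ := by
        rw [χ.tsupport_eq]
        intro hx'
        rw [hsrc] at hx
        exact hx (closedBall_subset_ball (by simp [χ]; linarith) hx')
      have : ρ =ᶠ[𝓝 x] fun _ => 0 := by
        filter_upwards [(isClosed_tsupport χ).isOpen_compl.mem_nhds hx'] with y hy
        simp [ρ, image_eq_zero_of_notMem_tsupport hy]
      exact contDiffAt_const.congr_of_eventuallyEq this
  · have hev : ρ =ᶠ[𝓝 x₀] fun x => ψ x i := by
      filter_upwards [ball_mem_nhds x₀ (show 0 < r / 3 by positivity)] with x hx using hρeq x hx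
    rw [hev.fderiv_eq]
    have hd : DifferentiableAt ℝ ψ x₀ :=
      (hψ.contDiffAt (ψ.open_source.mem_nhds hx₀s)).differentiableAt hk0
    have hy₀ : ψ x₀ ∈ ψ.target := ψ.map_source hx₀s
    have hd' : DifferentiableAt ℝ ψ.symm (ψ x₀) :=
      (hψ'.contDiffAt (ψ.open_target.mem_nhds hy₀)).differentiableAt hk0
    -- `ψ` has the differentiable right inverse `ψ.symm`, so its differential is onto
    have hcomp : HasFDerivAt (ψ ∘ ψ.symm) ((fderiv ℝ ψ x₀).comp (fderiv ℝ ψ.symm (ψ x₀)))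
        (ψ x₀) := by
      refine HasFDerivAt.comp _ ?_ hd'.hasFDerivAt
      rw [ψ.left_inv hx₀s]
      exact hd.hasFDerivAt
    have hid : HasFDerivAt (ψ ∘ ψ.symm) (ContinuousLinearMap.id ℝ (Space N)) (ψ x₀) := by
      refine (hasFDerivAt_id _).congr_of_eventuallyEq ?_
      filter_upwards [ψ.open_target.mem_nhds hy₀] with y hy using ψ.right_inv hy
    have he := hcomp.unique hid
    have hproj : HasFDerivAt (fun x => ψ x i)
        ((EuclideanSpace.proj i : Space N →L[ℝ] ℝ).comp (fderiv ℝ ψ x₀)) x₀ :=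
      (EuclideanSpace.proj i : Space N →L[ℝ] ℝ).hasFDerivAt.comp x₀ hd.hasFDerivAt
    rw [hproj.fderiv]
    intro h0
    have h1 := DFunLike.congr_fun h0 (fderiv ℝ ψ.symm (ψ x₀) (EuclideanSpace.single i 1))
    have h2 := DFunLike.congr_fun he (EuclideanSpace.single i (1 : ℝ))
    simp only [ContinuousLinearMap.comp_apply, ContinuousLinearMap.id_apply] at h1 h2
    rw [h2] at h1
    simp at h1
  · intro x hx
    rw [hρeq x hx]
    exact hiff x (by rw [hsrc]; exact ball_subset_ball (by linarith) hx)

/-- The points of `closure Ω` near `x₀` can be moved into `Ω` along all directions of a fixed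
cone, generated by the ball of centre `ν` and radius `s`. -/
def HasInwardCone (Ω : Set (Space N)) (x₀ : Space N) (r : ℝ) (ν : Space N) (s : ℝ) : Prop :=
  ∀ x ∈ closure Ω ∩ ball x₀ r, ∀ z ∈ closedBall ν s, ∀ ε : ℝ, 0 < ε → ε ≤ 1 → x + ε • z ∈ Ω

lemma HasInwardCone.mono {Ω : Set (Space N)} {x₀ ν : Space N} {r r' s : ℝ}
    (h : HasInwardCone Ω x₀ r ν s) (hr : r' ≤ r) : HasInwardCone Ω x₀ r' ν s :=
  fun x hx => h x ⟨hx.1, ball_subset_ball hr hx.2⟩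

lemma exists_inwardCone_of_mem {Ω : Set (Space N)} (hΩ : IsOpen Ω) {x₀ : Space N} (hx₀ : x₀ ∈ Ω) :
    ∃ (r : ℝ) (ν : Space N) (s : ℝ), 0 < r ∧ 0 < s ∧ HasInwardCone Ω x₀ r ν s := by
  obtain ⟨r, hr, hb⟩ := Metric.isOpen_iff.1 hΩ x₀ hx₀
  refine ⟨r / 2, 0, r / 2, by positivity, by positivity, fun x hx z hz ε hε hε1 => hb ?_⟩
  have h1 := mem_ball.1 hx.2
  have h2 := mem_closedBall_zero_iff.1 hz
  rw [mem_ball]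
  have h3 : dist (x + ε • z) x ≤ r / 2 := by
    rw [dist_eq_norm, add_sub_cancel_left, norm_smul, Real.norm_of_nonneg hε.le]
    nlinarith [norm_nonneg z]
  linarith [dist_triangle (x + ε • z) x x₀]

lemma exists_inwardCone_of_definingFunction {Ω : Set (Space N)} {x₀ : Space N} {r : ℝ}
    {ρ : Space N → ℝ} (hr : 0 < r) (hρ : ContDiff ℝ 1 ρ) (hd : fderiv ℝ ρ x₀ ≠ 0)
    (h : ∀ x ∈ ball x₀ r, (x ∈ Ω ↔ 0 < ρ x) ∧ (x ∈ frontier Ω ↔ ρ x = 0)) :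
    ∃ (r' : ℝ) (ν : Space N) (s : ℝ), 0 < r' ∧ 0 < s ∧ HasInwardCone Ω x₀ r' ν s := by
  obtain ⟨n, hn⟩ : ∃ n, 0 < fderiv ℝ ρ x₀ n := by
    by_contra hcon
    push Not at hcon
    refine hd (ContinuousLinearMap.ext fun v => le_antisymm (hcon v) ?_)
    have := hcon (-v)
    rw [map_neg] at this
    simpa using this
  have hcont : Continuous fun p : Space N × Space N => fderiv ℝ ρ p.1 p.2 :=
    ((hρ.continuous_fderiv (by norm_num)).comp continuous_fst).clm_apply continuous_snd
  have hev : ∀ᶠ p in 𝓝 (x₀, n), 0 < fderiv ℝ ρ p.1 p.2 :=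
    hcont.continuousAt.eventually (lt_mem_nhds hn)
  obtain ⟨δ, hδ, hδ'⟩ := Metric.eventually_nhds_iff_ball.1 hev
  let r₁ := min r δ
  have hr₁ : 0 < r₁ := lt_min hr hδ
  let τ := r₁ / 2 / (‖n‖ + δ)
  have hnδ : 0 < ‖n‖ + δ := by positivity
  have hτ : 0 < τ := by positivity
  refine ⟨r₁ / 2, τ • n, τ * (δ / 2), by positivity, by positivity, ?_⟩
  intro x hx z hz ε hε hε1
  have hz' : ‖τ⁻¹ • z - n‖ ≤ δ / 2 := by
    have : z - τ • n = τ • (τ⁻¹ • z - n) := by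
      rw [smul_sub, smul_inv_smul₀ hτ.ne']
    rw [mem_closedBall, dist_eq_norm, this, norm_smul, Real.norm_of_nonneg hτ.le] at hz
    exact le_of_mul_le_mul_left hz hτ
  have hzn : ‖z‖ < r₁ / 2 := by
    have h1 : ‖τ⁻¹ • z‖ ≤ ‖n‖ + δ / 2 := by
      have := norm_le_norm_add_norm_sub' (τ⁻¹ • z) n
      rw [norm_sub_rev] at this
      linarith [norm_sub_rev n (τ⁻¹ • z)]
    rw [norm_smul, norm_inv, Real.norm_of_nonneg hτ.le, inv_mul_le_iff₀ hτ] at h1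
    calc ‖z‖ ≤ τ * (‖n‖ + δ / 2) := h1
      _ < τ * (‖n‖ + δ) := by gcongr; linarith
      _ = r₁ / 2 := div_mul_cancel₀ _ hnδ.ne'
  have hin : ∀ t ∈ Icc (0 : ℝ) ε, x + t • z ∈ ball x₀ r₁ := by
    intro t ht
    have h1 := mem_ball.1 hx.2
    have h3 : dist (x + t • z) x ≤ ‖z‖ := by
      rw [dist_eq_norm, add_sub_cancel_left, norm_smul, Real.norm_of_nonneg ht.1]
      nlinarith [norm_nonneg z, ht.2]
    rw [mem_ball]
    linarith [dist_triangle (x + t • z) x x₀]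
  have hx0 : 0 ≤ ρ x := by
    have hxb : x ∈ ball x₀ r :=
      ball_subset_ball ((half_le_self hr₁.le).trans (min_le_left _ _)) hx.2
    rcases closure_eq_self_union_frontier Ω ▸ hx.1 with h1 | h1
    · exact ((h x hxb).1.1 h1).le
    · exact ((h x hxb).2.1 h1).ge
  have hder : ∀ t, HasDerivAt (fun t : ℝ => ρ (x + t • z)) (fderiv ℝ ρ (x + t • z) z) t := by
    intro t
    have h1 : HasDerivAt (fun t : ℝ => x + t • z) z t := by
      simpa using ((hasDerivAt_id t).smul_const z).const_add x
    exact ((hρ.differentiable (by norm_num) _).hasFDerivAt).comp_hasDerivAt t h1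
  have hmono : StrictMonoOn (fun t : ℝ => ρ (x + t • z)) (Icc 0 ε) := by
    refine strictMonoOn_of_deriv_pos (convex_Icc 0 ε)
      (fun t _ => (hder t).continuousAt.continuousWithinAt) fun t ht => ?_
    rw [interior_Icc] at ht
    rw [(hder t).deriv]
    have hp := hδ' (x + t • z, τ⁻¹ • z) (by
      rw [mem_ball, Prod.dist_eq]
      refine max_lt (lt_of_lt_of_le (mem_ball.1 (hin t ⟨ht.1.le, ht.2.le⟩)) (min_le_right _ _)) ?_
      simp only [dist_eq_norm]
      linarith)
    simp only [map_smul, smul_eq_mul] at hp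
    exact (pos_iff_pos_of_mul_pos hp).1 (inv_pos.2 hτ)
  have hpos : 0 < ρ (x + ε • z) := by
    have := hmono (left_mem_Icc.2 hε.le) (right_mem_Icc.2 hε.le) hε
    simp only [zero_smul, add_zero] at this
    linarith
  exact (h _ (ball_subset_ball (min_le_left _ _) (hin ε (right_mem_Icc.2 hε.le)))).1.2 hpos

/-- A domain of class `C^{k,η}` admits inward cones at all points of its closure. -/
lemma HasCkHolderBoundary.exists_inwardCone {k : ℕ} (hk : 1 ≤ k) {η : ℝ≥0}
    {Ω : Set (Space N)} (hΩ : IsOpen Ω) (h : HasCkHolderBoundary k η Ω) {x₀ : Space N}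
    (hx₀ : x₀ ∈ closure Ω) :
    ∃ (r : ℝ) (ν : Space N) (s : ℝ), 0 < r ∧ 0 < s ∧ HasInwardCone Ω x₀ r ν s := by
  rcases closure_eq_self_union_frontier Ω ▸ hx₀ with h1 | h1
  · exact exists_inwardCone_of_mem hΩ h1
  · obtain ⟨r, ρ, hr, hρ, hd, hiff⟩ := h.exists_definingFunction hk h1
    exact exists_inwardCone_of_definingFunction hr (hρ.of_le (by exact_mod_cast hk)) hd hiff

/-- A smooth probability density supported in a given ball. -/
lemma exists_profile (ν : Space N) {s : ℝ} (hs : 0 < s) :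
    ∃ η : Space N → ℝ, ContDiff ℝ (⊤ : ℕ∞) η ∧ (∀ z, 0 ≤ η z) ∧ ∫ z, η z = 1 ∧
      tsupport η ⊆ closedBall ν s := by
  let b : ContDiffBump ν := ⟨s / 2, s, by positivity, by linarith⟩
  exact ⟨b.normed volume, b.contDiff_normed, b.nonneg_normed, b.integral_normed,
    b.tsupport_normed_eq.subset⟩

end Geometry

/-! ### The embedding of `W^{1,2}(Ω)` into `L⁴(Ω)` -/

section Sobolev

variable {N : ℕ}

lemma mollify_indicator (η : Space N → ℝ) (ε : ℝ) {Ω : Set (Space N)} (hΩ : MeasurableSet Ω)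
    (w : Space N → ℝ) (x : Space N) :
    mollify η ε (Ω.indicator w) x = ∫ y in Ω, w y * scaled η ε (x - y) := by
  rw [mollify, ← integral_indicator hΩ]
  congr 1 with y
  by_cases hy : y ∈ Ω <;> simp [hy]

lemma sum_pd_coord_mul {η : Space N → ℝ} {ζ : Space N} (hη : DifferentiableAt ℝ η ζ) :
    ∑ j, pd j (fun z => z j * η z) ζ = N * η ζ + fderiv ℝ η ζ ζ := by
  have h1 : ∀ j : Fin N, pd j (fun z : Space N => z j * η z) ζ = η ζ + ζ j * pd j η ζ := by
    intro j
    have hd : HasFDerivAt (fun z : Space N => z j) (EuclideanSpace.proj j : Space N →L[ℝ] ℝ) ζ :=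
      (EuclideanSpace.proj j : Space N →L[ℝ] ℝ).hasFDerivAt
    rw [pd_mul hd.differentiableAt hη]
    have : pd j (fun z : Space N => z j) ζ = 1 := by
      rw [pd, hd.fderiv]
      simp
    rw [this, one_mul]
  have h2 : fderiv ℝ η ζ ζ = ∑ j, ζ j * pd j η ζ := by
    have : ζ = ∑ j, ζ j • (EuclideanSpace.single j (1 : ℝ)) := by
      ext i
      simp [Pi.single_apply]
    conv_lhs => rw [this]
    rw [map_sum, ← this]
    simp [pd]
  rw [h2, Finset.sum_congr rfl fun j _ => h1 j, Finset.sum_add_distrib]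
  simp

lemma pd_scaled_sub {θ : Space N → ℝ} (hθ : Differentiable ℝ θ) (ε : ℝ) (x y : Space N)
    (j : Fin N) : pd j (fun y => scaled θ ε (x - y)) y
      = -((ε ^ N)⁻¹ * ε⁻¹ * pd j θ (ε⁻¹ • (x - y))) := by
  have h1 : HasFDerivAt (fun y : Space N => ε⁻¹ • (x - y))
      (ε⁻¹ • -ContinuousLinearMap.id ℝ (Space N)) y :=
    ((hasFDerivAt_id y).const_sub x).const_smul ε⁻¹
  have h2 := ((hθ (ε⁻¹ • (x - y))).hasFDerivAt.comp y h1).const_mul (ε ^ N)⁻¹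
  have h3 : fderiv ℝ (fun y => scaled θ ε (x - y)) y = _ := h2.fderiv
  rw [pd, h3]
  simp [pd]
  ring

lemma hasDerivAt_scaled {η : Space N → ℝ} (hη : Differentiable ℝ η) {ε : ℝ} (hε : ε ≠ 0)
    (z : Space N) :
    HasDerivAt (fun t => scaled η t z)
      (-((ε ^ N)⁻¹ * ε⁻¹ * (N * η (ε⁻¹ • z) + fderiv ℝ η (ε⁻¹ • z) (ε⁻¹ • z)))) ε := by
  have h1 : HasDerivAt (fun t : ℝ => t⁻¹ • z) (-(ε ^ 2)⁻¹ • z) ε :=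
    (hasDerivAt_inv hε).smul_const z
  have h2 := (hη (ε⁻¹ • z)).hasFDerivAt.comp_hasDerivAt ε h1
  have h3 : HasDerivAt (fun t : ℝ => (t ^ N)⁻¹) (-(N * ε ^ (N - 1)) / (ε ^ N) ^ 2) ε :=
    (hasDerivAt_pow N ε).fun_inv (pow_ne_zero N hε)
  have h4 := h3.mul h2
  refine h4.congr_deriv ?_
  simp only [map_smul, smul_eq_mul, Function.comp_apply]
  rcases Nat.eq_zero_or_pos N with hN | hN
  · subst hN
    simp
    ring
  · obtain ⟨m, rfl⟩ : ∃ m, N = m + 1 := ⟨N - 1, by omega⟩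
    simp only [Nat.add_sub_cancel]
    field_simp
    ring

/-- The derivative of the mollification with respect to the scale involves only the weak
gradient: the derivative of the kernel with respect to the scale is a divergence. -/
lemma hasDerivAt_mollify {Ω : Set (Space N)} {η : Space N → ℝ} (hη : ContDiff ℝ (⊤ : ℕ∞) η)
    (hc : HasCompactSupport η) {w : Space N → ℝ} {g : Fin N → Space N → ℝ}
    (hw : IntegrableOn w Ω) (hwg : ∀ j, HasWeakDeriv Ω w (g j) j) {x : Space N} {ε : ℝ}
    (hε : 0 < ε) (hx : ∀ ζ ∈ tsupport η, x - ε • ζ ∈ Ω) :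
    HasDerivAt (fun t => ∫ y in Ω, w y * scaled η t (x - y))
      (-∑ j, ∫ y in Ω, g j y * scaled (fun z => z j * η z) ε (x - y)) ε := by
  have hdη : Differentiable ℝ η := hη.differentiable (by simp)
  let θ : Fin N → Space N → ℝ := fun j z => z j * η z
  have hθ : ∀ j, ContDiff ℝ (⊤ : ℕ∞) (θ j) := fun j =>
    ((EuclideanSpace.proj j : Space N →L[ℝ] ℝ).contDiff).mul hη
  let D : Space N → ℝ := fun ζ => N * η ζ + fderiv ℝ η ζ ζ
  have hD : Continuous D := (continuous_const.mul hη.continuous).add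
    ((hη.continuous_fderiv (by simp)).clm_apply continuous_id)
  have hDc : HasCompactSupport D := by
    refine HasCompactSupport.add hc.mul_left ?_
    refine hc.mono' fun ζ hζ => ?_
    by_contra hcon
    refine hζ ?_
    have : fderiv ℝ η ζ = 0 := by
      have := support_fderiv_subset ℝ (f := η)
      by_contra h0
      exact hcon (this h0)
    simp [this]
  obtain ⟨C, hC⟩ := hD.bounded_above_of_compact_support hDc
  have hC0 : 0 ≤ C := (norm_nonneg _).trans (hC 0)
  have key := hasDerivAt_integral_of_dominated_loc_of_deriv_le (μ := volume.restrict Ω)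
    (F := fun t y => w y * scaled η t (x - y))
    (F' := fun t y => w y * -((t ^ N)⁻¹ * t⁻¹ * D (t⁻¹ • (x - y))))
    (x₀ := ε) (s := ball ε (ε / 2)) (bound := fun y => ‖w y‖ * (((ε / 2) ^ N)⁻¹ * (ε / 2)⁻¹ * C))
    (ball_mem_nhds ε (by positivity)) ?_ ?_ ?_ ?_ ?_ ?_
  · refine key.2.congr_deriv ?_
    have hΨ : ∀ j, ContDiff ℝ 1 (fun y => scaled (θ j) ε (x - y)) := fun j =>
      ((contDiff_scaled (hθ j) ε).of_le (by exact_mod_cast le_top)).comp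
        (contDiff_const.sub contDiff_id)
    have hΨs : ∀ j, tsupport (fun y => scaled (θ j) ε (x - y)) ⊆ (fun ζ => x - ε • ζ) '' tsupport η :=
      fun j => by
      refine closure_minimal (fun y hy => ⟨ε⁻¹ • (x - y), subset_tsupport _ ?_, ?_⟩)
        (hc.isCompact.image (by fun_prop)).isClosed
      · intro h0
        refine hy ?_
        simp [scaled, θ, h0]
      · simp [smul_inv_smul₀ hε.ne']
    have hΨc : ∀ j, HasCompactSupport (fun y => scaled (θ j) ε (x - y)) := fun j =>
      (hc.isCompact.image (f := fun ζ => x - ε • ζ) (by fun_prop)).of_isClosed_subset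
        (isClosed_tsupport _) (hΨs j)
    have hΨΩ : ∀ j, tsupport (fun y => scaled (θ j) ε (x - y)) ⊆ Ω := fun j =>
      (hΨs j).trans (image_subset_iff.2 hx)
    have e1 : ∀ y, w y * -((ε ^ N)⁻¹ * ε⁻¹ * D (ε⁻¹ • (x - y)))
        = ∑ j, w y * pd j (fun y => scaled (θ j) ε (x - y)) y := by
      intro y
      rw [← Finset.mul_sum]
      congr 1
      simp only [D]
      rw [← sum_pd_coord_mul (hdη _), Finset.mul_sum, ← Finset.sum_neg_distrib]
      refine Finset.sum_congr rfl fun j _ => ?_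
      rw [pd_scaled_sub ((hθ j).differentiable (by simp))]
    simp only [e1]
    rw [integral_finsetSum, ← Finset.sum_neg_distrib]
    · exact Finset.sum_congr rfl fun j _ => hwg j _ (hΨ j) (hΨc j) (hΨΩ j)
    · intro j _
      obtain ⟨B, hB⟩ := (continuous_pd (hΨ j) j).bounded_above_of_compact_support
        (hasCompactSupport_pd (hΨc j) j)
      exact hw.mul_bdd (continuous_pd (hΨ j) j).aestronglyMeasurable (Eventually.of_forall hB)
  · exact Eventually.of_forall fun t => hw.1.mul
      ((continuous_scaled hη.continuous t).comp (by fun_prop)).aestronglyMeasurable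
  · obtain ⟨B, hB⟩ := (continuous_scaled hη.continuous ε).bounded_above_of_compact_support
      (hasCompactSupport_scaled hc hε)
    exact hw.mul_bdd ((continuous_scaled hη.continuous ε).comp
      (by fun_prop)).aestronglyMeasurable (Eventually.of_forall fun y => hB (x - y))
  · exact hw.1.mul (Continuous.aestronglyMeasurable (by fun_prop))
  · refine Eventually.of_forall fun y t ht => ?_
    have ht' : ε / 2 < t := by
      rw [Real.ball_eq_Ioo] at ht
      linarith [ht.1]
    have ht0 : 0 < t := by linarith
    rw [norm_mul, norm_neg, norm_mul, norm_mul, norm_inv, norm_inv, norm_pow,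
      Real.norm_of_nonneg ht0.le]
    gcongr
    exact hC _
  · exact hw.norm.mul_const _
  · refine Eventually.of_forall fun y t ht => ?_
    have ht0 : 0 < t := by
      rw [Real.ball_eq_Ioo] at ht
      linarith [ht.1]
    exact (hasDerivAt_scaled hdη ht0.ne' (x - y)).const_mul (w y)

/-- Mollifications at the scales `δ` and `δ / 2` differ by at most a multiple of the integral of
the gradient over a ball of radius comparable to `δ`. -/
lemma enorm_mollify_sub_le {Ω : Set (Space N)} (hΩ : MeasurableSet Ω) {η : Space N → ℝ}
    (hη : ContDiff ℝ (⊤ : ℕ∞) η) (hc : HasCompactSupport η) {R M : ℝ}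
    (hR : ∀ ζ ∈ tsupport η, ‖ζ‖ ≤ R) (hR0 : 0 ≤ R) (hM : ∀ ζ, |η ζ| ≤ M)
    {w : Space N → ℝ} {g : Fin N → Space N → ℝ}
    (hw : IntegrableOn w Ω) (hg : ∀ j, IntegrableOn (g j) Ω)
    (hwg : ∀ j, HasWeakDeriv Ω w (g j) j) {x : Space N}
    (hx : ∀ ζ ∈ tsupport η, ∀ ε : ℝ, 0 < ε → ε ≤ 1 → x - ε • ζ ∈ Ω)
    {δ : ℝ} (hδ : 0 < δ) (hδ1 : δ ≤ 1) :
    ‖mollify η (δ / 2) (Ω.indicator w) x - mollify η δ (Ω.indicator w) x‖ₑ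
      ≤ ENNReal.ofReal (δ / 2 * (((δ / 2) ^ N)⁻¹ * (R * M))) *
        ∫⁻ y in closedBall x (R * δ), Ω.indicator (fun y => ∑ j, ‖g j y‖ₑ) y := by
  have hM0 : 0 ≤ M := (abs_nonneg _).trans (hM 0)
  let K : ℝ := ((δ / 2) ^ N)⁻¹ * (R * M)
  let I : ℝ := ∫ y in Ω, (closedBall x (R * δ)).indicator (fun y => ∑ j, ‖g j y‖) y
  have hgs : IntegrableOn (fun y => ∑ j, ‖g j y‖) Ω :=
    integrable_finsetSum _ fun j _ => (hg j).norm
  have hbound : ∀ ε ∈ Icc (δ / 2) δ,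
      ‖-∑ j, ∫ y in Ω, g j y * scaled (fun z => z j * η z) ε (x - y)‖ ≤ K * I := by
    intro ε hε
    have hε0 : 0 < ε := lt_of_lt_of_le (by positivity) hε.1
    have hpt : ∀ j y, ‖g j y * scaled (fun z => z j * η z) ε (x - y)‖
        ≤ K * (closedBall x (R * δ)).indicator (fun y => ‖g j y‖) y := by
      intro j y
      by_cases hy : ε⁻¹ • (x - y) ∈ tsupport η
      · have h1 := hR _ hy
        have h2 : y ∈ closedBall x (R * δ) := by
          rw [norm_smul, norm_inv, Real.norm_of_nonneg hε0.le, inv_mul_le_iff₀ hε0] at h1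
          rw [mem_closedBall, dist_comm, dist_eq_norm]
          calc ‖x - y‖ ≤ ε * R := h1
            _ ≤ δ * R := by gcongr; exact hε.2
            _ = R * δ := mul_comm _ _
        rw [indicator_of_mem h2, norm_mul, scaled, norm_mul, norm_mul, norm_inv, norm_pow,
          Real.norm_of_nonneg hε0.le, mul_comm]
        refine mul_le_mul_of_nonneg_right ?_ (norm_nonneg _)
        refine mul_le_mul ?_ ?_ (by positivity) (by positivity)
        · have h3 : (0 : ℝ) < (δ / 2) ^ N := by positivity
          exact inv_anti₀ h3 (pow_le_pow_left₀ (by positivity) hε.1 N)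
        · exact mul_le_mul ((PiLp.norm_apply_le _ j).trans h1) (hM _) (norm_nonneg _) hR0
      · have h0 : η (ε⁻¹ • (x - y)) = 0 := image_eq_zero_of_notMem_tsupport hy
        rw [scaled, h0]
        simp only [mul_zero, norm_zero]
        exact mul_nonneg (by positivity) (indicator_nonneg (fun _ _ => norm_nonneg _) _)
    rw [norm_neg]
    calc ‖∑ j, ∫ y in Ω, g j y * scaled (fun z => z j * η z) ε (x - y)‖
        ≤ ∑ j, ∫ y in Ω, K * (closedBall x (R * δ)).indicator (fun y => ‖g j y‖) y := by
          refine (norm_sum_le _ _).trans (Finset.sum_le_sum fun j _ => ?_)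
          exact norm_integral_le_of_norm_le
            (((hg j).norm.indicator measurableSet_closedBall).const_mul K)
            (Eventually.of_forall (hpt j))
      _ = K * I := by
          rw [← integral_finsetSum _ fun j _ =>
            ((hg j).norm.indicator measurableSet_closedBall).const_mul K, ← integral_const_mul]
          congr 1 with y
          rw [← Finset.mul_sum]
          by_cases hy : y ∈ closedBall x (R * δ)
          · simp only [indicator_of_mem hy]
          · simp only [indicator_of_notMem hy, Finset.sum_const_zero]
  have hmvt := Convex.norm_image_sub_le_of_norm_hasDerivWithin_le
    (f := fun t => ∫ y in Ω, w y * scaled η t (x - y)) (s := Icc (δ / 2) δ) (C := K * I)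
    (fun ε hε => (hasDerivAt_mollify hη hc hw hwg (lt_of_lt_of_le (by positivity) hε.1)
      fun ζ hζ => hx ζ hζ ε (lt_of_lt_of_le (by positivity) hε.1)
        (hε.2.trans hδ1)).hasDerivWithinAt)
    hbound (convex_Icc _ _) (right_mem_Icc.2 (by linarith)) (left_mem_Icc.2 (by linarith))
  simp only [← mollify_indicator η _ hΩ] at hmvt
  have hI : ENNReal.ofReal I
      = ∫⁻ y in closedBall x (R * δ), Ω.indicator (fun y => ∑ j, ‖g j y‖ₑ) y := by
    rw [ofReal_integral_eq_lintegral_ofReal (hgs.indicator measurableSet_closedBall)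
      (Eventually.of_forall fun y => indicator_nonneg
        (fun _ _ => Finset.sum_nonneg fun _ _ => norm_nonneg _) _),
      ← lintegral_indicator hΩ, ← lintegral_indicator measurableSet_closedBall]
    refine lintegral_congr fun y => ?_
    by_cases h1 : y ∈ Ω <;> by_cases h2 : y ∈ closedBall x (R * δ) <;>
      simp only [h1, h2, indicator_of_mem, indicator_of_notMem, ENNReal.ofReal_zero,
        not_false_eq_true]
    rw [ENNReal.ofReal_sum_of_nonneg fun _ _ => norm_nonneg _]
    exact Finset.sum_congr rfl fun j _ => ofReal_norm _
  rw [← hI, ← ENNReal.ofReal_mul (by positivity), ← ofReal_norm]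
  refine ENNReal.ofReal_le_ofReal (hmvt.trans (le_of_eq ?_))
  rw [show δ / 2 - δ = -(δ / 2) by ring, norm_neg, Real.norm_of_nonneg (by positivity)]
  ring

end Sobolev

section SobolevEmbedding

variable {N : ℕ}

lemma eLpNorm_four_eq {α : Type*} [MeasurableSpace α] {μ : Measure α} {E : Type*}
    [NormedAddCommGroup E] (f : α → E) :
    eLpNorm f 4 μ = (∫⁻ x, ‖f x‖ₑ ^ 4 ∂μ) ^ (1 / 4 : ℝ) := by
  rw [eLpNorm_eq_lintegral_rpow_enorm_toReal (by norm_num) (by norm_num)]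
  simp

lemma eLpNorm_two_eq {α : Type*} [MeasurableSpace α] {μ : Measure α} {E : Type*}
    [NormedAddCommGroup E] (f : α → E) :
    eLpNorm f 2 μ = (∫⁻ x, ‖f x‖ₑ ^ 2 ∂μ) ^ (1 / 2 : ℝ) := by
  rw [eLpNorm_eq_lintegral_rpow_enorm_toReal (by norm_num) (by norm_num)]
  simp

/-- The `L⁴` distance between the mollifications at the scales `δ` and `δ / 2` is of order
`δ ^ (1 - N / 4)`, which is at most `δ ^ (1 / 4)` in dimension `N ≤ 3`. -/
lemma exists_eLpNorm_mollify_sub_le (hN : N ≤ 3) {Ω : Set (Space N)} (hΩ : MeasurableSet Ω)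
    {η : Space N → ℝ} (hη : ContDiff ℝ (⊤ : ℕ∞) η) (hc : HasCompactSupport η) :
    ∃ C : ℝ, 0 ≤ C ∧ ∀ S : Set (Space N),
      (∀ x ∈ S, ∀ ζ ∈ tsupport η, ∀ ε : ℝ, 0 < ε → ε ≤ 1 → x - ε • ζ ∈ Ω) → MeasurableSet S →
      ∀ (w : Space N → ℝ) (g : Fin N → Space N → ℝ), IntegrableOn w Ω →
        (∀ j, IntegrableOn (g j) Ω) → (∀ j, HasWeakDeriv Ω w (g j) j) →
        ∀ δ : ℝ, 0 < δ → δ ≤ 1 →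
          eLpNorm (fun x => mollify η (δ / 2) (Ω.indicator w) x - mollify η δ (Ω.indicator w) x) 4
            (volume.restrict S) ≤ ENNReal.ofReal (C * δ ^ (1 / 4 : ℝ)) *
              eLpNorm (fun y => ∑ j, ‖g j y‖) 2 (volume.restrict Ω) := by
  obtain ⟨R', hR'⟩ := hc.isCompact.isBounded.exists_norm_le
  obtain ⟨M, hM⟩ := hη.continuous.bounded_above_of_compact_support hc
  have hM0 : 0 ≤ M := (norm_nonneg _).trans (hM 0)
  let R := |R'|
  have hR : ∀ ζ ∈ tsupport η, ‖ζ‖ ≤ R := fun ζ hζ => (hR' ζ hζ).trans (le_abs_self _)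
  have hR0 : 0 ≤ R := abs_nonneg _
  let v : ℝ := (volume (closedBall (0 : Space N) 1)).toReal
  have hv : volume (closedBall (0 : Space N) 1) = ENNReal.ofReal v :=
    (ENNReal.ofReal_toReal measure_closedBall_lt_top.ne).symm
  have hv0 : 0 ≤ v := ENNReal.toReal_nonneg
  let D : ℝ := (2 ^ N * (R * M) / 2) ^ 4 * (R ^ N * v) ^ 3
  have hD : 0 ≤ D := by positivity
  refine ⟨D ^ (1 / 4 : ℝ), by positivity, fun S hS hSm w g hw hg hwg δ hδ hδ1 => ?_⟩
  let F : Space N → ℝ≥0∞ := Ω.indicator (fun y => ∑ j, ‖g j y‖ₑ)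
  have hFm : AEMeasurable F := by
    rw [aemeasurable_indicator_iff hΩ]
    exact Finset.aemeasurable_fun_sum _ fun j _ => (hg j).1.enorm
  let F' := hFm.mk F
  have hF' : Measurable F' := hFm.measurable_mk
  have hFF' : F =ᵐ[volume] F' := hFm.ae_eq_mk
  let K : ℝ := δ / 2 * (((δ / 2) ^ N)⁻¹ * (R * M))
  have hK0 : 0 ≤ K := by positivity
  have hGF : eLpNorm (fun y => ∑ j, ‖g j y‖) 2 (volume.restrict Ω)
      = (∫⁻ y, F' y ^ 2) ^ (1 / 2 : ℝ) := by
    have e1 : ∀ y, ‖∑ j, ‖g j y‖‖ₑ = ∑ j, ‖g j y‖ₑ := by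
      intro y
      rw [Real.enorm_of_nonneg (Finset.sum_nonneg fun _ _ => norm_nonneg _),
        ENNReal.ofReal_sum_of_nonneg fun _ _ => norm_nonneg _]
      exact Finset.sum_congr rfl fun j _ => ofReal_norm _
    rw [eLpNorm_two_eq, ← lintegral_indicator hΩ]
    congr 1
    refine lintegral_congr_ae ?_
    filter_upwards [hFF'] with y hy
    rw [← hy]
    by_cases h : y ∈ Ω
    · simp only [F, indicator_of_mem h, e1]
    · simp [F, h]
  have hmain : ∫⁻ x in S, ‖mollify η (δ / 2) (Ω.indicator w) x
      - mollify η δ (Ω.indicator w) x‖ₑ ^ 4 ≤ ENNReal.ofReal (D * δ) * (∫⁻ y, F' y ^ 2) ^ 2 := by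
    calc _ ≤ ∫⁻ x in S, (ENNReal.ofReal K * ∫⁻ y in closedBall x (R * δ), F' y) ^ 4 := by
          refine setLIntegral_mono' hSm fun x hx => ?_
          gcongr
          refine (enorm_mollify_sub_le hΩ hη hc hR hR0 hM hw hg hwg (hS x hx) hδ hδ1).trans
            (le_of_eq ?_)
          congr 1
          exact lintegral_congr_ae (ae_restrict_of_ae hFF')
      _ ≤ ∫⁻ x, (ENNReal.ofReal K * ∫⁻ y in closedBall x (R * δ), F' y) ^ 4 :=
          setLIntegral_le_lintegral _ _
      _ = ENNReal.ofReal K ^ 4 * ∫⁻ x, (∫⁻ y in closedBall x (R * δ), F' y) ^ 4 := by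
          simp only [mul_pow]
          rw [lintegral_const_mul' _ _ (by simp)]
      _ ≤ ENNReal.ofReal K ^ 4 * (volume (closedBall (0 : Space N) (R * δ)) ^ 3
            * (∫⁻ y, F' y ^ 2) ^ 2) := by
          gcongr
          exact lintegral_ball_average_pow_four_le hF' _
      _ ≤ _ := by
          rw [← mul_assoc]
          gcongr
          rw [Measure.addHaar_closedBall' _ _ (by positivity), hv, finrank_euclideanSpace,
            Fintype.card_fin, ← ENNReal.ofReal_mul (by positivity),
            ← ENNReal.ofReal_pow (by positivity), ← ENNReal.ofReal_pow (by positivity),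
            ← ENNReal.ofReal_mul (by positivity)]
          refine ENNReal.ofReal_le_ofReal ?_
          have h3 : δ ^ 3 ≤ δ ^ N := pow_le_pow_of_le_one hδ.le hδ1 hN
          have hδN : (0 : ℝ) < δ ^ N := by positivity
          have e : K ^ 4 * ((R * δ) ^ N * v) ^ 3 = D * (δ ^ 3 / δ ^ N) * δ := by
            simp only [K, D, mul_pow, div_pow]
            field_simp
          rw [e]
          have : δ ^ 3 / δ ^ N ≤ 1 := (div_le_one hδN).2 h3
          calc D * (δ ^ 3 / δ ^ N) * δ ≤ D * 1 * δ := by gcongr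
            _ = D * δ := by ring
  rw [eLpNorm_four_eq, hGF]
  calc _ ≤ (ENNReal.ofReal (D * δ) * (∫⁻ y, F' y ^ 2) ^ 2) ^ (1 / 4 : ℝ) := by gcongr
    _ = _ := by
        rw [ENNReal.mul_rpow_of_nonneg _ _ (by norm_num), ENNReal.ofReal_rpow_of_nonneg
          (by positivity) (by norm_num), Real.mul_rpow hD hδ.le, ← ENNReal.rpow_natCast,
          ← ENNReal.rpow_mul]
        norm_num

lemma memLp_indicator_of_restrict {Ω : Set (Space N)} (hΩ : MeasurableSet Ω) {w : Space N → ℝ}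
    {p : ℝ≥0∞} (hw : MemLp w p (volume.restrict Ω)) : MemLp (Ω.indicator w) p :=
  (memLp_indicator_iff_restrict hΩ).2 hw

/-- Quantitative approximation of functions in `W^{1,2}(Ω)` by mollifications in `L⁴`, near a
point where `Ω` has an inward cone. -/
theorem exists_eLpNorm_sub_mollify_le (hN : N ≤ 3) {Ω : Set (Space N)} (hΩ : IsOpen Ω)
    (hbdd : Bornology.IsBounded Ω) {x₀ ν : Space N} {r s : ℝ} (hs : 0 < s)
    (hcone : HasInwardCone Ω x₀ r ν s) :
    ∃ (η : Space N → ℝ) (C : ℝ), Continuous η ∧ HasCompactSupport η ∧ 0 ≤ C ∧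
      ∀ (w : Space N → ℝ) (g : Fin N → Space N → ℝ), MemLp w 2 (volume.restrict Ω) →
        (∀ j, MemLp (g j) 2 (volume.restrict Ω)) → (∀ j, HasWeakDeriv Ω w (g j) j) → ∀ k : ℕ,
          eLpNorm (fun x => w x - mollify η ((1 / 2) ^ k) (Ω.indicator w) x) 4
            (volume.restrict (Ω ∩ ball x₀ r)) ≤ ENNReal.ofReal (C * ((1 / 2) ^ (1 / 4 : ℝ)) ^ k) *
              eLpNorm (fun y => ∑ j, ‖g j y‖) 2 (volume.restrict Ω) := by
  obtain ⟨η, hη, h0, h1, hsupp⟩ := exists_profile (-ν) hs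
  have hc : HasCompactSupport η :=
    (isCompact_closedBall _ _).of_isClosed_subset (isClosed_tsupport _) hsupp
  obtain ⟨A, hA0, hA⟩ := exists_eLpNorm_mollify_sub_le hN hΩ.measurableSet hη hc
  let q : ℝ := (1 / 2) ^ (1 / 4 : ℝ)
  have hq0 : 0 < q := by positivity
  have hq1 : q < 1 := Real.rpow_lt_one (by norm_num) (by norm_num) (by norm_num)
  have hq1' : 0 < 1 - q := by linarith
  have : IsFiniteMeasure (volume.restrict Ω) := ⟨by simpa using hbdd.measure_lt_top⟩
  refine ⟨η, A / (1 - q), hη.continuous, hc, by positivity, fun w g hw hg hwg k => ?_⟩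
  set μ := volume.restrict (Ω ∩ ball x₀ r) with hμ
  set Γ := eLpNorm (fun y => ∑ j, ‖g j y‖) 2 (volume.restrict Ω) with hΓ
  set W := Ω.indicator w with hW
  have hWm : MemLp W 2 := memLp_indicator_of_restrict hΩ.measurableSet hw
  have hWloc : LocallyIntegrable W := hWm.locallyIntegrable (by norm_num)
  let m : ℕ → Space N → ℝ := fun k => mollify η ((1 / 2) ^ k) W
  have hmc : ∀ k, Continuous (m k) := fun k =>
    continuous_mollify hη.continuous hc (by positivity) hWloc
  have hmm : ∀ k, AEStronglyMeasurable (m k) μ := fun k => (hmc k).aestronglyMeasurable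
  have hS : ∀ x ∈ Ω ∩ ball x₀ r, ∀ ζ ∈ tsupport η, ∀ ε : ℝ, 0 < ε → ε ≤ 1 → x - ε • ζ ∈ Ω := by
    intro x hx ζ hζ ε hε hε1
    have := hcone x ⟨subset_closure hx.1, hx.2⟩ (-ζ) (by
      have := hsupp hζ
      rw [mem_closedBall, dist_eq_norm] at this ⊢
      rwa [show -ζ - ν = -(ζ - -ν) by abel, norm_neg]) ε hε hε1
    rwa [smul_neg, ← sub_eq_add_neg] at this
  have hstep : ∀ k, eLpNorm (fun x => m (k + 1) x - m k x) 4 μ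
      ≤ ENNReal.ofReal (A * q ^ k) * Γ := by
    intro k
    have := hA (Ω ∩ ball x₀ r) hS (hΩ.measurableSet.inter measurableSet_ball) w g
      (hw.integrable (by norm_num)) (fun j => (hg j).integrable (by norm_num)) hwg
      ((1 / 2) ^ k) (by positivity) (pow_le_one₀ (by norm_num) (by norm_num))
    have e1 : (((1 : ℝ) / 2) ^ k) ^ (1 / 4 : ℝ) = q ^ k := by
      rw [← Real.rpow_natCast, ← Real.rpow_natCast, ← Real.rpow_mul (by norm_num),
        ← Real.rpow_mul (by norm_num), mul_comm]
    have e2 : ((1 : ℝ) / 2) ^ k / 2 = (1 / 2) ^ (k + 1) := by ring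
    rw [e1, e2] at this
    exact this
  -- telescoping: `A q ^ k = B k - B (k + 1)` for `B k = A q ^ k / (1 - q)`
  let B : ℕ → ℝ := fun k => A / (1 - q) * q ^ k
  have hB0 : ∀ k, 0 ≤ B k := fun k => by positivity
  have hBstep : ∀ k, B k = A * q ^ k + B (k + 1) := by
    intro k
    simp only [B]
    field_simp
    ring
  have htel : ∀ k j, eLpNorm (fun x => m (k + j) x - m k x) 4 μ + ENNReal.ofReal (B (k + j)) * Γ
      ≤ ENNReal.ofReal (B k) * Γ := by
    intro k j
    induction j with
    | zero => simp
    | succ j ih =>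
      refine le_trans ?_ ih
      have h2 : eLpNorm (fun x => m (k + (j + 1)) x - m k x) 4 μ
          ≤ eLpNorm (fun x => m (k + j) x - m k x) 4 μ
            + ENNReal.ofReal (A * q ^ (k + j)) * Γ := by
        have h3 := eLpNorm_add_le (((hmm (k + j)).sub (hmm k))) ((hmm (k + j + 1)).sub (hmm (k + j)))
          (p := 4) (by norm_num)
        have e3 : (m (k + j) - m k + (m (k + j + 1) - m (k + j)))
            = fun x => m (k + (j + 1)) x - m k x := by
          ext x
          simp only [Pi.add_apply, Pi.sub_apply, add_assoc]
          ring
        rw [e3] at h3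
        exact h3.trans (add_le_add le_rfl (hstep (k + j)))
      rw [hBstep (k + j), ENNReal.ofReal_add (by positivity) (hB0 _), add_mul]
      calc _ ≤ eLpNorm (fun x => m (k + j) x - m k x) 4 μ
            + ENNReal.ofReal (A * q ^ (k + j)) * Γ + ENNReal.ofReal (B (k + (j + 1))) * Γ :=
            add_le_add h2 le_rfl
        _ = _ := by rw [add_assoc, add_assoc]
  have htel' : ∀ j, k ≤ j → eLpNorm (fun x => m j x - m k x) 4 μ ≤ ENNReal.ofReal (B k) * Γ := by
    intro j hj
    obtain ⟨i, rfl⟩ := Nat.exists_eq_add_of_le hj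
    exact le_self_add.trans (htel k i)
  have hconv : Tendsto (fun j => eLpNorm (m j - W) 2 volume) atTop (𝓝 0) := by
    have h2 : Tendsto (fun j : ℕ => ((1 : ℝ) / 2) ^ j) atTop (𝓝[>] 0) :=
      tendsto_nhdsWithin_iff.2 ⟨tendsto_pow_atTop_nhds_zero_of_lt_one (by norm_num) (by norm_num),
        Eventually.of_forall fun j => by simp⟩
    exact (tendsto_mollify hη.continuous hc h0 h1 hWm).comp h2
  obtain ⟨ns, hns, hlim⟩ := (tendstoInMeasure_of_tendsto_eLpNorm (by norm_num)
    (fun j => (hmc j).aestronglyMeasurable) hWm.1 hconv).exists_seq_tendsto_ae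
  have hae : ∀ᵐ x ∂μ, Tendsto (fun j => m (ns j) x - m k x) atTop (𝓝 (w x - m k x)) := by
    filter_upwards [ae_restrict_of_ae hlim, ae_restrict_mem
      (hΩ.measurableSet.inter measurableSet_ball)] with x hx hxΩ
    have : W x = w x := indicator_of_mem hxΩ.1 _
    rw [this] at hx
    exact hx.sub_const _
  refine (Lp.eLpNorm_lim_le_liminf_eLpNorm (fun j => (hmm (ns j)).sub (hmm k)) _ hae).trans ?_
  refine liminf_le_of_frequently_le' (Eventually.frequently ?_)
  filter_upwards [hns.tendsto_atTop.eventually_ge_atTop k] with j hj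
  exact htel' _ hj

end SobolevEmbedding

section SobolevGlobal

variable {N : ℕ}

lemma eLpNorm_four_union_le {α : Type*} [MeasurableSpace α] {μ : Measure α} (s t : Set α)
    (f : α → ℝ) : eLpNorm f 4 (μ.restrict (s ∪ t))
      ≤ eLpNorm f 4 (μ.restrict s) + eLpNorm f 4 (μ.restrict t) := by
  rw [eLpNorm_four_eq, eLpNorm_four_eq, eLpNorm_four_eq]
  refine le_trans ?_ (ENNReal.rpow_add_le_add_rpow _ _ (by norm_num) (by norm_num))
  gcongr
  exact lintegral_union_le _ s t

lemma abs_mollify_indicator_le {Ω : Set (Space N)} (hΩ : MeasurableSet Ω)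
    (hbdd : Bornology.IsBounded Ω) {η : Space N → ℝ} (hη : Continuous η) (hc : HasCompactSupport η)
    {ε : ℝ} (hε : 0 < ε) :
    ∃ C : ℝ, 0 ≤ C ∧ ∀ w : Space N → ℝ, MemLp w 2 (volume.restrict Ω) → ∀ x,
      |mollify η ε (Ω.indicator w) x| ≤ C * l2norm (volume.restrict Ω) w := by
  have : IsFiniteMeasure (volume.restrict Ω) := ⟨by simpa using hbdd.measure_lt_top⟩
  obtain ⟨B, hB⟩ := (continuous_scaled hη ε).bounded_above_of_compact_support
    (hasCompactSupport_scaled hc hε)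
  have hB0 : 0 ≤ B := (norm_nonneg _).trans (hB 0)
  refine ⟨B * l2norm (volume.restrict Ω) (fun _ => 1), mul_nonneg hB0 (l2norm_nonneg _),
    fun w hw x => ?_⟩
  have hk : MemLp (fun y => scaled η ε (x - y)) 2 (volume.restrict Ω) :=
    MemLp.of_bound ((continuous_scaled hη ε).comp (by fun_prop)).aestronglyMeasurable B
      (Eventually.of_forall fun y => hB _)
  rw [mollify_indicator η ε hΩ]
  refine (abs_integral_mul_le hw hk).trans ?_
  rw [mul_comm]
  refine mul_le_mul_of_nonneg_right ?_ (l2norm_nonneg _)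
  exact l2norm_le_mul hB0 (memLp_const 1) (Eventually.of_forall fun y => by simpa using hB (x - y))

/-- In dimension `N ≤ 3` the space `W^{1,2}(Ω)` embeds into `L⁴(Ω)`. -/
theorem exists_eLpNorm_four_le (hN : N ≤ 3) {Ω : Set (Space N)} (hΩ : IsOpen Ω)
    (hbdd : Bornology.IsBounded Ω)
    (hcone : ∀ x ∈ closure Ω, ∃ (r : ℝ) (ν : Space N) (s : ℝ), 0 < r ∧ 0 < s ∧
      HasInwardCone Ω x r ν s) :
    ∃ C : ℝ≥0, ∀ (w : Space N → ℝ) (g : Fin N → Space N → ℝ), MemLp w 2 (volume.restrict Ω) →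
      (∀ j, MemLp (g j) 2 (volume.restrict Ω)) → (∀ j, HasWeakDeriv Ω w (g j) j) →
      eLpNorm w 4 (volume.restrict Ω) ≤ C * (eLpNorm w 2 (volume.restrict Ω)
        + eLpNorm (fun y => ∑ j, ‖g j y‖) 2 (volume.restrict Ω)) := by
  have key := IsCompact.induction_on (s := closure Ω) hbdd.isCompact_closure
    (p := fun S => ∃ C : ℝ≥0, ∀ (w : Space N → ℝ) (g : Fin N → Space N → ℝ),
      MemLp w 2 (volume.restrict Ω) → (∀ j, MemLp (g j) 2 (volume.restrict Ω)) →
      (∀ j, HasWeakDeriv Ω w (g j) j) → eLpNorm w 4 (volume.restrict (Ω ∩ S))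
        ≤ C * (eLpNorm w 2 (volume.restrict Ω)
          + eLpNorm (fun y => ∑ j, ‖g j y‖) 2 (volume.restrict Ω))) ?_ ?_ ?_ ?_
  · obtain ⟨C, hC⟩ := key
    refine ⟨C, fun w g h1 h2 h3 => ?_⟩
    have := hC w g h1 h2 h3
    rwa [inter_eq_left.2 subset_closure] at this
  · exact ⟨0, fun w g _ _ _ => by simp⟩
  · rintro S T hST ⟨C, hC⟩
    exact ⟨C, fun w g h1 h2 h3 => (eLpNorm_mono_measure _ (Measure.restrict_mono
      (inter_subset_inter_right _ hST) le_rfl)).trans (hC w g h1 h2 h3)⟩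
  · rintro S T ⟨C, hC⟩ ⟨C', hC'⟩
    refine ⟨C + C', fun w g h1 h2 h3 => ?_⟩
    rw [inter_union_distrib_left, ENNReal.coe_add, add_mul]
    exact (eLpNorm_four_union_le _ _ _).trans (add_le_add (hC w g h1 h2 h3) (hC' w g h1 h2 h3))
  · intro x₀ hx₀
    obtain ⟨r, ν, s, hr, hs, hc⟩ := hcone x₀ hx₀
    refine ⟨ball x₀ r, mem_nhdsWithin_of_mem_nhds (ball_mem_nhds x₀ hr), ?_⟩
    obtain ⟨η, C, hη, hηc, hC0, hC⟩ := exists_eLpNorm_sub_mollify_le hN hΩ hbdd hs hc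
    obtain ⟨C', hC'0, hC'⟩ := abs_mollify_indicator_le hΩ.measurableSet hbdd hη hηc
      (ε := (1 / 2) ^ 0) (by positivity)
    let V := volume (Ω ∩ ball x₀ r) ^ (1 / 4 : ℝ)
    have hV : V ≠ ⊤ := ENNReal.rpow_ne_top_of_nonneg (by norm_num)
      ((measure_mono inter_subset_left).trans_lt hbdd.measure_lt_top).ne
    let D : ℝ≥0∞ := ENNReal.ofReal C + V * ENNReal.ofReal C'
    have hD : D ≠ ⊤ := by finiteness
    refine ⟨D.toNNReal, fun w g h1 h2 h3 => ?_⟩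
    rw [ENNReal.coe_toNNReal hD]
    have hm : AEStronglyMeasurable (mollify η ((1 / 2) ^ 0) (Ω.indicator w))
        (volume.restrict (Ω ∩ ball x₀ r)) :=
      (continuous_mollify hη hηc (by positivity) ((memLp_indicator_of_restrict hΩ.measurableSet
        h1).locallyIntegrable (by norm_num))).aestronglyMeasurable
    have hwm : AEStronglyMeasurable w (volume.restrict (Ω ∩ ball x₀ r)) :=
      h1.1.mono_measure (Measure.restrict_mono inter_subset_left le_rfl)
    have e1 := eLpNorm_add_le (p := 4) (hwm.sub hm) hm (by norm_num)
    rw [sub_add_cancel] at e1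
    have e2 := hC w g h1 h2 h3 0
    have e3 := eLpNorm_le_of_ae_bound (p := 4) (μ := volume.restrict (Ω ∩ ball x₀ r))
      (f := mollify η ((1 / 2) ^ 0) (Ω.indicator w))
      (Eventually.of_forall fun x => hC' w h1 x)
    have e4 : ENNReal.ofReal (l2norm (volume.restrict Ω) w) = eLpNorm w 2 (volume.restrict Ω) :=
      ENNReal.ofReal_toReal h1.2.ne
    have e5 : ((4 : ℝ≥0∞).toReal)⁻¹ = (1 / 4 : ℝ) := by simp
    rw [ENNReal.ofReal_mul hC'0, e4, Measure.restrict_apply_univ, e5, ← mul_assoc] at e3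
    have e6 : C * ((1 / 2 : ℝ) ^ (1 / 4 : ℝ)) ^ 0 = C := by rw [pow_zero, mul_one]
    rw [e6] at e2
    refine e1.trans ((add_le_add e2 e3).trans ?_)
    rw [add_mul, add_comm (eLpNorm w 2 _)]
    gcongr
    · exact le_self_add
    · exact le_add_self

/-- In dimension `N ≤ 3` the embedding of `W^{1,2}(Ω)` into `L⁴(Ω)` is compact: sequences that are
bounded in `W^{1,2}(Ω)` and tend to zero weakly in `L²(Ω)` tend to zero in `L⁴(Ω)`. -/
theorem tendsto_eLpNorm_four_of_weak (hN : N ≤ 3) {Ω : Set (Space N)} (hΩ : IsOpen Ω)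
    (hbdd : Bornology.IsBounded Ω)
    (hcone : ∀ x ∈ closure Ω, ∃ (r : ℝ) (ν : Space N) (s : ℝ), 0 < r ∧ 0 < s ∧
      HasInwardCone Ω x r ν s)
    {w : ℕ → Space N → ℝ} {g : ℕ → Fin N → Space N → ℝ} {K : ℝ≥0}
    (hw : ∀ n, MemLp (w n) 2 (volume.restrict Ω))
    (hg : ∀ n j, MemLp (g n j) 2 (volume.restrict Ω))
    (hwg : ∀ n j, HasWeakDeriv Ω (w n) (g n j) j)
    (hwK : ∀ n, eLpNorm (w n) 2 (volume.restrict Ω) ≤ K)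
    (hgK : ∀ n, eLpNorm (fun y => ∑ j, ‖g n j y‖) 2 (volume.restrict Ω) ≤ K)
    (hweak : ∀ h, MemLp h 2 (volume.restrict Ω) →
      Tendsto (fun n => ∫ x in Ω, w n x * h x) atTop (𝓝 0)) :
    Tendsto (fun n => eLpNorm (w n) 4 (volume.restrict Ω)) atTop (𝓝 0) := by
  have : IsFiniteMeasure (volume.restrict Ω) := ⟨by simpa using hbdd.measure_lt_top⟩
  have key := IsCompact.induction_on (s := closure Ω) hbdd.isCompact_closure
    (p := fun S => Tendsto (fun n => eLpNorm (w n) 4 (volume.restrict (Ω ∩ S))) atTop (𝓝 0))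
    ?_ ?_ ?_ ?_
  · rwa [inter_eq_left.2 subset_closure] at key
  · simp
  · intro S T hST hT
    exact tendsto_of_tendsto_of_tendsto_of_le_of_le tendsto_const_nhds hT (fun _ => zero_le)
      fun n => eLpNorm_mono_measure _ (Measure.restrict_mono
        (inter_subset_inter_right _ hST) le_rfl)
  · intro S T hS hT
    have := hS.add hT
    rw [add_zero] at this
    refine tendsto_of_tendsto_of_tendsto_of_le_of_le tendsto_const_nhds this (fun _ => zero_le)
      fun n => ?_
    rw [inter_union_distrib_left]
    exact eLpNorm_four_union_le _ _ _
  · intro x₀ hx₀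
    obtain ⟨r, ν, s, hr, hs, hc⟩ := hcone x₀ hx₀
    refine ⟨ball x₀ r, mem_nhdsWithin_of_mem_nhds (ball_mem_nhds x₀ hr), ?_⟩
    obtain ⟨η, C, hη, hηc, hC0, hC⟩ := exists_eLpNorm_sub_mollify_le hN hΩ hbdd hs hc
    let q : ℝ := (1 / 2) ^ (1 / 4 : ℝ)
    have hq0 : 0 < q := by positivity
    have hq1 : q < 1 := Real.rpow_lt_one (by norm_num) (by norm_num) (by norm_num)
    let μ := volume.restrict (Ω ∩ ball x₀ r)
    have hμfin : IsFiniteMeasure μ := ⟨by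
      simpa [μ] using (measure_mono inter_subset_left).trans_lt hbdd.measure_lt_top⟩
    let m : ℕ → ℕ → Space N → ℝ := fun k n => mollify η ((1 / 2) ^ k) (Ω.indicator (w n))
    have hm : ∀ k n, Continuous (m k n) := fun k n =>
      continuous_mollify hη hηc (by positivity) ((memLp_indicator_of_restrict hΩ.measurableSet
        (hw n)).locallyIntegrable (by norm_num))
    have hwm : ∀ n, AEStronglyMeasurable (w n) μ := fun n =>
      (hw n).1.mono_measure (Measure.restrict_mono inter_subset_left le_rfl)
    have hmlim : ∀ k, Tendsto (fun n => eLpNorm (m k n) 4 μ) atTop (𝓝 0) := by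
      intro k
      obtain ⟨C', hC'0, hC'⟩ := abs_mollify_indicator_le hΩ.measurableSet hbdd hη hηc
        (ε := (1 / 2) ^ k) (by positivity)
      have hbd : ∀ n x, |m k n x| ≤ C' * K := fun n x => (hC' (w n) (hw n) x).trans (by
        gcongr
        exact ENNReal.toReal_le_coe_of_le_coe (hwK n))
      have hpt : ∀ x, Tendsto (fun n => m k n x) atTop (𝓝 0) := by
        intro x
        obtain ⟨B, hB⟩ := (continuous_scaled hη ((1 / 2) ^ k)).bounded_above_of_compact_support
          (hasCompactSupport_scaled hηc (by positivity))
        refine (hweak (fun y => scaled η ((1 / 2) ^ k) (x - y)) (MemLp.of_bound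
          ((continuous_scaled hη _).comp (by fun_prop)).aestronglyMeasurable B
          (Eventually.of_forall fun y => hB _))).congr fun n => ?_
        rw [← mollify_indicator η _ hΩ.measurableSet]
      have hlim := tendsto_lintegral_of_dominated_convergence (μ := μ)
        (F := fun n x => ‖m k n x‖ₑ ^ 4) (f := fun _ => 0)
        (fun _ => ENNReal.ofReal (C' * K) ^ 4) (fun n => ((hm k n).measurable.enorm.pow_const 4))
        (fun n => Eventually.of_forall fun x => by
          beta_reduce
          gcongr
          rw [← ofReal_norm]
          exact ENNReal.ofReal_le_ofReal (hbd n x))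
        (by simp only [lintegral_const]; finiteness)
        (Eventually.of_forall fun x => by
          have h1 := ENNReal.Tendsto.pow (n := 4) (hpt x).enorm
          simpa using h1)
      simp only [eLpNorm_four_eq]
      have := hlim.ennrpow_const (1 / 4)
      simpa using this
    rw [ENNReal.tendsto_nhds_zero]
    intro τ hτ
    have hCq : Tendsto (fun k : ℕ => ENNReal.ofReal (C * q ^ k) * K) atTop (𝓝 0) := by
      have h1 : Tendsto (fun k : ℕ => C * q ^ k) atTop (𝓝 0) := by
        simpa using (tendsto_pow_atTop_nhds_zero_of_lt_one hq0.le hq1).const_mul C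
      have h2 := ENNReal.Tendsto.mul_const (ENNReal.tendsto_ofReal h1)
        (b := (K : ℝ≥0∞)) (Or.inr ENNReal.coe_ne_top)
      simpa using h2
    have hτ2 : 0 < τ / 2 := ENNReal.half_pos hτ.ne'
    obtain ⟨k, hk⟩ := ((ENNReal.tendsto_nhds_zero.1 hCq) (τ / 2) hτ2).exists
    filter_upwards [(ENNReal.tendsto_nhds_zero.1 (hmlim k)) (τ / 2) hτ2] with n hn
    have e1 := eLpNorm_add_le (p := 4) ((hwm n).sub (hm k n).aestronglyMeasurable)
      (hm k n).aestronglyMeasurable (μ := μ) (by norm_num)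
    rw [sub_add_cancel] at e1
    refine e1.trans ?_
    rw [← ENNReal.add_halves τ]
    refine add_le_add (le_trans ?_ hk) hn
    refine (hC (w n) (g n) (hw n) (hg n) (hwg n) k).trans ?_
    gcongr
    exact hgK n

end SobolevGlobal

/-! ### Tangential derivatives near the boundary -/

section Tangential

variable {N : ℕ} {Ω : Set (Space N)}

lemma ae_restrict_abs_le_of_continuous (hΩ : IsOpen Ω) (hbdd : Bornology.IsBounded Ω)
    {f : Space N → ℝ} (hf : Continuous f) :
    ∃ C : ℝ, 0 ≤ C ∧ ∀ᵐ x ∂(volume.restrict Ω), ‖f x‖ ≤ C := by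
  obtain ⟨C, hC⟩ := hbdd.isCompact_closure.exists_bound_of_continuousOn hf.continuousOn
  refine ⟨|C|, abs_nonneg _, ?_⟩
  filter_upwards [ae_restrict_mem hΩ.measurableSet] with x hx
  exact (hC x (subset_closure hx)).trans (le_abs_self C)

lemma integrableOn_mul_of_continuous (hΩ : IsOpen Ω) (hbdd : Bornology.IsBounded Ω)
    {f w : Space N → ℝ} (hw : IntegrableOn w Ω) (hf : Continuous f) :
    IntegrableOn (fun x => w x * f x) Ω := by
  obtain ⟨C, -, hC⟩ := ae_restrict_abs_le_of_continuous hΩ hbdd hf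
  exact Integrable.mul_bdd hw hf.aestronglyMeasurable hC

lemma memLp_mul_of_continuous (hΩ : IsOpen Ω) (hbdd : Bornology.IsBounded Ω)
    {f w : Space N → ℝ} {p : ℝ≥0∞} (hw : MemLp w p (volume.restrict Ω)) (hf : Continuous f) :
    MemLp (fun x => w x * f x) p (volume.restrict Ω) := by
  obtain ⟨C, -, hC⟩ := ae_restrict_abs_le_of_continuous hΩ hbdd hf
  refine hw.of_le_mul (c := C) (hw.1.mul hf.aestronglyMeasurable) ?_
  filter_upwards [hC] with x hx
  rw [norm_mul, mul_comm]
  gcongr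

/-- Integration by parts along the vector field `χ (∂ⱼρ ∂ₖ - ∂ₖρ ∂ⱼ)`, which is tangent to the
level sets of the defining function `ρ`. No boundary term appears, whatever the boundary values of
`w`: the field annihilates `ρ`, so it does not see the cutoff functions `h(nρ)`. -/
lemma integral_tangential_deriv (hΩ : IsOpen Ω) (hbdd : Bornology.IsBounded Ω) {x₀ : Space N}
    {r : ℝ} {ρ χ φ : Space N → ℝ} (hρ : ContDiff ℝ 2 ρ) (hχ : ContDiff ℝ 1 χ)
    (hφ : ContDiff ℝ 1 φ) (hχc : HasCompactSupport χ) (hχs : tsupport χ ⊆ ball x₀ r)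
    (hiff : ∀ x ∈ ball x₀ r, x ∈ Ω ↔ 0 < ρ x) {j k : Fin N} {w wj wk : Space N → ℝ}
    (hw : IntegrableOn w Ω) (hwj : IntegrableOn wj Ω) (hwk : IntegrableOn wk Ω)
    (hj : HasWeakDeriv Ω w wj j) (hk : HasWeakDeriv Ω w wk k) :
    ∫ x in Ω, (χ x * pd j ρ x * wk x - χ x * pd k ρ x * wj x) * φ x
      = -∫ x in Ω, w x * (pd k (fun y => χ y * pd j ρ y * φ y) x
          - pd j (fun y => χ y * pd k ρ y * φ y) x) := by
  have hpd : ∀ i, ContDiff ℝ 1 (pd i ρ) := fun i => contDiff_pd hρ (by norm_num) i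
  let a : Fin N → Space N → ℝ := fun i y => χ y * pd i ρ y * φ y
  have ha : ∀ i, ContDiff ℝ 1 (a i) := fun i => (hχ.mul (hpd i)).mul hφ
  have has : ∀ i, Function.support (a i) ⊆ Function.support χ := fun i y hy h0 => hy (by
    simp [a, h0])
  have hats : ∀ i, tsupport (a i) ⊆ tsupport χ := fun i => closure_mono (has i)
  let t : ℕ → ℝ → ℝ := fun n s => Real.smoothTransition (n * s - 1)
  have ht : ∀ n, ContDiff ℝ 1 (t n) := fun n =>
    (Real.smoothTransition.contDiff (n := 1)).comp ((contDiff_const.mul contDiff_id).sub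
      contDiff_const)
  let h : ℕ → Space N → ℝ := fun n y => t n (ρ y)
  have hh : ∀ n, ContDiff ℝ 1 (h n) := fun n => (ht n).comp (hρ.of_le (by norm_num))
  have hpdh : ∀ n i y, pd i (h n) y = deriv (t n) (ρ y) * pd i ρ y := by
    intro n i y
    have h1 := ((ht n).differentiable (by norm_num) (ρ y)).hasDerivAt.comp_hasFDerivAt y
      ((hρ.differentiable (by norm_num) y).hasFDerivAt)
    have h2 : fderiv ℝ (h n) y = _ := h1.fderiv
    rw [pd, h2]
    simp [pd]
  -- the cut off fields are admissible in the definition of the weak derivatives of `w`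
  have hsupp : ∀ n i, tsupport (fun y => a i y * h n y) ⊆ tsupport χ ∩ {y | 1 ≤ n * ρ y} := by
    intro n i
    refine closure_minimal (fun y hy => ⟨subset_tsupport _ (has i ?_), ?_⟩)
      ((isClosed_tsupport χ).inter (isClosed_le continuous_const
        (continuous_const.mul hρ.continuous)))
    · intro h0
      exact hy (by simp [h0])
    · by_contra hlt
      refine hy ?_
      have : h n y = 0 := Real.smoothTransition.zero_of_nonpos
        (by simp only [mem_ofPred_eq, not_le] at hlt; linarith)
      simp [this]
  have hsub : ∀ n i, tsupport (fun y => a i y * h n y) ⊆ Ω := by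
    intro n i y hy
    obtain ⟨h1, h2⟩ := hsupp n i hy
    refine (hiff y (hχs h1)).2 ?_
    have h2' : 1 ≤ n * ρ y := h2
    by_contra hneg
    push Not at hneg
    have : (n : ℝ) * ρ y ≤ 0 := mul_nonpos_of_nonneg_of_nonpos (Nat.cast_nonneg n) hneg
    linarith
  have hcpt : ∀ n i, HasCompactSupport (fun y => a i y * h n y) := fun n i =>
    hχc.isCompact.of_isClosed_subset (isClosed_tsupport _) ((hsupp n i).trans inter_subset_left)
  have hah : ∀ n i, ContDiff ℝ 1 (fun y => a i y * h n y) := fun n i => (ha i).mul (hh n)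
  have hpdah : ∀ n i l y, pd l (fun y => a i y * h n y) y
      = pd l (a i) y * h n y + a i y * pd l (h n) y := fun n i l y =>
    pd_mul ((ha i).differentiable (by norm_num) y) ((hh n).differentiable (by norm_num) y) l
  have key : ∀ n, ∫ x in Ω, (χ x * pd j ρ x * wk x - χ x * pd k ρ x * wj x) * φ x * h n x
      = -∫ x in Ω, w x * (pd k (a j) x - pd j (a k) x) * h n x := by
    intro n
    have e1 := hk _ (hah n j) (hcpt n j) (hsub n j)
    have e2 := hj _ (hah n k) (hcpt n k) (hsub n k)
    have i1 := integrableOn_mul_of_continuous hΩ hbdd hwk (hah n j).continuous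
    have i2 := integrableOn_mul_of_continuous hΩ hbdd hwj (hah n k).continuous
    have i3 := integrableOn_mul_of_continuous hΩ hbdd hw (continuous_pd (hah n j) k)
    have i4 := integrableOn_mul_of_continuous hΩ hbdd hw (continuous_pd (hah n k) j)
    calc _ = ∫ x in Ω, (wk x * (a j x * h n x) - wj x * (a k x * h n x)) := by
          congr 1 with x
          simp only [a]
          ring
      _ = -((∫ x in Ω, w x * pd k (fun y => a j y * h n y) x)
            - ∫ x in Ω, w x * pd j (fun y => a k y * h n y) x) := by
          rw [integral_sub i1 i2, e1, e2]
          ring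
      _ = _ := by
          rw [← integral_sub i3 i4]
          congr 2 with x
          rw [hpdah, hpdah, hpdh, hpdh]
          simp only [a]
          ring
  have hlim : ∀ f : Space N → ℝ, IntegrableOn f Ω → (∀ x, x ∉ tsupport χ → f x = 0) →
      Tendsto (fun n : ℕ => ∫ x in Ω, f x * h n x) atTop (𝓝 (∫ x in Ω, f x)) := by
    intro f hf hf0
    refine tendsto_integral_of_dominated_convergence (fun x => ‖f x‖) ?_ hf.norm ?_ ?_
    · exact fun n => hf.1.mul (hh n).continuous.aestronglyMeasurable
    · intro n
      refine Eventually.of_forall fun x => ?_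
      rw [norm_mul, Real.norm_of_nonneg (r := h n x) (Real.smoothTransition.nonneg _)]
      exact mul_le_of_le_one_right (norm_nonneg _) (Real.smoothTransition.le_one _)
    · filter_upwards [ae_restrict_mem hΩ.measurableSet] with x hx
      by_cases hxs : x ∈ tsupport χ
      · have hpos : 0 < ρ x := (hiff x (hχs hxs)).1 hx
        obtain ⟨n₀, hn₀⟩ := exists_nat_ge (2 / ρ x)
        refine tendsto_const_nhds.congr' ?_
        filter_upwards [eventually_ge_atTop n₀] with n hn
        have h2 : (2 : ℝ) ≤ n * ρ x := by
          rw [← div_le_iff₀ hpos]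
          exact hn₀.trans (by exact_mod_cast hn)
        have : h n x = 1 := Real.smoothTransition.one_of_one_le (by linarith)
        rw [this, mul_one]
      · simp [hf0 x hxs]
  have i1 := integrableOn_mul_of_continuous hΩ hbdd hwk (ha j).continuous
  have i2 := integrableOn_mul_of_continuous hΩ hbdd hwj (ha k).continuous
  have l1 := hlim (fun x => (χ x * pd j ρ x * wk x - χ x * pd k ρ x * wj x) * φ x)
    ((i1.sub i2).congr (Eventually.of_forall fun x => by simp [a]; ring))
    (fun x hx => by simp [image_eq_zero_of_notMem_tsupport hx])
  have l2 := hlim (fun x => w x * (pd k (a j) x - pd j (a k) x))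
    (integrableOn_mul_of_continuous hΩ hbdd hw ((continuous_pd (ha j) k).sub
      (continuous_pd (ha k) j))) (fun x hx => by
      have h0 : ∀ i l, pd l (a i) x = 0 := fun i l => image_eq_zero_of_notMem_tsupport
        fun hc => hx (hats i (tsupport_pd_subset _ l hc))
      simp [h0])
  exact tendsto_nhds_unique l1 (l2.neg.congr fun n => (key n).symm)

/-- `p` is a gradient field of class `W^{1,2}(Ω)` with derivatives `A i j = ∂ⱼ pᵢ`, whose
potential vanishes on the boundary. The latter is expressed by the identity
`∫ pₖ ∂ₗΦ = ∫ pₗ ∂ₖΦ` for test functions `Φ` that need not vanish on the boundary. -/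
structure IsNormalGradient (Ω : Set (Space N)) (p : Fin N → Space N → ℝ)
    (A : Fin N → Fin N → Space N → ℝ) : Prop where
  memLp : ∀ i, MemLp (p i) 2 (volume.restrict Ω)
  memLp_deriv : ∀ i j, MemLp (A i j) 2 (volume.restrict Ω)
  hasWeakDeriv : ∀ i j, HasWeakDeriv Ω (p i) (A i j) j
  symm : ∀ i j, A i j =ᵐ[volume.restrict Ω] A j i
  integral_mul_pd : ∀ Φ : Space N → ℝ, ContDiff ℝ 2 Φ → ∀ k l,
    ∫ x in Ω, p k x * pd l Φ x = ∫ x in Ω, p l x * pd k Φ x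

/-- The derivative `∂ₗ(a pₖ)`. -/
def derivMul (p : Fin N → Space N → ℝ) (A : Fin N → Fin N → Space N → ℝ) (a : Space N → ℝ)
    (k l : Fin N) (x : Space N) : ℝ :=
  p k x * pd l a x + A k l x * a x

lemma IsNormalGradient.memLp_derivMul {p : Fin N → Space N → ℝ}
    {A : Fin N → Fin N → Space N → ℝ} (h : IsNormalGradient Ω p A) (hΩ : IsOpen Ω)
    (hbdd : Bornology.IsBounded Ω) {a : Space N → ℝ} (ha : ContDiff ℝ 1 a) (k l : Fin N) :
    MemLp (derivMul p A a k l) 2 (volume.restrict Ω) :=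
  (memLp_mul_of_continuous hΩ hbdd (h.memLp k) (continuous_pd ha l)).add
    (memLp_mul_of_continuous hΩ hbdd (h.memLp_deriv k l) ha.continuous)

lemma integrableOn_of_memLp_two (hbdd : Bornology.IsBounded Ω) {w : Space N → ℝ}
    (hw : MemLp w 2 (volume.restrict Ω)) : IntegrableOn w Ω := by
  have : IsFiniteMeasure (volume.restrict Ω) := ⟨by simpa using hbdd.measure_lt_top⟩
  exact hw.integrable (by norm_num)

/-- If integration by parts along the field `a ∂ₖ - b ∂ⱼ` produces no boundary terms, then the
extension by zero of `a pₖ - b pⱼ` has weak derivatives on the whole space. -/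
lemma IsNormalGradient.integral_extension {p : Fin N → Space N → ℝ}
    {A : Fin N → Fin N → Space N → ℝ} (h : IsNormalGradient Ω p A) (hΩ : IsOpen Ω)
    (hbdd : Bornology.IsBounded Ω) {a b : Space N → ℝ} (ha : ContDiff ℝ 2 a) (hb : ContDiff ℝ 2 b)
    {j k : Fin N} {φ : Space N → ℝ} (hφ : ContDiff ℝ 2 φ) (l : Fin N)
    (hab : ∫ x in Ω, (a x * A l k x - b x * A l j x) * φ x
      = -∫ x in Ω, p l x * (pd k (fun y => a y * φ y) x - pd j (fun y => b y * φ y) x)) :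
    ∫ x in Ω, (p k x * a x - p j x * b x) * pd l φ x
      = -∫ x in Ω, (derivMul p A a k l x - derivMul p A b j l x) * φ x := by
  have hI : ∀ {w : Space N → ℝ} {f : Space N → ℝ}, MemLp w 2 (volume.restrict Ω) → Continuous f →
      IntegrableOn (fun x => w x * f x) Ω := fun hw hf =>
    integrableOn_mul_of_continuous hΩ hbdd (integrableOn_of_memLp_two hbdd hw) hf
  have ha1 : ContDiff ℝ 1 a := ha.of_le (by norm_num)
  have hb1 : ContDiff ℝ 1 b := hb.of_le (by norm_num)
  have hφ1 : ContDiff ℝ 1 φ := hφ.of_le (by norm_num)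
  have cφ := hφ.continuous
  have eqa : ∀ i x, pd i (fun y => a y * φ y) x = pd i a x * φ x + a x * pd i φ x := fun i x =>
    pd_mul (ha1.differentiable (by norm_num) x) (hφ1.differentiable (by norm_num) x) i
  have eqb : ∀ i x, pd i (fun y => b y * φ y) x = pd i b x * φ x + b x * pd i φ x := fun i x =>
    pd_mul (hb1.differentiable (by norm_num) x) (hφ1.differentiable (by norm_num) x) i
  have t1 := h.integral_mul_pd _ (ha.mul hφ) k l
  have t2 := h.integral_mul_pd _ (hb.mul hφ) j l
  have i1 : IntegrableOn (fun x => p l x * pd k (fun y => a y * φ y) x) Ω :=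
    hI (h.memLp l) (continuous_pd (ha1.mul hφ1) k)
  have i2 : IntegrableOn (fun x => p l x * pd j (fun y => b y * φ y) x) Ω :=
    hI (h.memLp l) (continuous_pd (hb1.mul hφ1) j)
  have i3 : IntegrableOn (fun x => p k x * pd l (fun y => a y * φ y) x) Ω :=
    hI (h.memLp k) (continuous_pd (ha1.mul hφ1) l)
  have i4 : IntegrableOn (fun x => p j x * pd l (fun y => b y * φ y) x) Ω :=
    hI (h.memLp j) (continuous_pd (hb1.mul hφ1) l)
  have hab' : ∫ x in Ω, (A k l x * (a x * φ x) - A j l x * (b x * φ x))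
      = -((∫ x in Ω, p k x * pd l (fun y => a y * φ y) x)
        - ∫ x in Ω, p j x * pd l (fun y => b y * φ y) x) := by
    rw [t1, t2, ← integral_sub i1 i2]
    simp only [← mul_sub]
    rw [← hab]
    refine integral_congr_ae ?_
    filter_upwards [h.symm k l, h.symm j l] with x h1 h2
    rw [h1, h2]
    ring
  rw [← integral_sub i3 i4] at hab'
  have i5 : IntegrableOn (fun x => p k x * (pd l a x * φ x) - p j x * (pd l b x * φ x)) Ω :=
    (hI (h.memLp k) ((continuous_pd ha1 l).mul cφ)).sub
      (hI (h.memLp j) ((continuous_pd hb1 l).mul cφ))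
  have i6 : IntegrableOn (fun x => A k l x * (a x * φ x) - A j l x * (b x * φ x)) Ω :=
    (hI (h.memLp_deriv k l) (ha.continuous.mul cφ)).sub
      (hI (h.memLp_deriv j l) (hb.continuous.mul cφ))
  have e3 : ∫ x in Ω, (derivMul p A a k l x - derivMul p A b j l x) * φ x
      = (∫ x in Ω, (p k x * (pd l a x * φ x) - p j x * (pd l b x * φ x)))
        + ∫ x in Ω, (A k l x * (a x * φ x) - A j l x * (b x * φ x)) := by
    rw [← integral_add i5 i6]
    congr 1 with x
    simp only [derivMul]
    ring
  have i34 : IntegrableOn (fun x => p k x * pd l (fun y => a y * φ y) x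
      - p j x * pd l (fun y => b y * φ y) x) Ω := i3.sub i4
  rw [e3, hab', neg_add, neg_neg, neg_add_eq_sub, ← integral_sub i34 i5]
  congr 1 with x
  rw [eqa, eqb]
  ring

/-- The energy identity for a first derivative, tested with a function supported in `Ω`. Second
derivatives of `p` do not occur, and of its first derivatives only the divergence does. -/
lemma IsNormalGradient.integral_derivMul_mul_pd {p : Fin N → Space N → ℝ}
    {A : Fin N → Fin N → Space N → ℝ} (h : IsNormalGradient Ω p A) (hΩ : IsOpen Ω)
    (hbdd : Bornology.IsBounded Ω) {a : Space N → ℝ} (ha : ContDiff ℝ 2 a) (k l : Fin N)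
    {φ : Space N → ℝ} (hφ : ContDiff ℝ 2 φ) (hφc : HasCompactSupport φ) (hφs : tsupport φ ⊆ Ω) :
    ∫ x in Ω, derivMul p A a k l x * pd l φ x
      = (∫ x in Ω, p k x * (pd l a x * pd l φ x)) - (∫ x in Ω, p l x * (pd k a x * pd l φ x))
        + (∫ x in Ω, A l l x * (a x * pd k φ x)) + ∫ x in Ω, p l x * (pd l a x * pd k φ x) := by
  have hI : ∀ {w : Space N → ℝ} {f : Space N → ℝ}, MemLp w 2 (volume.restrict Ω) → Continuous f →
      IntegrableOn (fun x => w x * f x) Ω := fun hw hf =>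
    integrableOn_mul_of_continuous hΩ hbdd (integrableOn_of_memLp_two hbdd hw) hf
  have ha1 : ContDiff ℝ 1 a := ha.of_le (by norm_num)
  have hφ1 : ContDiff ℝ 1 φ := hφ.of_le (by norm_num)
  have hpdφ : ∀ i, ContDiff ℝ 1 (pd i φ) := fun i => contDiff_pd hφ (by norm_num) i
  have haφ : ∀ i, ContDiff ℝ 1 (fun y => a y * pd i φ y) := fun i => ha1.mul (hpdφ i)
  have hc : ∀ i, HasCompactSupport (fun y => a y * pd i φ y) := fun i =>
    (hasCompactSupport_pd hφc i).mul_left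
  have hs : ∀ i, tsupport (fun y => a y * pd i φ y) ⊆ Ω := fun i =>
    (tsupport_mul_subset_right.trans (tsupport_pd_subset φ i)).trans hφs
  have hpd : ∀ i m x, pd m (fun y => a y * pd i φ y) x
      = pd m a x * pd i φ x + a x * pd m (pd i φ) x := fun i m x =>
    pd_mul (ha1.differentiable (by norm_num) x) ((hpdφ i).differentiable (by norm_num) x) m
  have w1 := h.hasWeakDeriv l k _ (haφ l) (hc l) (hs l)
  have w2 := h.hasWeakDeriv l l _ (haφ k) (hc k) (hs k)
  have cpa : ∀ i, Continuous (pd i a) := continuous_pd ha1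
  have cpφ : ∀ i, Continuous (pd i φ) := continuous_pd hφ1
  have j1 := hI (f := fun x => pd l a x * pd l φ x) (h.memLp k)
    ((cpa l).mul (cpφ l))
  have j2 := hI (f := fun x => a x * pd l φ x) (h.memLp_deriv k l)
    (ha.continuous.mul (cpφ l))
  have j3 := hI (f := fun x => pd k a x * pd l φ x) (h.memLp l)
    ((cpa k).mul (cpφ l))
  have j4 := hI (f := fun x => pd l a x * pd k φ x) (h.memLp l)
    ((cpa l).mul (cpφ k))
  have j5 := hI (f := fun x => a x * pd k (pd l φ) x) (h.memLp l)
    (ha.continuous.mul (continuous_pd (hpdφ l) k))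
  have e0 : ∫ x in Ω, derivMul p A a k l x * pd l φ x
      = (∫ x in Ω, p k x * (pd l a x * pd l φ x)) + ∫ x in Ω, A k l x * (a x * pd l φ x) := by
    rw [← integral_add j1 j2]
    congr 1 with x
    simp only [derivMul]
    ring
  have e1 : ∫ x in Ω, A k l x * (a x * pd l φ x) = ∫ x in Ω, A l k x * (a x * pd l φ x) := by
    refine integral_congr_ae ?_
    filter_upwards [h.symm k l] with x hx
    rw [hx]
  have e2 : ∫ x in Ω, p l x * pd k (fun y => a y * pd l φ y) x
      = (∫ x in Ω, p l x * (pd k a x * pd l φ x))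
        + ∫ x in Ω, p l x * (a x * pd k (pd l φ) x) := by
    rw [← integral_add j3 j5]
    congr 1 with x
    rw [hpd]
    ring
  have e3 : ∫ x in Ω, p l x * pd l (fun y => a y * pd k φ y) x
      = (∫ x in Ω, p l x * (pd l a x * pd k φ x))
        + ∫ x in Ω, p l x * (a x * pd k (pd l φ) x) := by
    rw [← integral_add j4 j5]
    congr 1 with x
    rw [hpd, pd_pd_comm hφ l k]
    ring
  rw [e0, e1]
  rw [e2] at w1
  rw [e3] at w2
  linarith

end Tangential

section TangentialEstimate

variable {N : ℕ} {Ω : Set (Space N)}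

/-- The quantity that controls all second derivatives of a potential with gradient `p`: the `L²`
norms of the gradient and of the Laplacian. -/
def gradLapNorm (Ω : Set (Space N)) (p : Fin N → Space N → ℝ) (A : Fin N → Fin N → Space N → ℝ) :
    ℝ :=
  ∑ i, l2norm (volume.restrict Ω) (p i) + l2norm (volume.restrict Ω) (fun x => ∑ i, A i i x)

lemma l2norm_le_gradLapNorm (p : Fin N → Space N → ℝ) (A : Fin N → Fin N → Space N → ℝ)
    (i : Fin N) : l2norm (volume.restrict Ω) (p i) ≤ gradLapNorm Ω p A :=
  (Finset.single_le_sum (f := fun i => l2norm (volume.restrict Ω) (p i))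
    (fun _ _ => l2norm_nonneg _) (Finset.mem_univ i)).trans
    (le_add_of_nonneg_right (l2norm_nonneg _))

lemma sum_l2norm_le_gradLapNorm (p : Fin N → Space N → ℝ) (A : Fin N → Fin N → Space N → ℝ) :
    ∑ i, l2norm (volume.restrict Ω) (p i) ≤ gradLapNorm Ω p A :=
  le_add_of_nonneg_right (l2norm_nonneg _)

lemma l2norm_trace_le_gradLapNorm (p : Fin N → Space N → ℝ) (A : Fin N → Fin N → Space N → ℝ) :
    l2norm (volume.restrict Ω) (fun x => ∑ i, A i i x) ≤ gradLapNorm Ω p A :=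
  le_add_of_nonneg_left (Finset.sum_nonneg fun _ _ => l2norm_nonneg _)

lemma gradLapNorm_nonneg (p : Fin N → Space N → ℝ) (A : Fin N → Fin N → Space N → ℝ) :
    0 ≤ gradLapNorm Ω p A :=
  add_nonneg (Finset.sum_nonneg fun _ _ => l2norm_nonneg _) (l2norm_nonneg _)

lemma IsNormalGradient.abs_sum_integral_le {p : Fin N → Space N → ℝ}
    {A : Fin N → Fin N → Space N → ℝ} (h : IsNormalGradient Ω p A) (hΩ : IsOpen Ω)
    (hbdd : Bornology.IsBounded Ω) {a : Space N → ℝ} (ha : ContDiff ℝ 2 a) {M : ℝ}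
    (haM : ∀ x, |a x| ≤ M) (hdaM : ∀ i x, |pd i a x| ≤ M) (k : Fin N)
    {φ : Space N → ℝ} (hφ : ContDiff ℝ 2 φ) (hφc : HasCompactSupport φ) (hφs : tsupport φ ⊆ Ω) :
    |∑ l, ∫ x in Ω, derivMul p A a k l x * pd l φ x|
      ≤ 4 * M * gradLapNorm Ω p A * ∑ l, l2norm (volume.restrict Ω) (pd l φ) := by
  set μ := volume.restrict Ω with hμ
  set S := gradLapNorm Ω p A with hS
  set P := ∑ l, l2norm μ (pd l φ) with hP
  have hM0 : 0 ≤ M := (abs_nonneg _).trans (haM 0)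
  have hS0 : 0 ≤ S := gradLapNorm_nonneg p A
  have hP0 : 0 ≤ P := Finset.sum_nonneg fun _ _ => l2norm_nonneg _
  have hφ1 : ContDiff ℝ 1 φ := hφ.of_le (by norm_num)
  have ha1 : ContDiff ℝ 1 a := ha.of_le (by norm_num)
  have hml : ∀ i, MemLp (pd i φ) 2 μ := fun i =>
    ((continuous_pd hφ1 i).memLp_of_hasCompactSupport (hasCompactSupport_pd hφc i)).restrict _
  have hprod : ∀ (f c : Space N → ℝ) (i : Fin N), MemLp f 2 μ → Continuous c →
      (∀ x, |c x| ≤ M) → |∫ x in Ω, f x * (c x * pd i φ x)| ≤ l2norm μ f * (M * l2norm μ (pd i φ)) := by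
    intro f c i hf hc hcM
    have hm : MemLp (fun x => c x * pd i φ x) 2 μ := by
      have := memLp_mul_of_continuous hΩ hbdd (hml i) hc
      simpa only [mul_comm] using this
    refine (abs_integral_mul_le hf hm).trans ?_
    gcongr
    · exact l2norm_nonneg _
    · refine l2norm_le_mul hM0 (hml i) (Eventually.of_forall fun x => ?_)
      rw [abs_mul]
      gcongr
      exact hcM x
  have hPi : ∀ i, l2norm μ (pd i φ) ≤ P := fun i =>
    Finset.single_le_sum (f := fun i => l2norm μ (pd i φ))
      (fun _ _ => l2norm_nonneg _) (Finset.mem_univ i)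
  have h1 : |∑ l, ∫ x in Ω, p k x * (pd l a x * pd l φ x)| ≤ M * S * P := by
    refine (Finset.abs_sum_le_sum_abs _ _).trans ?_
    calc _ ≤ ∑ l, S * (M * l2norm μ (pd l φ)) := by
          refine Finset.sum_le_sum fun l _ => (hprod _ _ l (h.memLp k) (continuous_pd ha1 l)
            (hdaM l)).trans ?_
          gcongr
          · exact mul_nonneg hM0 (l2norm_nonneg _)
          · exact l2norm_le_gradLapNorm p A k
      _ = _ := by rw [← Finset.mul_sum, ← Finset.mul_sum]; ring
  have h2 : |∑ l, ∫ x in Ω, p l x * (pd k a x * pd l φ x)| ≤ M * S * P := by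
    refine (Finset.abs_sum_le_sum_abs _ _).trans ?_
    calc _ ≤ ∑ l, S * (M * l2norm μ (pd l φ)) := by
          refine Finset.sum_le_sum fun l _ => (hprod _ _ l (h.memLp l) (continuous_pd ha1 k)
            (hdaM k)).trans ?_
          gcongr
          · exact mul_nonneg hM0 (l2norm_nonneg _)
          · exact l2norm_le_gradLapNorm p A l
      _ = _ := by rw [← Finset.mul_sum, ← Finset.mul_sum]; ring
  have h3 : |∑ l, ∫ x in Ω, A l l x * (a x * pd k φ x)| ≤ M * S * P := by
    have hi : ∀ l ∈ Finset.univ, IntegrableOn (fun x => A l l x * (a x * pd k φ x)) Ω := fun l _ =>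
      integrableOn_mul_of_continuous hΩ hbdd (integrableOn_of_memLp_two hbdd (h.memLp_deriv l l))
        (ha.continuous.mul (continuous_pd hφ1 k))
    rw [← integral_finsetSum _ hi]
    simp only [← Finset.sum_mul]
    refine (hprod (fun x => ∑ l, A l l x) a k (memLp_finsetSum _ fun l _ => h.memLp_deriv l l)
      ha.continuous haM).trans ?_
    calc _ ≤ S * (M * P) := by
          gcongr
          · exact mul_nonneg hM0 (l2norm_nonneg _)
          · exact l2norm_trace_le_gradLapNorm p A
          · exact hPi k
      _ = _ := by ring
  have h4 : |∑ l, ∫ x in Ω, p l x * (pd l a x * pd k φ x)| ≤ M * S * P := by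
    refine (Finset.abs_sum_le_sum_abs _ _).trans ?_
    calc _ ≤ ∑ l, l2norm μ (p l) * (M * P) := by
          refine Finset.sum_le_sum fun l _ => (hprod _ _ k (h.memLp l) (continuous_pd ha1 l)
            (hdaM l)).trans ?_
          gcongr
          · exact l2norm_nonneg _
          · exact hPi k
      _ ≤ S * (M * P) := by
          rw [← Finset.sum_mul]
          gcongr
          exact sum_l2norm_le_gradLapNorm p A
      _ = _ := by ring
  rw [Finset.sum_congr rfl fun l _ => h.integral_derivMul_mul_pd hΩ hbdd ha k l hφ hφc hφs,
    Finset.sum_add_distrib, Finset.sum_add_distrib, Finset.sum_sub_distrib]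
  rw [abs_le] at *
  constructor <;> nlinarith

/-- If the extension by zero of `a pₖ - b pⱼ` has weak derivatives on the whole space, then its
gradient is controlled by the gradient and the Laplacian of the potential. The test function in the
energy identity is a mollification that moves the support into `Ω` along the inward cone. -/
theorem exists_sum_l2norm_derivMul_le (hΩ : IsOpen Ω) (hbdd : Bornology.IsBounded Ω)
    {x₀ ν : Space N} {r s : ℝ} (hs : 0 < s) (hcone : HasInwardCone Ω x₀ r ν s)
    {a b : Space N → ℝ} (ha : ContDiff ℝ 2 a) (hb : ContDiff ℝ 2 b) (hac : HasCompactSupport a)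
    (hbc : HasCompactSupport b) (har : tsupport a ⊆ ball x₀ r) (hbr : tsupport b ⊆ ball x₀ r)
    (j k : Fin N) :
    ∃ C : ℝ, 0 ≤ C ∧ ∀ (p : Fin N → Space N → ℝ) (A : Fin N → Fin N → Space N → ℝ),
      IsNormalGradient Ω p A →
      (∀ (l : Fin N) (φ : Space N → ℝ), ContDiff ℝ 2 φ →
        ∫ x in Ω, (p k x * a x - p j x * b x) * pd l φ x
          = -∫ x in Ω, (derivMul p A a k l x - derivMul p A b j l x) * φ x) →
      ∑ l, l2norm (volume.restrict Ω) (fun x => derivMul p A a k l x - derivMul p A b j l x)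
        ≤ C * gradLapNorm Ω p A := by
  obtain ⟨η, hη, h0, h1, hsupp⟩ := exists_profile ν hs
  have hηc : HasCompactSupport η :=
    (isCompact_closedBall _ _).of_isClosed_subset (isClosed_tsupport _) hsupp
  have hbound : ∀ f : Space N → ℝ, ContDiff ℝ 2 f → HasCompactSupport f →
      ∃ M : ℝ, (∀ x, |f x| ≤ M) ∧ ∀ i x, |pd i f x| ≤ M := by
    intro f hf hfc
    obtain ⟨M₀, hM₀⟩ := hf.continuous.bounded_above_of_compact_support hfc
    have hf1 : ContDiff ℝ 1 f := hf.of_le (by norm_num)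
    have := fun i => (continuous_pd hf1 i).bounded_above_of_compact_support
      (hasCompactSupport_pd hfc i)
    choose M₁ hM₁ using this
    have hM₁0 : ∀ i, 0 ≤ M₁ i := fun i => (norm_nonneg _).trans (hM₁ i 0)
    refine ⟨M₀ + ∑ i, M₁ i, fun x => (hM₀ x).trans (le_add_of_nonneg_right
      (Finset.sum_nonneg fun i _ => hM₁0 i)), fun i x => (hM₁ i x).trans ?_⟩
    refine (Finset.single_le_sum (f := M₁) (fun i _ => hM₁0 i) (Finset.mem_univ i)).trans ?_
    exact le_add_of_nonneg_left ((norm_nonneg _).trans (hM₀ 0))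
  obtain ⟨M, haM, hdaM⟩ := hbound a ha hac
  obtain ⟨M', hbM, hdbM⟩ := hbound b hb hbc
  have hM0 : 0 ≤ M := (abs_nonneg _).trans (haM 0)
  have hM'0 : 0 ≤ M' := (abs_nonneg _).trans (hbM 0)
  refine ⟨N * (4 * M + 4 * M'), by positivity, fun p A h hext => ?_⟩
  set μ := volume.restrict Ω with hμ
  set S := gradLapNorm Ω p A with hS
  have hS0 : 0 ≤ S := gradLapNorm_nonneg p A
  have ha1 : ContDiff ℝ 1 a := ha.of_le (by norm_num)
  have hb1 : ContDiff ℝ 1 b := hb.of_le (by norm_num)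
  let v : Space N → ℝ := fun x => p k x * a x - p j x * b x
  let dv : Fin N → Space N → ℝ := fun l x => derivMul p A a k l x - derivMul p A b j l x
  have hv : MemLp v 2 μ := (memLp_mul_of_continuous hΩ hbdd (h.memLp k) ha.continuous).sub
    (memLp_mul_of_continuous hΩ hbdd (h.memLp j) hb.continuous)
  have hda : ∀ l, MemLp (derivMul p A a k l) 2 μ := fun l => h.memLp_derivMul hΩ hbdd ha1 k l
  have hdb : ∀ l, MemLp (derivMul p A b j l) 2 μ := fun l => h.memLp_derivMul hΩ hbdd hb1 j l
  have hdv : ∀ l, MemLp (dv l) 2 μ := fun l => (hda l).sub (hdb l)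
  let V := Ω.indicator v
  let dV : Fin N → Space N → ℝ := fun l => Ω.indicator (dv l)
  have hV : MemLp V 2 := memLp_indicator_of_restrict hΩ.measurableSet hv
  have hdV : ∀ l, MemLp (dV l) 2 := fun l => memLp_indicator_of_restrict hΩ.measurableSet (hdv l)
  have hVloc : LocallyIntegrable V := hV.locallyIntegrable (by norm_num)
  let ε : ℕ → ℝ := fun n => 1 / ((n : ℝ) + 1)
  have hε0 : ∀ n, 0 < ε n := fun n => by positivity
  have hε1 : ∀ n, ε n ≤ 1 := fun n => by
    rw [div_le_one (by positivity)]
    linarith [(Nat.cast_nonneg n : (0 : ℝ) ≤ n)]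
  let φ : ℕ → Space N → ℝ := fun n => mollify η (ε n) V
  have hφ : ∀ n, ContDiff ℝ (⊤ : ℕ∞) (φ n) := fun n =>
    (hasCompactSupport_scaled hηc (hε0 n)).contDiff_convolution_right
      (ContinuousLinearMap.mul ℝ ℝ) hVloc (contDiff_scaled hη (ε n))
  have hφ2 : ∀ n, ContDiff ℝ 2 (φ n) := fun n => contDiff_infty.1 (hφ n) 2
  -- the supports of the mollifications are compact subsets of `Ω`
  let Q : Set (Space N) := closure Ω ∩ (tsupport a ∪ tsupport b)
  have hQ : IsCompact Q := hbdd.isCompact_closure.inter_right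
    ((isClosed_tsupport a).union (isClosed_tsupport b))
  let Q' : ℕ → Set (Space N) := fun n => (fun z : Space N × Space N => z.1 + ε n • z.2) ''
    (Q ×ˢ tsupport η)
  have hQ'c : ∀ n, IsCompact (Q' n) := fun n => (hQ.prod hηc.isCompact).image (by fun_prop)
  have hQ'Ω : ∀ n, Q' n ⊆ Ω := by
    rintro n _ ⟨⟨y, ζ⟩, ⟨hy, hζ⟩, rfl⟩
    exact hcone y ⟨hy.1, hy.2.elim (fun h => har h) (fun h => hbr h)⟩ ζ (hsupp hζ) _ (hε0 n) (hε1 n)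
  have hφs : ∀ n, tsupport (φ n) ⊆ Q' n := by
    intro n
    refine closure_minimal (fun x hx => ?_) (hQ'c n).isClosed
    by_contra hcon
    refine hx ?_
    simp only [φ, mollify]
    refine integral_eq_zero_of_ae (Eventually.of_forall fun y => ?_)
    by_cases hy : y ∈ Ω
    · by_cases hyt : y ∈ tsupport a ∪ tsupport b
      · have hζ : (ε n)⁻¹ • (x - y) ∉ tsupport η := by
          intro hζ
          refine hcon ⟨(y, (ε n)⁻¹ • (x - y)), ⟨⟨subset_closure hy, hyt⟩, hζ⟩, ?_⟩
          simp [smul_inv_smul₀ (hε0 n).ne']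
        simp [scaled, image_eq_zero_of_notMem_tsupport hζ]
      · simp only [mem_union, not_or] at hyt
        simp [V, hy, v, image_eq_zero_of_notMem_tsupport hyt.1,
          image_eq_zero_of_notMem_tsupport hyt.2]
    · simp [V, hy]
  have hφc : ∀ n, HasCompactSupport (φ n) := fun n =>
    (hQ'c n).of_isClosed_subset (isClosed_tsupport _) (hφs n)
  have hpdφ : ∀ n l, pd l (φ n) = mollify η (ε n) (dV l) := by
    intro n l
    ext x
    have hk1 : ContDiff ℝ 1 (scaled η (ε n)) := (contDiff_scaled hη _).of_le
      (by exact_mod_cast le_top)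
    have hkc := hasCompactSupport_scaled hηc (hε0 n)
    have hd := hkc.hasFDerivAt_convolution_right (L := ContinuousLinearMap.mul ℝ ℝ) hVloc hk1 x
    have e1 : pd l (φ n) x = ∫ y, V y * pd l (scaled η (ε n)) (x - y) := by
      have e2 : fderiv ℝ (φ n) x = _ := hd.fderiv
      rw [pd, e2, convolution_precompR_apply _ hVloc (hkc.fderiv ℝ)
        (hk1.continuous_fderiv (by norm_num))]
      rfl
    have hshift : ∀ y, pd l (fun y => scaled η (ε n) (x - y)) y = -pd l (scaled η (ε n)) (x - y) := by
      intro y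
      have h2 : HasFDerivAt (fun y : Space N => x - y) (-ContinuousLinearMap.id ℝ (Space N)) y :=
        (hasFDerivAt_id y).const_sub x
      have h3 : fderiv ℝ (fun y => scaled η (ε n) (x - y)) y = _ :=
        ((hk1.differentiable (by norm_num) (x - y)).hasFDerivAt.comp y h2).fderiv
      rw [pd, h3]
      simp [pd]
    have h4 := hext l (fun y => scaled η (ε n) (x - y))
      ((contDiff_infty.1 (contDiff_scaled hη _) 2).comp
        (contDiff_const.sub contDiff_id))
    simp only [hshift, mul_neg, integral_neg, neg_inj] at h4
    rw [e1, mollify_indicator η _ hΩ.measurableSet, ← h4, ← integral_indicator hΩ.measurableSet]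
    congr 1 with y
    by_cases hy : y ∈ Ω <;> simp [V, v, hy]
  have hmolm : ∀ n l, MemLp (mollify η (ε n) (dV l)) 2 := fun n l => by
    rw [← hpdφ]
    exact (continuous_pd ((hφ n).of_le (by exact_mod_cast le_top)) l).memLp_of_hasCompactSupport
      (hasCompactSupport_pd (hφc n) l)
  let x : Fin N → ℝ := fun l => l2norm μ (dv l)
  let e : Fin N → ℕ → ℝ := fun l n => l2norm μ (fun y => mollify η (ε n) (dV l) y - dv l y)
  have hmoln : ∀ n l, l2norm μ (pd l (φ n)) ≤ x l + e l n := by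
    intro n l
    have := l2norm_add_le (μ := μ) (hdv l) (((hmolm n l).restrict Ω).sub (hdv l))
    simp only [Pi.sub_apply, add_sub_cancel] at this
    rw [hpdφ]
    exact this
  have he : ∀ l, Tendsto (e l) atTop (𝓝 0) := by
    intro l
    have h2 : Tendsto ε atTop (𝓝[>] 0) := tendsto_nhdsWithin_iff.2
      ⟨tendsto_one_div_add_atTop_nhds_zero_nat, Eventually.of_forall hε0⟩
    have h3 := (tendsto_mollify hη.continuous hηc h0 h1 (hdV l)).comp h2
    have h4 := (ENNReal.tendsto_toReal ENNReal.zero_ne_top).comp h3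
    rw [ENNReal.toReal_zero] at h4
    refine squeeze_zero (fun _ => l2norm_nonneg _) (fun n => ?_) h4
    have e1 : e l n = l2norm μ (fun y => mollify η (ε n) (dV l) y - dV l y) := by
      refine l2norm_congr ?_
      filter_upwards [ae_restrict_mem hΩ.measurableSet] with y hy
      simp [dV, hy]
    rw [e1]
    exact l2norm_mono_measure ((hmolm n l).sub (hdV l)) Measure.restrict_le_self
  have hlow : ∀ n l, x l ^ 2 - x l * e l n ≤ ∫ y in Ω, dv l y * pd l (φ n) y := by
    intro n l
    have hm : MemLp (fun y => mollify η (ε n) (dV l) y - dv l y) 2 μ :=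
      ((hmolm n l).restrict Ω).sub (hdv l)
    have h2 := abs_integral_mul_le (hdv l) hm
    have h3 : ∫ y in Ω, dv l y * pd l (φ n) y
        = (∫ y in Ω, dv l y ^ 2) + ∫ y in Ω, dv l y * (mollify η (ε n) (dV l) y - dv l y) := by
      have i1 : Integrable (fun y => dv l y * (mollify η (ε n) (dV l) y - dv l y)) μ :=
        (hdv l).integrable_mul hm
      rw [← integral_add (hdv l).integrable_sq i1, hpdφ]
      congr 1 with y
      ring
    rw [h3, ← l2norm_sq (hdv l)]
    have h4 := (abs_le.1 h2).1
    simp only [x, e]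
    linarith
  have hup : ∀ n, ∑ l, ∫ y in Ω, dv l y * pd l (φ n) y
      ≤ (4 * M + 4 * M') * S * ∑ l, l2norm μ (pd l (φ n)) := by
    intro n
    have u1 := h.abs_sum_integral_le hΩ hbdd ha haM hdaM k (hφ2 n) (hφc n)
      ((hφs n).trans (hQ'Ω n))
    have u2 := h.abs_sum_integral_le hΩ hbdd hb hbM hdbM j (hφ2 n) (hφc n)
      ((hφs n).trans (hQ'Ω n))
    have e1 : ∑ l, ∫ y in Ω, dv l y * pd l (φ n) y
        = (∑ l, ∫ y in Ω, derivMul p A a k l y * pd l (φ n) y)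
          - ∑ l, ∫ y in Ω, derivMul p A b j l y * pd l (φ n) y := by
      rw [← Finset.sum_sub_distrib]
      refine Finset.sum_congr rfl fun l _ => ?_
      have hm : MemLp (pd l (φ n)) 2 μ := by rw [hpdφ]; exact (hmolm n l).restrict _
      have i1 : Integrable (fun y => derivMul p A a k l y * pd l (φ n) y) μ :=
        (hda l).integrable_mul hm
      have i2 : Integrable (fun y => derivMul p A b j l y * pd l (φ n) y) μ :=
        (hdb l).integrable_mul hm
      rw [← integral_sub i1 i2]
      congr 1 with y
      simp only [dv]
      ring
    rw [e1]
    linarith [(abs_le.1 u1).2, (abs_le.1 u2).1]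
  have hx0 : ∀ l, 0 ≤ x l := fun l => l2norm_nonneg _
  have hlimit : ∑ l, x l ^ 2 ≤ (4 * M + 4 * M') * S * ∑ l, x l := by
    have hfin : ∀ n, ∑ l, (x l ^ 2 - x l * e l n) ≤ (4 * M + 4 * M') * S * ∑ l, (x l + e l n) := by
      intro n
      refine (Finset.sum_le_sum fun l _ => hlow n l).trans ((hup n).trans ?_)
      gcongr with l
      exact hmoln n l
    have t1 : Tendsto (fun n => ∑ l, (x l ^ 2 - x l * e l n)) atTop (𝓝 (∑ l, x l ^ 2)) := by
      refine tendsto_finsetSum _ fun l _ => ?_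
      simpa using ((he l).const_mul (x l)).const_sub (x l ^ 2)
    have t2 : Tendsto (fun n => (4 * M + 4 * M') * S * ∑ l, (x l + e l n)) atTop
        (𝓝 ((4 * M + 4 * M') * S * ∑ l, x l)) := by
      refine Tendsto.const_mul _ (tendsto_finsetSum _ fun l _ => ?_)
      simpa using (he l).const_add (x l)
    exact le_of_tendsto_of_tendsto' t1 t2 hfin
  have hcs : (∑ l, x l) ^ 2 ≤ N * ∑ l, x l ^ 2 := by
    simpa using sq_sum_le_card_mul_sum_sq (s := Finset.univ) (f := x)
  have hX0 : 0 ≤ ∑ l, x l := Finset.sum_nonneg fun l _ => hx0 l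
  change ∑ l, x l ≤ _
  rcases hX0.eq_or_lt with hX | hX
  · rw [← hX]
    positivity
  · have h5 : (∑ l, x l) * (∑ l, x l) ≤ (N * (4 * M + 4 * M') * S) * ∑ l, x l := by
      calc (∑ l, x l) * (∑ l, x l) = (∑ l, x l) ^ 2 := by ring
        _ ≤ N * ((4 * M + 4 * M') * S * ∑ l, x l) := hcs.trans (by gcongr)
        _ = _ := by ring
    exact le_of_mul_le_mul_right h5 hX

end TangentialEstimate

/-! ### Second derivatives are controlled by the gradient and the Laplacian -/

section SecondDerivatives

variable {N : ℕ} {Ω : Set (Space N)}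

lemma l2norm_abs {α : Type*} [MeasurableSpace α] {μ : Measure α} (f : α → ℝ) :
    l2norm μ (fun x => |f x|) = l2norm μ f := by
  rw [l2norm, l2norm]
  simp only [← Real.norm_eq_abs, eLpNorm_norm]

lemma exists_bound_pd {f : Space N → ℝ} (hf : ContDiff ℝ 1 f) (hfc : HasCompactSupport f) :
    ∃ M : ℝ, 0 ≤ M ∧ (∀ x, |f x| ≤ M) ∧ ∀ i x, |pd i f x| ≤ M := by
  obtain ⟨M₀, hM₀⟩ := hf.continuous.bounded_above_of_compact_support hfc
  have := fun i => (continuous_pd hf i).bounded_above_of_compact_support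
    (hasCompactSupport_pd hfc i)
  choose M₁ hM₁ using this
  have hM₁0 : ∀ i, 0 ≤ M₁ i := fun i => (norm_nonneg _).trans (hM₁ i 0)
  have hM₀0 : 0 ≤ M₀ := (norm_nonneg _).trans (hM₀ 0)
  have hs : 0 ≤ ∑ i, M₁ i := Finset.sum_nonneg fun i _ => hM₁0 i
  refine ⟨M₀ + ∑ i, M₁ i, by positivity, fun x => (hM₀ x).trans (le_add_of_nonneg_right hs),
    fun i x => (hM₁ i x).trans ?_⟩
  exact (Finset.single_le_sum (f := M₁) (fun i _ => hM₁0 i) (Finset.mem_univ i)).trans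
    (le_add_of_nonneg_left hM₀0)

/-- A symmetric matrix is controlled by its trace and by its tangential parts
`gⱼ Aₖₗ - gₖ Aⱼₗ` with respect to a vector `g ≠ 0`. -/
lemma abs_le_of_tangential {g : Fin N → ℝ} {A : Fin N → Fin N → ℝ} {c M β : ℝ}
    (hsymm : ∀ i j, A i j = A j i) (hc : c ≤ ∑ i, g i ^ 2) (hM : ∀ i, |g i| ≤ M)
    (hβ : ∀ j k l, |g j * A k l - g k * A j l| ≤ β) (k l : Fin N) :
    c * |A k l| ≤ 2 * N * M * β + M ^ 2 * |∑ i, A i i| := by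
  have hM0 : 0 ≤ M := (abs_nonneg _).trans (hM k)
  have hβ0 : 0 ≤ β := (abs_nonneg _).trans (hβ k k k)
  have e1 : (∑ i, g i ^ 2) * A k l = ∑ j, g j * (g j * A k l - g k * A j l)
      + g k * (g l * ∑ i, A i i - ∑ j, (g l * A j j - g j * A l j)) := by
    simp only [Finset.sum_mul, Finset.mul_sum, ← Finset.sum_sub_distrib, ← Finset.sum_add_distrib]
    refine Finset.sum_congr rfl fun j _ => ?_
    rw [hsymm l j]
    ring
  have b1 : |∑ j, g j * (g j * A k l - g k * A j l)| ≤ N * (M * β) := by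
    refine (Finset.abs_sum_le_sum_abs _ _).trans ?_
    calc _ ≤ ∑ _j : Fin N, M * β := Finset.sum_le_sum fun j _ => by
          rw [abs_mul]
          exact mul_le_mul (hM j) (hβ j k l) (abs_nonneg _) hM0
      _ = _ := by simp
  have b2 : |∑ j, (g l * A j j - g j * A l j)| ≤ N * β := by
    refine (Finset.abs_sum_le_sum_abs _ _).trans ?_
    calc _ ≤ ∑ _j : Fin N, β := Finset.sum_le_sum fun j _ => hβ l j j
      _ = _ := by simp
  calc c * |A k l| ≤ (∑ i, g i ^ 2) * |A k l| := by gcongr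
    _ = |(∑ i, g i ^ 2) * A k l| := by
        rw [abs_mul, abs_of_nonneg (a := ∑ i, g i ^ 2) (Finset.sum_nonneg fun i _ => sq_nonneg _)]
    _ ≤ N * (M * β) + M * (M * |∑ i, A i i| + N * β) := by
        rw [e1]
        refine (abs_add_le _ _).trans (add_le_add b1 ?_)
        rw [abs_mul]
        refine mul_le_mul (hM k) ((abs_sub _ _).trans (add_le_add ?_ b2)) (abs_nonneg _) hM0
        rw [abs_mul]
        gcongr
        exact hM l
    _ = _ := by ring

/-- Interior estimate for the second derivatives. -/
lemma exists_l2norm_deriv_le_of_mem (hΩ : IsOpen Ω) (hbdd : Bornology.IsBounded Ω) {x₀ : Space N}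
    (hx₀ : x₀ ∈ Ω) :
    ∃ t : ℝ, 0 < t ∧ ∃ C : ℝ, 0 ≤ C ∧ ∀ (p : Fin N → Space N → ℝ)
      (A : Fin N → Fin N → Space N → ℝ), IsNormalGradient Ω p A → ∀ k l,
        l2norm (volume.restrict (Ω ∩ ball x₀ t)) (A k l) ≤ C * gradLapNorm Ω p A := by
  obtain ⟨r₁, ν, s, hr₁, hs, hcone⟩ := exists_inwardCone_of_mem hΩ hx₀
  obtain ⟨r₂, hr₂, hball⟩ := Metric.isOpen_iff.1 hΩ x₀ hx₀
  set r := min r₁ r₂ with hr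
  have hr0 : 0 < r := lt_min hr₁ hr₂
  let χ : ContDiffBump x₀ := ⟨r / 3, r / 2, by positivity, by linarith⟩
  have hχ : ∀ n : ℕ, ContDiff ℝ n χ := fun n => χ.contDiff
  have hχc : HasCompactSupport χ := χ.hasCompactSupport
  have hχs : tsupport χ ⊆ ball x₀ r := by
    rw [χ.tsupport_eq]
    exact closedBall_subset_ball (by change r / 2 < r; linarith)
  obtain ⟨M, hM0, -, hM⟩ := exists_bound_pd (hχ 1) hχc
  have hz : ContDiff ℝ 2 (fun _ : Space N => (0 : ℝ)) := contDiff_const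
  have := fun k => exists_sum_l2norm_derivMul_le hΩ hbdd hs (hcone.mono (min_le_left r₁ r₂))
    (hχ 2) hz hχc HasCompactSupport.zero hχs (by simp [tsupport]) k k
  choose C hC0 hC using this
  refine ⟨r / 3, by positivity, ∑ k, C k + M, add_nonneg (Finset.sum_nonneg fun k _ => hC0 k) hM0,
    fun p A h k l => ?_⟩
  have hext := hC k p A h (fun l φ hφ => h.integral_extension hΩ hbdd (hχ 2) hz hφ l (by
    have := h.hasWeakDeriv l k (fun y => χ y * φ y) ((hχ 1).mul (hφ.of_le (by norm_num)))
      hχc.mul_right ((tsupport_mul_subset_left.trans hχs).trans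
        ((ball_subset_ball (min_le_right _ _)).trans hball))
    have e0 : ∀ x, pd k (fun _ : Space N => (0 : ℝ)) x = 0 := fun x => by
      simp [pd]
    simp only [zero_mul, e0, sub_zero]
    rw [this, neg_neg]
    congr 1 with x
    ring))
  have e0 : ∀ l x, derivMul p A (fun _ => 0) k l x = 0 := fun l x => by simp [derivMul, pd]
  simp only [e0, sub_zero] at hext
  set S := gradLapNorm Ω p A
  have hS : 0 ≤ S := gradLapNorm_nonneg p A
  set μ := volume.restrict (Ω ∩ ball x₀ (r / 3)) with hμ
  have hμΩ : μ ≤ volume.restrict Ω := Measure.restrict_mono_set _ inter_subset_left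
  have hd := h.memLp_derivMul hΩ hbdd (hχ 1) k l
  have hp := memLp_mul_of_continuous hΩ hbdd (h.memLp k) (continuous_pd (hχ 1) l)
  have e1 : l2norm μ (A k l) = l2norm μ (fun x => derivMul p A χ k l x - p k x * pd l χ x) := by
    refine l2norm_congr ?_
    filter_upwards [ae_restrict_mem (hΩ.measurableSet.inter measurableSet_ball)] with x hx
    have : χ x = 1 := χ.one_of_mem_closedBall (ball_subset_closedBall hx.2)
    simp [derivMul, this]
  calc l2norm μ (A k l) ≤ l2norm μ (derivMul p A χ k l) + l2norm μ (fun x => p k x * pd l χ x) := by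
        rw [e1]
        exact l2norm_sub_le (hd.mono_measure hμΩ) (hp.mono_measure hμΩ)
    _ ≤ C k * S + M * S := by
        refine add_le_add ((l2norm_mono_measure hd hμΩ).trans
          ((Finset.single_le_sum (f := fun l => l2norm (volume.restrict Ω) (derivMul p A χ k l))
            (fun _ _ => l2norm_nonneg _) (Finset.mem_univ l)).trans hext))
          ((l2norm_mono_measure hp hμΩ).trans ((l2norm_le_mul hM0 (h.memLp k)
            (Eventually.of_forall fun x => ?_)).trans
              (mul_le_mul_of_nonneg_left (l2norm_le_gradLapNorm p A k) hM0)))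
        rw [abs_mul, mul_comm]
        gcongr
        exact hM l x
    _ ≤ (∑ k, C k + M) * S := by
        rw [add_mul]
        gcongr
        exact Finset.single_le_sum (fun k _ => hC0 k) (Finset.mem_univ k)

/-- Boundary estimate for the second derivatives. -/
lemma exists_l2norm_deriv_le_of_definingFunction (hΩ : IsOpen Ω) (hbdd : Bornology.IsBounded Ω)
    {x₀ : Space N} {r : ℝ} {ρ : Space N → ℝ} (hr : 0 < r) (hρ : ContDiff ℝ 3 ρ)
    (hd : fderiv ℝ ρ x₀ ≠ 0)
    (hiff : ∀ x ∈ ball x₀ r, (x ∈ Ω ↔ 0 < ρ x) ∧ (x ∈ frontier Ω ↔ ρ x = 0)) :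
    ∃ t : ℝ, 0 < t ∧ ∃ C : ℝ, 0 ≤ C ∧ ∀ (p : Fin N → Space N → ℝ)
      (A : Fin N → Fin N → Space N → ℝ), IsNormalGradient Ω p A → ∀ k l,
        l2norm (volume.restrict (Ω ∩ ball x₀ t)) (A k l) ≤ C * gradLapNorm Ω p A := by
  obtain ⟨r₁, ν, s, hr₁, hs, hcone⟩ :=
    exists_inwardCone_of_definingFunction hr (hρ.of_le (by norm_num)) hd hiff
  set R := min r₁ r with hR
  have hR0 : 0 < R := lt_min hr₁ hr
  let χ : ContDiffBump x₀ := ⟨R / 3, R / 2, by positivity, by linarith⟩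
  have hχ : ∀ n : ℕ, ContDiff ℝ n χ := fun n => χ.contDiff
  have hχc : HasCompactSupport χ := χ.hasCompactSupport
  have hχs : tsupport χ ⊆ ball x₀ R := by
    rw [χ.tsupport_eq]
    exact closedBall_subset_ball (by change R / 2 < R; linarith)
  have hg : ∀ i, ContDiff ℝ 2 (pd i ρ) := fun i => contDiff_pd hρ (by norm_num) i
  let a : Fin N → Space N → ℝ := fun i x => χ x * pd i ρ x
  have ha : ∀ i, ContDiff ℝ 2 (a i) := fun i => (hχ 2).mul (hg i)
  have ha1 : ∀ i, ContDiff ℝ 1 (a i) := fun i => (ha i).of_le (by norm_num)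
  have hac : ∀ i, HasCompactSupport (a i) := fun i => hχc.mul_right
  have has : ∀ i, tsupport (a i) ⊆ ball x₀ R := fun i => tsupport_mul_subset_left.trans hχs
  have := fun j k => exists_sum_l2norm_derivMul_le hΩ hbdd hs (hcone.mono (min_le_left r₁ r))
    (ha j) (ha k) (hac j) (hac k) (has j) (has k) j k
  choose C hC0 hC using this
  have := fun i => exists_bound_pd (ha1 i) (hac i)
  choose M₁ hM₁0 hM₁ hM₁' using this
  set M := ∑ i, M₁ i with hMdef
  have hM0 : 0 ≤ M := Finset.sum_nonneg fun i _ => hM₁0 i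
  have hMle : ∀ i, M₁ i ≤ M := fun i => Finset.single_le_sum (fun i _ => hM₁0 i) (Finset.mem_univ i)
  -- the gradient of `ρ` is bounded away from zero near `x₀`
  obtain ⟨c, hc0, hcx⟩ : ∃ c : ℝ, 0 < c ∧ c < ∑ i, pd i ρ x₀ ^ 2 := by
    refine exists_between (lt_of_le_of_ne (Finset.sum_nonneg fun i _ => sq_nonneg _) fun h0 => hd ?_)
    have h1 := (Finset.sum_eq_zero_iff_of_nonneg fun i _ => sq_nonneg (pd i ρ x₀)).1 h0.symm
    have h2 : ∀ i, fderiv ℝ ρ x₀ (EuclideanSpace.single i 1) = 0 := fun i => by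
      have := h1 i (Finset.mem_univ i)
      exact pow_eq_zero_iff (n := 2) (by norm_num) |>.1 this
    refine ContinuousLinearMap.coe_injective ((EuclideanSpace.basisFun (Fin N) ℝ).toBasis.ext
      fun i => ?_)
    simpa using h2 i
  have hcont : Continuous fun x => ∑ i, pd i ρ x ^ 2 :=
    continuous_finsetSum _ fun i _ => (hg i).continuous.pow 2
  obtain ⟨t₁, ht₁, hball⟩ := Metric.mem_nhds_iff.1 (hcont.continuousAt.eventually (lt_mem_nhds hcx))
  set t := min t₁ (R / 3) with ht
  have ht0 : 0 < t := lt_min ht₁ (by positivity)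
  set K := ∑ j, ∑ k, C j k with hK
  have hK0 : 0 ≤ K := Finset.sum_nonneg fun j _ => Finset.sum_nonneg fun k _ => hC0 j k
  refine ⟨t, ht0, c⁻¹ * (2 * N * M * (K + 2 * M) + M ^ 2), by positivity, fun p A h k l => ?_⟩
  set S := gradLapNorm Ω p A
  have hS : 0 ≤ S := gradLapNorm_nonneg p A
  let v : Fin N → Fin N → Fin N → Space N → ℝ := fun j k l x =>
    derivMul p A (a j) k l x - derivMul p A (a k) j l x
  have hvm : ∀ j k l, MemLp (v j k l) 2 (volume.restrict Ω) := fun j k l =>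
    (h.memLp_derivMul hΩ hbdd (ha1 j) k l).sub (h.memLp_derivMul hΩ hbdd (ha1 k) j l)
  have hv : ∀ j k, ∑ l, l2norm (volume.restrict Ω) (v j k l) ≤ C j k * S := by
    refine fun j k => hC j k p A h fun l φ hφ => h.integral_extension hΩ hbdd (ha j) (ha k) hφ l ?_
    exact integral_tangential_deriv hΩ hbdd (hρ.of_le (by norm_num)) (hχ 1)
      (hφ.of_le (by norm_num)) hχc (hχs.trans (ball_subset_ball (min_le_right _ _)))
      (fun x hx => (hiff x hx).1) (integrableOn_of_memLp_two hbdd (h.memLp l))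
      (integrableOn_of_memLp_two hbdd (h.memLp_deriv l j))
      (integrableOn_of_memLp_two hbdd (h.memLp_deriv l k)) (h.hasWeakDeriv l j) (h.hasWeakDeriv l k)
  let β₁ : Space N → ℝ := fun x => ∑ j, ∑ k, ∑ l, |v j k l x|
  let β₂ : Space N → ℝ := fun x => ∑ i, |p i x|
  let f : Space N → ℝ := fun x => ∑ i, A i i x
  have hβ₁ : MemLp β₁ 2 (volume.restrict Ω) := memLp_finsetSum _ fun j _ =>
    memLp_finsetSum _ fun k _ => memLp_finsetSum _ fun l _ => (hvm j k l).abs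
  have hβ₂ : MemLp β₂ 2 (volume.restrict Ω) := memLp_finsetSum _ fun i _ => (h.memLp i).abs
  have hf : MemLp f 2 (volume.restrict Ω) := memLp_finsetSum _ fun i _ => h.memLp_deriv i i
  have nβ₁ : l2norm (volume.restrict Ω) β₁ ≤ K * S := by
    refine (l2norm_sum_le _ fun j _ => memLp_finsetSum _ fun k _ =>
      memLp_finsetSum _ fun l _ => (hvm j k l).abs).trans ?_
    rw [hK, Finset.sum_mul]
    refine Finset.sum_le_sum fun j _ => (l2norm_sum_le _ fun k _ =>
      memLp_finsetSum _ fun l _ => (hvm j k l).abs).trans ?_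
    rw [Finset.sum_mul]
    refine Finset.sum_le_sum fun k _ => (l2norm_sum_le _ (f := fun l x => |v j k l x|)
      fun l _ => (hvm j k l).abs).trans ?_
    simp only [l2norm_abs]
    exact hv j k
  have nβ₂ : l2norm (volume.restrict Ω) β₂ ≤ S := by
    refine (l2norm_sum_le _ (f := fun i x => |p i x|) fun i _ => (h.memLp i).abs).trans ?_
    simp only [l2norm_abs]
    exact sum_l2norm_le_gradLapNorm p A
  have nf : l2norm (volume.restrict Ω) f ≤ S := l2norm_trace_le_gradLapNorm p A
  have hpt : ∀ᵐ x ∂(volume.restrict (Ω ∩ ball x₀ t)), |A k l x|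
      ≤ c⁻¹ * |2 * N * M * (β₁ x + 2 * M * β₂ x) + M ^ 2 * abs (f x)| := by
    have hsymm : ∀ᵐ x ∂(volume.restrict (Ω ∩ ball x₀ t)), ∀ i j, A i j x = A j i x := by
      refine ae_all_iff.2 fun i => ae_all_iff.2 fun j => ?_
      exact ae_restrict_of_ae_restrict_of_subset inter_subset_left (h.symm i j)
    filter_upwards [hsymm, ae_restrict_mem (hΩ.measurableSet.inter measurableSet_ball)] with x hsx hx
    have hχ1 : χ x = 1 := χ.one_of_mem_closedBall
      (ball_subset_closedBall (ball_subset_ball (min_le_right _ _) hx.2))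
    have hax : ∀ i, a i x = pd i ρ x := fun i => by simp [a, hχ1]
    have hcx : c ≤ ∑ i, pd i ρ x ^ 2 :=
      (hball (ball_subset_ball (min_le_left _ _) hx.2)).le
    have hpx : ∀ i, |p i x| ≤ β₂ x := fun i => Finset.single_le_sum (f := fun i => |p i x|)
      (fun _ _ => abs_nonneg _) (Finset.mem_univ i)
    have hvx : ∀ j k l, |v j k l x| ≤ β₁ x := fun j k l => by
      refine (Finset.single_le_sum (f := fun l => |v j k l x|)
        (fun _ _ => abs_nonneg _) (Finset.mem_univ l)).trans ?_
      refine (Finset.single_le_sum (f := fun k => ∑ l, |v j k l x|)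
        (fun _ _ => Finset.sum_nonneg fun _ _ => abs_nonneg _) (Finset.mem_univ k)).trans ?_
      exact Finset.single_le_sum (f := fun j => ∑ k, ∑ l, |v j k l x|)
        (fun _ _ => Finset.sum_nonneg fun _ _ => Finset.sum_nonneg fun _ _ => abs_nonneg _)
        (Finset.mem_univ j)
    have hpr : ∀ i j l, |p i x * pd l (a j) x| ≤ M * β₂ x := fun i j l => by
      rw [abs_mul, mul_comm]
      exact mul_le_mul ((hM₁' j l x).trans (hMle j)) (hpx i) (abs_nonneg _) hM0
    have key := abs_le_of_tangential (g := fun i => pd i ρ x) (A := fun i j => A i j x)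
      (β := β₁ x + 2 * M * β₂ x) (M := M) hsx hcx
      (fun i => by rw [← hax]; exact (hM₁ i x).trans (hMle i)) (fun j k l => by
        have e : pd j ρ x * A k l x - pd k ρ x * A j l x
            = v j k l x - p k x * pd l (a j) x + p j x * pd l (a k) x := by
          simp only [v, derivMul, hax]
          ring
        rw [e]
        have h1 := abs_add_le (v j k l x - p k x * pd l (a j) x) (p j x * pd l (a k) x)
        have h2 := abs_sub (v j k l x) (p k x * pd l (a j) x)
        linarith [hvx j k l, hpr k j l, hpr j k l]) k l
    rw [le_inv_mul_iff₀ hc0]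
    exact key.trans (le_abs_self _)
  have hβm : MemLp (fun x => β₁ x + 2 * M * β₂ x) 2 (volume.restrict Ω) :=
    hβ₁.add (hβ₂.const_mul _)
  have hT : MemLp (fun x => 2 * N * M * (β₁ x + 2 * M * β₂ x) + M ^ 2 * |f x|) 2
      (volume.restrict Ω) := (hβm.const_mul _).add (hf.abs.const_mul _)
  have hμΩ : volume.restrict (Ω ∩ ball x₀ t) ≤ volume.restrict Ω :=
    Measure.restrict_mono_set _ inter_subset_left
  have hsc : ∀ (C : ℝ) {w : Space N → ℝ}, 0 ≤ C → MemLp w 2 (volume.restrict Ω) →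
      l2norm (volume.restrict Ω) (fun x => C * w x) ≤ C * l2norm (volume.restrict Ω) w :=
    fun C w hC hw => l2norm_le_mul hC hw (Eventually.of_forall fun x => by
      rw [abs_mul, abs_of_nonneg hC])
  refine (l2norm_le_mul (inv_nonneg.2 hc0.le) (hT.mono_measure hμΩ) hpt).trans ?_
  rw [mul_assoc c⁻¹]
  refine mul_le_mul_of_nonneg_left ((l2norm_mono_measure hT hμΩ).trans ?_) (inv_nonneg.2 hc0.le)
  calc _ ≤ 2 * N * M * (l2norm (volume.restrict Ω) β₁ + 2 * M * l2norm (volume.restrict Ω) β₂)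
        + M ^ 2 * l2norm (volume.restrict Ω) f := by
        refine (l2norm_add_le (hβm.const_mul _) (hf.abs.const_mul _)).trans (add_le_add ?_ ?_)
        · refine (hsc _ (by positivity) hβm).trans (mul_le_mul_of_nonneg_left ?_ (by positivity))
          exact (l2norm_add_le hβ₁ (hβ₂.const_mul _)).trans
            (add_le_add_right (hsc _ (by positivity) hβ₂) _)
        · exact (hsc _ (by positivity) hf.abs).trans_eq
            (congrArg (M ^ 2 * ·) (l2norm_abs f))
    _ ≤ 2 * N * M * (K * S + 2 * M * S) + M ^ 2 * S := by gcongr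
    _ = _ := by ring

/-- The second derivatives of a function that vanishes on the boundary are controlled in `L²` by
its gradient and its Laplacian. -/
theorem exists_l2norm_deriv_le {k : ℕ} (hk : 3 ≤ k) {η : ℝ≥0} (hΩ : IsOpen Ω)
    (hbdd : Bornology.IsBounded Ω) (hreg : HasCkHolderBoundary k η Ω) :
    ∃ C : ℝ, 0 ≤ C ∧ ∀ (p : Fin N → Space N → ℝ) (A : Fin N → Fin N → Space N → ℝ),
      IsNormalGradient Ω p A → ∀ k l,
        l2norm (volume.restrict Ω) (A k l) ≤ C * gradLapNorm Ω p A := by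
  have key : ∃ C : ℝ, 0 ≤ C ∧ ∀ (p : Fin N → Space N → ℝ) (A : Fin N → Fin N → Space N → ℝ),
      IsNormalGradient Ω p A → ∀ k l,
        l2norm (volume.restrict (Ω ∩ closure Ω)) (A k l) ≤ C * gradLapNorm Ω p A := by
    refine hbdd.isCompact_closure.induction_on (p := fun S => ∃ C : ℝ, 0 ≤ C ∧
      ∀ (p : Fin N → Space N → ℝ) (A : Fin N → Fin N → Space N → ℝ),
      IsNormalGradient Ω p A → ∀ k l,
        l2norm (volume.restrict (Ω ∩ S)) (A k l) ≤ C * gradLapNorm Ω p A) ?_ ?_ ?_ ?_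
    · exact ⟨0, le_rfl, fun p A h k l => by simp [l2norm]⟩
    · rintro s t hst ⟨C, hC0, hC⟩
      refine ⟨C, hC0, fun p A h k l => (l2norm_mono_measure ?_ ?_).trans (hC p A h k l)⟩
      · exact (h.memLp_deriv k l).mono_measure (Measure.restrict_mono_set _ inter_subset_left)
      · exact Measure.restrict_mono_set _ (inter_subset_inter_right _ hst)
    · rintro s t ⟨C, hC0, hC⟩ ⟨D, hD0, hD⟩
      refine ⟨C + D, by positivity, fun p A h k l => ?_⟩
      rw [add_mul]
      refine le_trans ?_ (add_le_add (hC p A h k l) (hD p A h k l))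
      have h1 := l2norm_union_le (s := Ω ∩ s) (t := Ω ∩ t) (μ := volume)
        (memLp_indicator_of_restrict hΩ.measurableSet (h.memLp_deriv k l))
      have e : ∀ S, l2norm (volume.restrict (Ω ∩ S)) (Ω.indicator (A k l))
          = l2norm (volume.restrict (Ω ∩ S)) (A k l) := fun S => by
        refine l2norm_congr ?_
        have : ∀ᵐ x ∂(volume.restrict (Ω ∩ S)), x ∈ Ω :=
          ae_restrict_of_ae_restrict_of_subset inter_subset_left (ae_restrict_mem hΩ.measurableSet)
        filter_upwards [this] with x hx
        simp [hx]
      rw [← inter_union_distrib_left] at h1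
      rwa [e, e, e] at h1
    · intro x hx
      obtain ⟨t, ht, C, hC0, hC⟩ : ∃ t : ℝ, 0 < t ∧ ∃ C : ℝ, 0 ≤ C ∧
          ∀ (p : Fin N → Space N → ℝ) (A : Fin N → Fin N → Space N → ℝ),
          IsNormalGradient Ω p A → ∀ k l,
          l2norm (volume.restrict (Ω ∩ ball x t)) (A k l) ≤ C * gradLapNorm Ω p A := by
        rcases closure_eq_self_union_frontier Ω ▸ hx with h1 | h1
        · exact exists_l2norm_deriv_le_of_mem hΩ hbdd h1
        · obtain ⟨r, ρ, hr, hρ, hd, hiff⟩ := hreg.exists_definingFunction (by omega) h1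
          exact exists_l2norm_deriv_le_of_definingFunction hΩ hbdd hr
            (hρ.of_le (by exact_mod_cast hk)) hd hiff
      exact ⟨ball x t, mem_nhdsWithin_of_mem_nhds (ball_mem_nhds x ht), C, hC0, hC⟩
  rwa [inter_eq_left.2 subset_closure] at key

end SecondDerivatives

/-! ### The working space -/

section Jets

variable {N k : ℕ} {Ω : Opens (Space N)}

lemma classicalDeriv_of_order_one (α : Fin 1 → Fin N) (φ : Space N → ℝ) :
    classicalDeriv α φ = pd (α 0) φ := by
  ext x
  simp [classicalDeriv, pd, iteratedFDeriv_one_apply]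

lemma classicalDeriv_of_order_two (α : Fin 2 → Fin N) {φ : Space N → ℝ} (hφ : ContDiff ℝ 2 φ) :
    classicalDeriv α φ = pd (α 0) (pd (α 1) φ) := by
  ext x
  have hd : DifferentiableAt ℝ (fderiv ℝ φ) x :=
    (hφ.fderiv_right (m := 1) (by norm_num)).differentiable (by norm_num) x
  have e : pd (α 1) φ = fun y => fderiv ℝ φ y (EuclideanSpace.single (α 1) 1) := rfl
  rw [classicalDeriv, iteratedFDeriv_two_apply, pd, e, fderiv_clm_apply hd (by fun_prop)]
  simp

/-- The partial derivative of a test function. -/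
def testPd (i : Fin N) (φ : 𝓓(Ω, ℝ)) : 𝓓(Ω, ℝ) where
  toFun := pd i φ
  contDiff' := contDiff_pd φ.contDiff (by norm_cast) i
  hasCompactSupport' := hasCompactSupport_pd φ.hasCompactSupport i
  tsupport_subset' := (tsupport_pd_subset _ i).trans φ.tsupport_subset

lemma coe_testPd (i : Fin N) (φ : 𝓓(Ω, ℝ)) : (testPd i φ : Space N → ℝ) = pd i φ := rfl

lemma contDiff_testFunction (n : ℕ) (φ : 𝓓(Ω, ℝ)) : ContDiff ℝ n φ := contDiff_infty.1 φ.contDiff n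

lemma setIntegral_mul_testFunction (f : Space N → ℝ) (φ : 𝓓(Ω, ℝ)) :
    ∫ x in (Ω : Set (Space N)), f x * φ x = ∫ x, f x * φ x :=
  setIntegral_eq_integral_of_forall_compl_eq_zero fun x hx => by
    rw [image_eq_zero_of_notMem_tsupport fun h => hx (φ.tsupport_subset h), mul_zero]

lemma setIntegral_mul_pd_testFunction {f : Space N → ℝ} (hf : ContDiff ℝ 1 f) (φ : 𝓓(Ω, ℝ))
    (i : Fin N) : ∫ x in (Ω : Set (Space N)), f x * pd i φ x
      = -∫ x in (Ω : Set (Space N)), pd i f x * φ x := by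
  rw [← coe_testPd, setIntegral_mul_testFunction, setIntegral_mul_testFunction, coe_testPd,
    integral_mul_pd hf (contDiff_testFunction 1 φ) φ.hasCompactSupport]

/-- The continuous linear functional `U ↦ ∫ U_α h`. -/
def pairing (α : JetIndex N k) {h : Space N → ℝ}
    (hh : MemLp h 2 (volume.restrict (Ω : Set (Space N)))) : JetSpace k Ω →L[ℝ] ℝ :=
  (innerSL ℝ (hh.toLp h)).comp
    (PiLp.proj 2 (fun _ : JetIndex N k => Lp ℝ 2 (volume.restrict (Ω : Set (Space N)))) α)

lemma pairing_apply (α : JetIndex N k) {h : Space N → ℝ}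
    (hh : MemLp h 2 (volume.restrict (Ω : Set (Space N)))) (U : JetSpace k Ω) :
    pairing α hh U = ∫ x in (Ω : Set (Space N)), U α x * h x := by
  change inner ℝ (hh.toLp h) (U α) = _
  rw [L2.inner_def]
  refine integral_congr_ae ?_
  filter_upwards [hh.coeFn_toLp] with x hx
  simp [hx]

lemma norm_eq_l2norm {α : Type*} [MeasurableSpace α] {μ : Measure α} (f : Lp ℝ 2 μ) :
    ‖f‖ = l2norm μ f := Lp.norm_def f

lemma continuous_jet_apply (α : JetIndex N k) : Continuous fun U : JetSpace k Ω => U α :=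
  (PiLp.proj 2 (fun _ : JetIndex N k => Lp ℝ 2 (volume.restrict (Ω : Set (Space N))))
    α : JetSpace k Ω →L[ℝ] _).continuous

/-- A closed condition holds on `W^{k,2}_0(Ω)` as soon as it holds for test functions. -/
lemma sobolevZero_induction {P : JetSpace k Ω → Prop} (hP : IsClosed {U | P U})
    (h : ∀ φ, P (testJet k Ω φ)) {U : JetSpace k Ω} (hU : U ∈ sobolevZero k Ω) : P U := by
  have : closure (LinearMap.range (testJet k Ω) : Set (JetSpace k Ω)) ⊆ {U | P U} :=
    closure_minimal (by rintro _ ⟨φ, rfl⟩; exact h φ) hP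
  exact this hU

lemma testJet_ae (φ : 𝓓(Ω, ℝ)) (α : JetIndex N k) :
    testJet k Ω φ α =ᵐ[volume.restrict (Ω : Set (Space N))] classicalDeriv α.2 φ :=
  (memLp_classicalDeriv α.2 φ).coeFn_toLp

lemma testJet_zeroIndex_ae (φ : 𝓓(Ω, ℝ)) :
    testJet k Ω φ (zeroIndex N k) =ᵐ[volume.restrict (Ω : Set (Space N))] φ :=
  testJet_ae φ (zeroIndex N k)

/-- The index of a first derivative. -/
def firstIndex (N k : ℕ) (i : Fin N) : JetIndex N (k + 1) :=
  ⟨⟨1, by omega⟩, fun _ => i⟩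

/-- The index of a second derivative. -/
def secondIndex (i j : Fin N) : JetIndex N 2 := ⟨2, ![i, j]⟩

lemma testJet_firstIndex_ae (φ : 𝓓(Ω, ℝ)) (i : Fin N) :
    testJet (k + 1) Ω φ (firstIndex N k i) =ᵐ[volume.restrict (Ω : Set (Space N))] pd i φ := by
  have e : classicalDeriv (firstIndex N k i).2 (φ : Space N → ℝ) = pd i φ :=
    classicalDeriv_of_order_one (fun _ => i) φ
  have h := testJet_ae φ (firstIndex N k i)
  rwa [e] at h

lemma isClosed_sobolev : IsClosed (sobolev k Ω : Set (JetSpace k Ω)) := by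
  have e : (sobolev k Ω : Set (JetSpace k Ω)) = ⋂ (α : JetIndex N k), ⋂ φ : 𝓓(Ω, ℝ),
      {U | pairing (zeroIndex N k) (memLp_classicalDeriv α.2 φ) U
        = (-1) ^ (α.1 : ℕ) * pairing α (memLp_testFunction φ) U} := by
    ext U
    simp only [mem_iInter, mem_ofPred_eq, pairing_apply]
    rfl
  rw [e]
  exact isClosed_iInter fun α => isClosed_iInter fun φ =>
    isClosed_eq (ContinuousLinearMap.continuous _) (continuous_const.mul
      (ContinuousLinearMap.continuous _))

lemma continuous_truncate : Continuous (truncate k Ω) :=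
  (PiLp.continuous_toLp 2 _).comp (continuous_pi fun _ => continuous_jet_apply _)

lemma truncate_mem_sobolevZero {U : JetSpace (k + 1) Ω} (hU : U ∈ sobolevZero (k + 1) Ω) :
    truncate k Ω U ∈ sobolevZero k Ω :=
  sobolevZero_induction (P := fun U => truncate k Ω U ∈ sobolevZero k Ω)
    ((Submodule.isClosed_topologicalClosure _).preimage continuous_truncate)
    (fun φ => Submodule.le_topologicalClosure _ ⟨φ, rfl⟩) hU


lemma secondIndex_self (i : Fin N) : (⟨2, fun _ => i⟩ : JetIndex N 2) = secondIndex i i := by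
  have : (fun _ : Fin 2 => i) = ![i, i] := by
    ext a
    fin_cases a <;> rfl
  exact congrArg (fun f : Fin 2 → Fin N => (⟨2, f⟩ : JetIndex N 2)) this

lemma testJet_secondIndex_ae (φ : 𝓓(Ω, ℝ)) (i j : Fin N) :
    testJet 2 Ω φ (secondIndex i j) =ᵐ[volume.restrict (Ω : Set (Space N))] pd i (pd j φ) := by
  have e : classicalDeriv (secondIndex i j).2 (φ : Space N → ℝ) = pd i (pd j φ) :=
    classicalDeriv_of_order_two ![i, j] (contDiff_testFunction 2 φ)
  have h := testJet_ae φ (secondIndex i j)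
  rwa [e] at h

/-- Every index of order at most two is one of the three kinds. -/
lemma jetIndex_cases {P : JetIndex N 2 → Prop} (h0 : P (zeroIndex N 2))
    (h1 : ∀ i, P (firstIndex N 1 i)) (h2 : ∀ i j, P (secondIndex i j)) (α : JetIndex N 2) :
    P α := by
  obtain ⟨m, f⟩ := α
  fin_cases m
  · have e : f = (Fin.elim0 : Fin 0 → Fin N) := funext fun a => Fin.elim0 a
    exact e ▸ h0
  · have e : f = fun _ : Fin 1 => f (0 : Fin 1) := funext fun a =>
      congrArg f (Subsingleton.elim (α := Fin 1) a 0)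
    exact e ▸ h1 (f (0 : Fin 1))
  · have e : f = (![f (0 : Fin 2), f (1 : Fin 2)] : Fin 2 → Fin N) := by
      ext a
      change Fin 2 at a
      fin_cases a <;> rfl
    exact e ▸ h2 (f (0 : Fin 2)) (f (1 : Fin 2))

lemma sobolev_firstIndex {U : JetSpace 2 Ω} (hU : U ∈ sobolev 2 Ω) (i : Fin N) (φ : 𝓓(Ω, ℝ)) :
    ∫ x in (Ω : Set (Space N)), U (zeroIndex N 2) x * pd i φ x
      = -∫ x in (Ω : Set (Space N)), U (firstIndex N 1 i) x * φ x := by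
  have h := hU (firstIndex N 1 i) φ
  have e : classicalDeriv (firstIndex N 1 i).2 (φ : Space N → ℝ) = pd i φ :=
    classicalDeriv_of_order_one (fun _ => i) φ
  rw [e] at h
  rw [h]
  change (-1 : ℝ) ^ 1 * _ = _
  ring

lemma sobolev_secondIndex {U : JetSpace 2 Ω} (hU : U ∈ sobolev 2 Ω) (i j : Fin N) (φ : 𝓓(Ω, ℝ)) :
    ∫ x in (Ω : Set (Space N)), U (zeroIndex N 2) x * pd i (pd j φ) x
      = ∫ x in (Ω : Set (Space N)), U (secondIndex i j) x * φ x := by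
  have h := hU (secondIndex i j) φ
  have e : classicalDeriv (secondIndex i j).2 (φ : Space N → ℝ) = pd i (pd j φ) :=
    classicalDeriv_of_order_two ![i, j] (contDiff_testFunction 2 φ)
  rw [e] at h
  rw [h]
  change (-1 : ℝ) ^ 2 * _ = _
  ring

lemma testJet_mem_sobolev (φ : 𝓓(Ω, ℝ)) : testJet 2 Ω φ ∈ sobolev 2 Ω := by
  have hc : ∀ (f g h : Space N → ℝ), f =ᵐ[volume.restrict (Ω : Set (Space N))] g →
      ∫ x in (Ω : Set (Space N)), f x * h x = ∫ x in (Ω : Set (Space N)), g x * h x := by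
    intro f g h hfg
    refine integral_congr_ae ?_
    filter_upwards [hfg] with x hx
    rw [hx]
  have h1 := contDiff_testFunction 1 φ
  have h2 := contDiff_testFunction 2 φ
  intro α χ
  rw [hc _ _ _ (testJet_zeroIndex_ae φ)]
  induction α using jetIndex_cases with
  | h0 =>
    rw [hc _ _ _ (testJet_zeroIndex_ae φ)]
    change _ = (-1 : ℝ) ^ 0 * _
    rw [pow_zero, one_mul]
    rfl
  | h1 i =>
    rw [hc _ _ _ (testJet_firstIndex_ae φ i)]
    have e : classicalDeriv (firstIndex N 1 i).2 (χ : Space N → ℝ) = pd i χ :=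
      classicalDeriv_of_order_one (fun _ => i) χ
    rw [e, setIntegral_mul_pd_testFunction h1]
    change _ = (-1 : ℝ) ^ 1 * _
    ring
  | h2 i j =>
    rw [hc _ _ _ (testJet_secondIndex_ae φ i j)]
    have e : classicalDeriv (secondIndex i j).2 (χ : Space N → ℝ) = pd i (pd j χ) :=
      classicalDeriv_of_order_two ![i, j] (contDiff_testFunction 2 χ)
    rw [e, ← coe_testPd j χ, setIntegral_mul_pd_testFunction h1, coe_testPd,
      setIntegral_mul_pd_testFunction (contDiff_pd h2 (by norm_num) i), neg_neg]
    change _ = (-1 : ℝ) ^ 2 * _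
    simp only [pd_pd_comm h2 i j]
    ring

lemma sobolevZero_le_sobolev : sobolevZero 2 Ω ≤ sobolev 2 Ω :=
  Submodule.topologicalClosure_minimal _ (by rintro _ ⟨φ, rfl⟩; exact testJet_mem_sobolev φ)
    isClosed_sobolev

lemma workingSpace_le_navier (bc : BoundaryCondition) :
    workingSpace bc Ω ≤ workingSpace .navier Ω :=
  match bc with
  | .dirichlet => fun _ hU => ⟨sobolevZero_le_sobolev hU, truncate_mem_sobolevZero hU⟩
  | .navier => le_rfl

lemma isClosed_workingSpace (bc : BoundaryCondition) :
    IsClosed (workingSpace bc Ω : Set (JetSpace 2 Ω)) :=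
  match bc with
  | .dirichlet => Submodule.isClosed_topologicalClosure _
  | .navier => isClosed_sobolev.inter
      ((Submodule.isClosed_topologicalClosure _).preimage continuous_truncate)

lemma testJet_mem_workingSpace (bc : BoundaryCondition) (φ : 𝓓(Ω, ℝ)) :
    testJet 2 Ω φ ∈ workingSpace bc Ω := by
  have h : ∀ k, testJet k Ω φ ∈ sobolevZero k Ω := fun k =>
    Submodule.le_topologicalClosure _ ⟨φ, rfl⟩
  match bc with
  | .dirichlet => exact h 2
  | .navier => exact ⟨testJet_mem_sobolev φ, h 1⟩

end Jets

section Estimates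

variable {N : ℕ} {Ω : Opens (Space N)}

/-- The first derivatives of the elements of `W^{2,2}(Ω) ∩ W^{1,2}_0(Ω)`. -/
def jetGrad (U : JetSpace 2 Ω) (i : Fin N) : Space N → ℝ := U (firstIndex N 1 i)

/-- The second derivatives. -/
def jetHessian (U : JetSpace 2 Ω) (i j : Fin N) : Space N → ℝ := U (secondIndex i j)

lemma hasWeakDeriv_jetGrad (hbdd : Bornology.IsBounded (Ω : Set (Space N))) {U : JetSpace 2 Ω}
    (hU : U ∈ sobolev 2 Ω) (i j : Fin N) :
    HasWeakDeriv (Ω : Set (Space N)) (jetGrad U i) (jetHessian U i j) j := by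
  refine HasWeakDeriv.of_smooth Ω.isOpen (integrableOn_of_memLp_two hbdd (Lp.memLp _))
    (integrableOn_of_memLp_two hbdd (Lp.memLp _)) fun φ => ?_
  have h1 := sobolev_firstIndex hU i (testPd j φ)
  have h2 := sobolev_secondIndex hU i j φ
  rw [coe_testPd] at h1
  simp only [jetGrad, jetHessian]
  linarith

lemma jetHessian_symm (hbdd : Bornology.IsBounded (Ω : Set (Space N))) {U : JetSpace 2 Ω}
    (hU : U ∈ sobolev 2 Ω) (i j : Fin N) :
    jetHessian U i j =ᵐ[volume.restrict (Ω : Set (Space N))] jetHessian U j i := by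
  have hi : ∀ i j, IntegrableOn (jetHessian U i j) (Ω : Set (Space N)) := fun i j =>
    integrableOn_of_memLp_two hbdd (Lp.memLp (U (secondIndex i j)))
  have hloc : LocallyIntegrableOn (fun x => jetHessian U i j x - jetHessian U j i x)
      (Ω : Set (Space N)) := ((hi i j).sub (hi j i)).locallyIntegrableOn
  have h := Ω.isOpen.ae_eq_zero_of_integral_contDiff_smul_eq_zero hloc fun g hg hgc hgs => by
    let φ : 𝓓(Ω, ℝ) := ⟨g, hg, hgc, hgs⟩
    have h1 := sobolev_secondIndex hU i j φ
    have h2 := sobolev_secondIndex hU j i φ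
    simp only [pd_pd_comm (contDiff_testFunction 2 φ) i j] at h1
    have e : ∫ x, g x • (jetHessian U i j x - jetHessian U j i x)
        = ∫ x in (Ω : Set (Space N)), (jetHessian U i j x - jetHessian U j i x) * φ x := by
      rw [setIntegral_mul_testFunction]
      congr 1 with x
      simp only [smul_eq_mul]
      exact mul_comm _ _
    rw [e]
    have i1 : IntegrableOn (fun x => jetHessian U i j x * φ x) (Ω : Set (Space N)) :=
      integrableOn_mul_of_continuous Ω.isOpen hbdd (hi i j) φ.continuous
    have i2 : IntegrableOn (fun x => jetHessian U j i x * φ x) (Ω : Set (Space N)) :=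
      integrableOn_mul_of_continuous Ω.isOpen hbdd (hi j i) φ.continuous
    simp only [sub_mul]
    rw [integral_sub i1 i2, sub_eq_zero]
    exact h1.symm.trans h2
  rw [EventuallyEq, ae_restrict_iff' Ω.isOpen.measurableSet]
  filter_upwards [h] with x hx hxΩ
  exact sub_eq_zero.1 (hx hxΩ)

lemma memLp_of_continuous (hbdd : Bornology.IsBounded (Ω : Set (Space N))) {f : Space N → ℝ}
    (hf : Continuous f) : MemLp f 2 (volume.restrict (Ω : Set (Space N))) := by
  have : IsFiniteMeasure (volume.restrict (Ω : Set (Space N))) :=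
    ⟨by simpa using hbdd.measure_lt_top⟩
  obtain ⟨C, -, hC⟩ := ae_restrict_abs_le_of_continuous Ω.isOpen hbdd hf
  exact MemLp.of_bound hf.aestronglyMeasurable C hC

/-- The gradient of a function that vanishes on the boundary is normal there. -/
lemma integral_firstIndex_mul_pd (hbdd : Bornology.IsBounded (Ω : Set (Space N)))
    {W : JetSpace 1 Ω} (hW : W ∈ sobolevZero 1 Ω) {Φ : Space N → ℝ} (hΦ : ContDiff ℝ 2 Φ)
    (k l : Fin N) :
    ∫ x in (Ω : Set (Space N)), W (firstIndex N 0 k) x * pd l Φ x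
      = ∫ x in (Ω : Set (Space N)), W (firstIndex N 0 l) x * pd k Φ x := by
  have hc : ∀ i, MemLp (pd i Φ) 2 (volume.restrict (Ω : Set (Space N))) := fun i =>
    memLp_of_continuous hbdd (continuous_pd (hΦ.of_le (by norm_num)) i)
  simp only [← pairing_apply _ (hc _)]
  refine sobolevZero_induction (P := fun W => pairing (firstIndex N 0 k) (hc l) W
    = pairing (firstIndex N 0 l) (hc k) W) (isClosed_eq (ContinuousLinearMap.continuous _)
      (ContinuousLinearMap.continuous _)) (fun φ => ?_) hW
  simp only [pairing_apply]
  have e : ∀ i j, ∫ x in (Ω : Set (Space N)), testJet 1 Ω φ (firstIndex N 0 i) x * pd j Φ x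
      = -∫ x in (Ω : Set (Space N)), pd i (pd j Φ) x * φ x := by
    intro i j
    rw [← setIntegral_mul_pd_testFunction (contDiff_pd hΦ (by norm_num) j)]
    refine integral_congr_ae ?_
    filter_upwards [testJet_firstIndex_ae (k := 0) φ i] with x hx
    rw [hx, mul_comm]
  rw [e, e]
  simp only [pd_pd_comm hΦ k l]

theorem isNormalGradient_jetGrad (hbdd : Bornology.IsBounded (Ω : Set (Space N)))
    {U : JetSpace 2 Ω} (hU : U ∈ workingSpace .navier Ω) :
    IsNormalGradient (Ω : Set (Space N)) (jetGrad U) (jetHessian U) where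
  memLp _ := Lp.memLp _
  memLp_deriv _ _ := Lp.memLp _
  hasWeakDeriv i j := hasWeakDeriv_jetGrad hbdd hU.1 i j
  symm i j := jetHessian_symm hbdd hU.1 i j
  integral_mul_pd _ hΦ k l := integral_firstIndex_mul_pd hbdd hU.2 hΦ k l

/-- The Poincaré inequality. -/
lemma exists_l2norm_zeroIndex_le (hbdd : Bornology.IsBounded (Ω : Set (Space N))) (i : Fin N) :
    ∃ C : ℝ, 0 ≤ C ∧ ∀ W ∈ sobolevZero 1 Ω, ‖W (zeroIndex N 1)‖ ≤ C * ‖W (firstIndex N 0 i)‖ := by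
  obtain ⟨C, hC0, hC⟩ := ae_restrict_abs_le_of_continuous (f := fun x : Space N => x i) Ω.isOpen
    hbdd (by fun_prop)
  refine ⟨2 * C, by positivity, fun W hW => sobolevZero_induction
    (P := fun W => ‖W (zeroIndex N 1)‖ ≤ 2 * C * ‖W (firstIndex N 0 i)‖)
    (isClosed_le (continuous_jet_apply _).norm (continuous_const.mul (continuous_jet_apply _).norm))
    (fun φ => ?_) hW⟩
  set μ := volume.restrict (Ω : Set (Space N)) with hμ
  have h1 := contDiff_testFunction 1 φ
  have hx : ContDiff ℝ 1 (fun x : Space N => x i) := by fun_prop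
  rw [norm_eq_l2norm, norm_eq_l2norm, l2norm_congr (testJet_zeroIndex_ae φ),
    l2norm_congr (testJet_firstIndex_ae (k := 0) φ i)]
  have mφ : MemLp φ 2 μ := memLp_testFunction φ
  have mpd : MemLp (pd i φ) 2 μ := memLp_testFunction (testPd i φ)
  have mx : MemLp (fun x => x i * pd i φ x) 2 μ := by
    have := memLp_mul_of_continuous Ω.isOpen hbdd mpd hx.continuous
    simpa only [mul_comm] using this
  have hpx : ∀ x : Space N, pd i (fun x : Space N => x i) x = 1 := fun x => by
    have : HasFDerivAt (fun x : Space N => x i)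
        (EuclideanSpace.proj i : Space N →L[ℝ] ℝ) x :=
      (EuclideanSpace.proj i : Space N →L[ℝ] ℝ).hasFDerivAt
    rw [pd, this.fderiv]
    simp
  have key : l2norm μ φ ^ 2 = -(2 * ∫ x in (Ω : Set (Space N)), φ x * (x i * pd i φ x)) := by
    rw [l2norm_sq mφ]
    have e1 := setIntegral_mul_pd_testFunction (hx.mul h1) φ i
    have e2 : ∀ x, pd i (fun x : Space N => x i * φ x) x = φ x + x i * pd i φ x := fun x => by
      rw [pd_mul (hx.differentiable (by norm_num) x) (h1.differentiable (by norm_num) x), hpx,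
        one_mul]
    have e3 : ∫ x in (Ω : Set (Space N)), pd i (fun x : Space N => x i * φ x) x * φ x
        = (∫ x in (Ω : Set (Space N)), φ x ^ 2)
          + ∫ x in (Ω : Set (Space N)), φ x * (x i * pd i φ x) := by
      have i2 : Integrable (fun x => φ x * (x i * pd i φ x)) μ := mφ.integrable_mul mx
      rw [← integral_add mφ.integrable_sq i2]
      congr 1 with x
      rw [e2]
      ring
    have e4 : ∫ x in (Ω : Set (Space N)), x i * φ x * pd i φ x
        = ∫ x in (Ω : Set (Space N)), φ x * (x i * pd i φ x) := by
      congr 1 with x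
      ring
    have e5 : ∫ x in (Ω : Set (Space N)), x i * φ x * pd i φ x
        = -∫ x in (Ω : Set (Space N)), pd i (fun x : Space N => x i * φ x) x * φ x := e1
    rw [e4, e3] at e5
    linarith
  have h2 := abs_integral_mul_le mφ mx
  have h3 : l2norm μ (fun x => x i * pd i φ x) ≤ C * l2norm μ (pd i φ) := by
    refine l2norm_le_mul hC0 mpd ?_
    filter_upwards [hC] with x hx
    rw [abs_mul]
    gcongr
    exact hx
  have h4 : l2norm μ φ * l2norm μ φ ≤ (2 * C * l2norm μ (pd i φ)) * l2norm μ φ := by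
    have := mul_le_mul_of_nonneg_left h3 (l2norm_nonneg (μ := μ) φ)
    nlinarith [neg_abs_le (∫ x in (Ω : Set (Space N)), φ x * (x i * pd i φ x))]
  rcases (l2norm_nonneg (μ := μ) φ).eq_or_lt with h0 | h0
  · rw [← h0]
    exact mul_nonneg (by positivity) (l2norm_nonneg _)
  · exact le_of_mul_le_mul_right h4 h0

/-- Green's formula. -/
lemma sum_integral_firstIndex_mul (hbdd : Bornology.IsBounded (Ω : Set (Space N)))
    {U : JetSpace 2 Ω} (hU : U ∈ sobolev 2 Ω) {W : JetSpace 1 Ω} (hW : W ∈ sobolevZero 1 Ω) :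
    ∑ i, ∫ x in (Ω : Set (Space N)), W (firstIndex N 0 i) x * jetGrad U i x
      = -∫ x in (Ω : Set (Space N)), W (zeroIndex N 1) x * ∑ i, jetHessian U i i x := by
  have hg : ∀ i, MemLp (jetGrad U i) 2 (volume.restrict (Ω : Set (Space N))) := fun i =>
    Lp.memLp _
  have hh : ∀ i, MemLp (jetHessian U i i) 2 (volume.restrict (Ω : Set (Space N))) := fun i =>
    Lp.memLp _
  have hL : MemLp (fun x => ∑ i, jetHessian U i i x) 2 (volume.restrict (Ω : Set (Space N))) :=
    memLp_finsetSum _ fun i _ => hh i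
  rw [← pairing_apply _ hL]
  simp only [← pairing_apply _ (hg _)]
  refine sobolevZero_induction (P := fun W => ∑ i, pairing (firstIndex N 0 i) (hg i) W
    = -pairing (zeroIndex N 1) hL W) (isClosed_eq
      (continuous_finsetSum _ fun i _ => ContinuousLinearMap.continuous _)
      (ContinuousLinearMap.continuous _).neg) (fun φ => ?_) hW
  simp only [pairing_apply]
  have e0 : ∫ x in (Ω : Set (Space N)), testJet 1 Ω φ (zeroIndex N 1) x * ∑ i, jetHessian U i i x
      = ∑ i, ∫ x in (Ω : Set (Space N)), jetHessian U i i x * φ x := by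
    rw [← integral_finsetSum]
    · refine integral_congr_ae ?_
      filter_upwards [testJet_zeroIndex_ae (k := 1) φ] with x hx
      rw [hx, mul_comm, Finset.sum_mul]
    · exact fun i _ => (hh i).integrable_mul (memLp_testFunction φ)
  rw [e0, ← Finset.sum_neg_distrib]
  refine Finset.sum_congr rfl fun i _ => ?_
  rw [← hasWeakDeriv_jetGrad hbdd hU i i φ (contDiff_testFunction 1 φ) φ.hasCompactSupport
    φ.tsupport_subset]
  refine integral_congr_ae ?_
  filter_upwards [testJet_firstIndex_ae (k := 0) φ i] with x hx
  rw [hx, mul_comm]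

lemma truncate_zeroIndex (U : JetSpace 2 Ω) :
    truncate 1 Ω U (zeroIndex N 1) = U (zeroIndex N 2) := rfl

lemma truncate_firstIndex (U : JetSpace 2 Ω) (i : Fin N) :
    truncate 1 Ω U (firstIndex N 0 i) = U (firstIndex N 1 i) := rfl

variable (Ω) in
lemma exists_norm_le_mul : ∃ C : ℝ, 0 ≤ C ∧ ∀ (U : JetSpace 2 Ω) (D : ℝ), 0 ≤ D →
    (∀ α, ‖U α‖ ≤ D) → ‖U‖ ≤ C * D := by
  refine ⟨√(∑ _α : JetIndex N 2, 1), Real.sqrt_nonneg _, fun U D hD h => ?_⟩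
  refine abs_le_of_sq_le_sq' ?_ (mul_nonneg (Real.sqrt_nonneg _) hD) |>.2
  rw [mul_pow, Real.sq_sqrt (Finset.sum_nonneg fun _ _ => zero_le_one), PiLp.norm_sq_eq_of_L2,
    Finset.sum_mul]
  refine Finset.sum_le_sum fun α _ => ?_
  rw [one_mul]
  gcongr
  exact h α

/-- On `W^{2,2}(Ω) ∩ W^{1,2}_0(Ω)` the full norm is controlled by the Laplacian. -/
theorem exists_norm_le_l2norm_lap (hN : 1 ≤ N) {k : ℕ} (hk : 3 ≤ k) {η : ℝ≥0}
    (hbdd : Bornology.IsBounded (Ω : Set (Space N)))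
    (hreg : HasCkHolderBoundary k η (Ω : Set (Space N))) :
    ∃ C : ℝ, 0 ≤ C ∧ ∀ U ∈ workingSpace .navier Ω,
      ‖U‖ ≤ C * l2norm (volume.restrict (Ω : Set (Space N))) (lap U) := by
  obtain ⟨K, hK0, hK⟩ := exists_l2norm_deriv_le hk Ω.isOpen hbdd hreg
  obtain ⟨P, hP0, hP⟩ := exists_l2norm_zeroIndex_le hbdd (⟨0, hN⟩ : Fin N)
  set D := P * P + P + K * (N * P + 1) with hD
  have hD0 : 0 ≤ D := by positivity
  obtain ⟨K', hK'0, hK'⟩ := exists_norm_le_mul Ω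
  refine ⟨K' * D, mul_nonneg hK'0 hD0, fun U hU => ?_⟩
  set μ := volume.restrict (Ω : Set (Space N)) with hμ
  set L := l2norm μ (lap U) with hL
  have hL0 : 0 ≤ L := l2norm_nonneg _
  have hlap : lap U = fun x => ∑ i, jetHessian U i i x := by
    ext x
    simp only [lap, secondIndex_self]
    rfl
  have hn := isNormalGradient_jetGrad hbdd hU
  have hLm : MemLp (fun x => ∑ i, jetHessian U i i x) 2 μ :=
    memLp_finsetSum _ fun i _ => hn.memLp_deriv i i
  obtain ⟨Z, hZ⟩ : ∃ Z, Z = ‖U (zeroIndex N 2)‖ := ⟨_, rfl⟩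
  obtain ⟨G, hG⟩ : ∃ G, G = ‖U (firstIndex N 1 ⟨0, hN⟩)‖ := ⟨_, rfl⟩
  have hZG : Z ≤ P * G := by
    have h := hP (truncate 1 Ω U) hU.2
    rwa [truncate_zeroIndex, truncate_firstIndex, ← hZ, ← hG] at h
  have hgreen : ∑ i, ‖U (firstIndex N 1 i)‖ ^ 2 ≤ Z * L := by
    have h1 := sum_integral_firstIndex_mul hbdd hU.1 hU.2
    have h2 : ∀ i, ∫ x in (Ω : Set (Space N)), (truncate 1 Ω U) (firstIndex N 0 i) x * jetGrad U i x
        = ‖U (firstIndex N 1 i)‖ ^ 2 := fun i => by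
      rw [norm_eq_l2norm, l2norm_sq (Lp.memLp _)]
      congr 1 with x
      rw [pow_two]
      rfl
    simp only [h2] at h1
    have h3 := abs_integral_mul_le (Lp.memLp (U (zeroIndex N 2))) hLm
    rw [← norm_eq_l2norm, ← hlap, ← hZ] at h3
    rw [h1, truncate_zeroIndex]
    exact (neg_le_abs _).trans h3
  have hfirst : ∀ i, ‖U (firstIndex N 1 i)‖ ^ 2 ≤ P * G * L := fun i =>
    (Finset.single_le_sum (f := fun i => ‖U (firstIndex N 1 i)‖ ^ 2) (fun _ _ => sq_nonneg _)
      (Finset.mem_univ i)).trans (hgreen.trans (by gcongr))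
  have hGL : G ≤ P * L := by
    have h := hfirst ⟨0, hN⟩
    rw [← hG] at h
    have hG0 : 0 ≤ G := hG ▸ norm_nonneg _
    rcases hG0.eq_or_lt with h0 | h0
    · rw [← h0]
      positivity
    · refine le_of_mul_le_mul_left (a := G) ?_ h0
      calc G * G = G ^ 2 := by ring
        _ ≤ _ := h
        _ = _ := by ring
  have hfirst' : ∀ i, ‖U (firstIndex N 1 i)‖ ≤ P * L := fun i => by
    refine abs_le_of_sq_le_sq' ?_ (by positivity) |>.2
    calc _ ≤ P * G * L := hfirst i
      _ ≤ P * (P * L) * L := by gcongr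
      _ = _ := by ring
  have hS : gradLapNorm (Ω : Set (Space N)) (jetGrad U) (jetHessian U) ≤ (N * P + 1) * L := by
    rw [gradLapNorm, ← hlap, add_mul, one_mul]
    refine add_le_add ?_ le_rfl
    calc _ ≤ ∑ _i : Fin N, P * L := Finset.sum_le_sum fun i _ =>
          (norm_eq_l2norm (U (firstIndex N 1 i))).symm.le.trans (hfirst' i)
      _ = _ := by simp; ring
  have hall : ∀ α, ‖U α‖ ≤ D * L := by
    intro α
    have e1 : 0 ≤ P * P * L := by positivity
    have e2 : 0 ≤ P * L := by positivity
    have e3 : 0 ≤ K * (N * P + 1) * L := by positivity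
    have e4 : D * L = P * P * L + P * L + K * (N * P + 1) * L := by rw [hD]; ring
    rw [e4]
    induction α using jetIndex_cases with
    | h0 =>
      have : ‖U (zeroIndex N 2)‖ ≤ P * P * L := hZ ▸ hZG.trans (by rw [mul_assoc]; gcongr)
      linarith
    | h1 i => linarith [hfirst' i]
    | h2 i j =>
      have h5 : ‖U (secondIndex i j)‖ ≤ K * ((N * P + 1) * L) := by
        rw [norm_eq_l2norm]
        exact (hK _ _ hn i j).trans (by gcongr)
      linarith
  rw [mul_assoc]
  exact hK' U _ (by positivity) hall

end Estimates

/-! ### Minimisation on the Nehari manifold in a Hilbert space -/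

section WeakCompactness

variable {E : Type*} [NormedAddCommGroup E] [InnerProductSpace ℝ E] [CompleteSpace E]
  [SeparableSpace E]

/-- Bounded sequences in a separable Hilbert space have weakly convergent subsequences. -/
lemma exists_subseq_tendsto_weak {u : ℕ → E} {R : ℝ} (hu : ∀ n, ‖u n‖ ≤ R) :
    ∃ (w : E) (φ : ℕ → ℕ), StrictMono φ ∧
      ∀ ℓ : E →L[ℝ] ℝ, Tendsto (fun n => ℓ (u (φ n))) atTop (𝓝 (ℓ w)) := by
  have hc := WeakDual.isSeqCompact_closedBall (𝕜 := ℝ) (E := E) 0 R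
  obtain ⟨f, -, φ, hφ, hf⟩ := hc
    (x := fun n => StrongDual.toWeakDual (InnerProductSpace.toDual ℝ E (u n))) (fun n => by
      change dist (InnerProductSpace.toDual ℝ E (u n)) 0 ≤ R
      rw [dist_zero_right, LinearIsometryEquiv.norm_map]
      exact hu n)
  refine ⟨(InnerProductSpace.toDual ℝ E).symm (WeakDual.toStrongDual f), φ, hφ, fun ℓ => ?_⟩
  obtain ⟨y, rfl⟩ := (InnerProductSpace.toDual ℝ E).surjective ℓ
  have h1 := ((WeakDual.eval_continuous y).tendsto f).comp hf
  have e1 : ∀ v, InnerProductSpace.toDual ℝ E y v = InnerProductSpace.toDual ℝ E v y := fun v => by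
    simp [real_inner_comm]
  simp only [e1, LinearIsometryEquiv.apply_symm_apply]
  exact h1

end WeakCompactness

/-- The data of a functional `½ a(u,u) - (κ/4) ‖G u‖⁴` on a Hilbert space: a coercive symmetric
bilinear form `a`, a compact linear map `G`, and the derivative `4 b(u,·)` of `u ↦ ‖G u‖⁴`. -/
structure QuarticProblem (E Y : Type*) [NormedAddCommGroup E] [InnerProductSpace ℝ E]
    [NormedAddCommGroup Y] [NormedSpace ℝ Y] where
  /-- the quadratic part -/
  a : E →L[ℝ] E →L[ℝ] ℝ
  /-- the map whose norm gives the quartic part -/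
  G : E →L[ℝ] Y
  /-- a quarter of the derivative of the quartic part -/
  b : E → E → ℝ
  symm : ∀ u v, a u v = a v u
  coercive : ∃ c : ℝ, 0 < c ∧ ∀ u, c * ‖u‖ ^ 2 ≤ a u u
  b_self : ∀ u, b u u = ‖G u‖ ^ 4
  b_smul_right : ∀ (s : ℝ) u v, b u (s • v) = s * b u v
  b_smul_left : ∀ (s : ℝ) u v, b (s • u) v = s ^ 3 * b u v
  expansion : ∃ C : ℝ, 0 ≤ C ∧ ∀ u v, |‖G (u + v)‖ ^ 4 - ‖G u‖ ^ 4 - 4 * b u v|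
    ≤ C * (‖G u‖ ^ 2 * ‖G v‖ ^ 2 + ‖G v‖ ^ 4)
  compact : ∀ (u : ℕ → E) (w : E), (∃ R, ∀ n, ‖u n‖ ≤ R) →
    (∀ ℓ : E →L[ℝ] ℝ, Tendsto (fun n => ℓ (u n)) atTop (𝓝 (ℓ w))) →
    Tendsto (fun n => G (u n)) atTop (𝓝 (G w))
  nontrivial : ∃ u, G u ≠ 0

namespace QuarticProblem

variable {E Y : Type*} [NormedAddCommGroup E] [InnerProductSpace ℝ E]
  [NormedAddCommGroup Y] [NormedSpace ℝ Y] (D : QuarticProblem E Y)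

/-- The functional. -/
def J (κ : ℝ) (u : E) : ℝ := 1 / 2 * D.a u u - κ / 4 * ‖D.G u‖ ^ 4

lemma a_nonneg (u : E) : 0 ≤ D.a u u := by
  obtain ⟨c, hc, h⟩ := D.coercive
  exact (by positivity : 0 ≤ c * ‖u‖ ^ 2).trans (h u)

lemma a_pos {u : E} (hu : u ≠ 0) : 0 < D.a u u := by
  obtain ⟨c, hc, h⟩ := D.coercive
  have : 0 < ‖u‖ := norm_pos_iff.2 hu
  exact (by positivity : 0 < c * ‖u‖ ^ 2).trans_le (h u)

lemma a_add (u v : E) : D.a (u + v) (u + v) = D.a u u + 2 * D.a u v + D.a v v := by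
  simp only [map_add, add_apply]
  rw [D.symm v u]
  ring

lemma a_smul (s : ℝ) (u : E) : D.a (s • u) (s • u) = s ^ 2 * D.a u u := by
  simp only [map_smul, smul_apply, smul_eq_mul]
  ring

lemma norm_G_smul (s : ℝ) (u : E) : ‖D.G (s • u)‖ ^ 4 = s ^ 4 * ‖D.G u‖ ^ 4 := by
  rw [map_smul, norm_smul, mul_pow, Real.norm_eq_abs, Even.pow_abs (by decide)]

lemma a_le_norm_sq : ∃ K : ℝ, 0 ≤ K ∧ ∀ u, D.a u u ≤ K * ‖u‖ ^ 2 :=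
  ⟨‖D.a‖, D.a.opNorm_nonneg, fun u => by
    have := (D.a.le_opNorm₂ u u)
    rw [pow_two, ← mul_assoc]
    exact (le_abs_self _).trans this⟩

/-- The energy on the Nehari manifold. -/
lemma J_eq_of_nehari {κ : ℝ} {u : E} (h : D.a u u = κ * ‖D.G u‖ ^ 4) :
    D.J κ u = 1 / 4 * D.a u u := by
  rw [J]
  linarith

/-- Increments of the functional at a weak solution. -/
lemma J_add_sub {κ : ℝ} (hκ : 0 < κ) {u : E} (hu : ∀ v, D.a u v = κ * D.b u v) :
    ∃ C : ℝ, 0 ≤ C ∧ ∀ v, |D.J κ (u + v) - D.J κ u - 1 / 2 * D.a v v|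
      ≤ C * (‖D.G u‖ ^ 2 * ‖D.G v‖ ^ 2 + ‖D.G v‖ ^ 4) := by
  obtain ⟨C, hC0, hC⟩ := D.expansion
  refine ⟨κ / 4 * C, by positivity, fun v => ?_⟩
  have e : D.J κ (u + v) - D.J κ u - 1 / 2 * D.a v v
      = -(κ / 4 * (‖D.G (u + v)‖ ^ 4 - ‖D.G u‖ ^ 4 - 4 * D.b u v)) := by
    rw [J, J, D.a_add, hu v]
    ring
  rw [e, abs_neg, abs_mul, abs_of_pos (by positivity : 0 < κ / 4), mul_assoc]
  gcongr
  exact hC u v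

lemma hasFDerivAt_J {κ : ℝ} (hκ : 0 < κ) {u : E} (hu : ∀ v, D.a u v = κ * D.b u v) :
    HasFDerivAt (D.J κ) (0 : E →L[ℝ] ℝ) u := by
  obtain ⟨C, hC0, hC⟩ := D.J_add_sub hκ hu
  obtain ⟨K, hK0, hK⟩ := D.a_le_norm_sq
  set g := ‖D.G‖ with hg
  have hG : ∀ v, ‖D.G v‖ ≤ g * ‖v‖ := D.G.le_opNorm
  have hg0 : 0 ≤ g := norm_nonneg _
  set B := 1 / 2 * K + C * (‖D.G u‖ ^ 2 * g ^ 2 + g ^ 4) with hB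
  have hB0 : 0 ≤ B := by positivity
  rw [hasFDerivAt_iff_isLittleO_nhds_zero]
  have hO : (fun v => D.J κ (u + v) - D.J κ u - (0 : E →L[ℝ] ℝ) v) =O[𝓝 0] fun v => ‖v‖ ^ 2 := by
    refine Asymptotics.IsBigO.of_bound B ?_
    filter_upwards [Metric.ball_mem_nhds (0 : E) one_pos] with v hv
    have hv1 : ‖v‖ ≤ 1 := (mem_ball_zero_iff.1 hv).le
    have h1 := hC v
    have h2 : ‖D.G v‖ ^ 2 ≤ g ^ 2 * ‖v‖ ^ 2 := by
      rw [← mul_pow]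
      exact pow_le_pow_left₀ (norm_nonneg _) (hG v) 2
    have h3 : ‖D.G v‖ ^ 4 ≤ g ^ 4 * ‖v‖ ^ 2 := by
      calc ‖D.G v‖ ^ 4 ≤ (g * ‖v‖) ^ 4 := pow_le_pow_left₀ (norm_nonneg _) (hG v) 4
        _ = g ^ 4 * ‖v‖ ^ 2 * ‖v‖ ^ 2 := by ring
        _ ≤ g ^ 4 * ‖v‖ ^ 2 * 1 := by
          gcongr
          exact pow_le_one₀ (norm_nonneg _) hv1
        _ = _ := mul_one _
    have h4 := hK v
    have h5 := D.a_nonneg v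
    have h6 : C * (‖D.G u‖ ^ 2 * ‖D.G v‖ ^ 2 + ‖D.G v‖ ^ 4)
        ≤ C * (‖D.G u‖ ^ 2 * (g ^ 2 * ‖v‖ ^ 2) + g ^ 4 * ‖v‖ ^ 2) := by gcongr
    have e : B * ‖v‖ ^ 2 = 1 / 2 * (K * ‖v‖ ^ 2)
        + C * (‖D.G u‖ ^ 2 * (g ^ 2 * ‖v‖ ^ 2) + g ^ 4 * ‖v‖ ^ 2) := by rw [hB]; ring
    rw [zero_apply, sub_zero, norm_pow, norm_norm, e, Real.norm_eq_abs]
    rw [abs_le] at h1 ⊢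
    constructor <;> linarith
  refine hO.trans_isLittleO ?_
  have := (Asymptotics.isLittleO_pow_id (𝕜 := ℝ) (n := 2) (by norm_num)).comp_tendsto
    (tendsto_norm_zero (E := E))
  exact (Asymptotics.isLittleO_norm_right.1 this)

/-- The Euler–Lagrange equation of a maximiser of the quotient. -/
lemma b_eq_of_maximizer {u : E} (hu : D.a u u = 1)
    (hmax : ∀ v, ‖D.G v‖ ^ 4 ≤ ‖D.G u‖ ^ 4 * D.a v v ^ 2) (v : E) :
    D.b u v = ‖D.G u‖ ^ 4 * D.a u v := by
  obtain ⟨C, hC0, hC⟩ := D.expansion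
  obtain ⟨M, hM⟩ : ∃ M, M = ‖D.G u‖ ^ 4 := ⟨_, rfl⟩
  have hM0 : 0 ≤ M := hM ▸ by positivity
  rw [← hM]
  obtain ⟨d, hd⟩ : ∃ d, d = D.b u v - M * D.a u v := ⟨_, rfl⟩
  obtain ⟨R, hR⟩ : ∃ R, R = C * (‖D.G u‖ ^ 2 * ‖D.G v‖ ^ 2 + ‖D.G v‖ ^ 4)
    + M * (2 * D.a v v + (2 * |D.a u v| + D.a v v) ^ 2) := ⟨_, rfl⟩
  have hav := D.a_nonneg v
  have hR0 : 0 ≤ R := by rw [hR]; positivity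
  -- the first order term in `s` of the inequality at `u + s v` must vanish
  have key : ∀ s : ℝ, |s| ≤ 1 → 4 * s * d ≤ R * s ^ 2 := by
    intro s hs
    have hs2 : s ^ 2 ≤ 1 := by rw [← sq_abs]; exact pow_le_one₀ (abs_nonneg _) hs
    have h1 := hmax (u + s • v)
    have h2 := (abs_le.1 (hC u (s • v))).1
    rw [D.a_add, D.a_smul, map_smul, smul_eq_mul, hu, ← hM] at h1
    have e2 : ‖D.G (s • v)‖ ^ 2 = s ^ 2 * ‖D.G v‖ ^ 2 := by
      rw [map_smul, norm_smul, mul_pow, Real.norm_eq_abs, sq_abs]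
    rw [D.b_smul_right, D.norm_G_smul, e2, ← hM] at h2
    have h3 : s ^ 4 * ‖D.G v‖ ^ 4 ≤ s ^ 2 * ‖D.G v‖ ^ 4 := by
      refine mul_le_mul_of_nonneg_right ?_ (by positivity)
      nlinarith [mul_le_mul_of_nonneg_left hs2 (sq_nonneg s)]
    have h4 : C * (‖D.G u‖ ^ 2 * (s ^ 2 * ‖D.G v‖ ^ 2) + s ^ 4 * ‖D.G v‖ ^ 4)
        ≤ C * (‖D.G u‖ ^ 2 * ‖D.G v‖ ^ 2 + ‖D.G v‖ ^ 4) * s ^ 2 := by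
      rw [mul_assoc]
      refine mul_le_mul_of_nonneg_left ?_ hC0
      linarith
    have h5 : (1 + 2 * (s * D.a u v) + s ^ 2 * D.a v v) ^ 2
        ≤ 1 + 4 * s * D.a u v + (2 * D.a v v + (2 * |D.a u v| + D.a v v) ^ 2) * s ^ 2 := by
      have e : 2 * (s * D.a u v) + s ^ 2 * D.a v v = s * (2 * D.a u v + s * D.a v v) := by ring
      have h6 : (2 * D.a u v + s * D.a v v) ^ 2 ≤ (2 * |D.a u v| + D.a v v) ^ 2 := by
        refine sq_le_sq.2 ?_
        rw [abs_of_nonneg (by positivity : 0 ≤ 2 * |D.a u v| + D.a v v)]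
        refine (abs_add_le _ _).trans (add_le_add ?_ ?_)
        · rw [abs_mul]
          norm_num
        · rw [abs_mul, abs_of_nonneg hav]
          exact mul_le_of_le_one_left hav hs
      have h7 := mul_le_mul_of_nonneg_left h6 (sq_nonneg s)
      nlinarith
    have h8 := mul_le_mul_of_nonneg_left h5 hM0
    rw [hd, hR]
    nlinarith
  have hd0 : d = 0 := by
    by_contra hne
    have hpos : 0 < |d| := abs_pos.2 hne
    obtain ⟨s, hs0, hs1, hs⟩ : ∃ s : ℝ, 0 < s ∧ s ≤ 1 ∧ R * s < |d| := by
      refine ⟨min 1 (|d| / (R + 1) / 2), by positivity, min_le_left _ _, ?_⟩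
      calc R * min 1 (|d| / (R + 1) / 2) ≤ (R + 1) * (|d| / (R + 1) / 2) :=
            mul_le_mul (by linarith) (min_le_right _ _) (by positivity) (by positivity)
        _ = |d| / 2 := by field_simp
        _ < |d| := by linarith
    have hs2 := mul_lt_mul_of_pos_right hs hs0
    rcases abs_cases d with ⟨h, -⟩ | ⟨h, -⟩
    · have := key s (by rw [abs_of_pos hs0]; exact hs1)
      rw [h] at hs2 hpos
      nlinarith
    · have := key (-s) (by rw [abs_neg, abs_of_pos hs0]; exact hs1)
      rw [h] at hs2 hpos
      nlinarith
  linarith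

section Complete

variable [CompleteSpace E] [SeparableSpace E]

/-- In infinite dimensions a compact map has no positive lower bound on the unit sphere. -/
lemma exists_norm_G_lt (hinf : ¬ FiniteDimensional ℝ E) {δ : ℝ} (hδ : 0 < δ) :
    ∃ v : E, ‖D.G v‖ < δ * ‖v‖ := by
  by_contra hcon
  push Not at hcon
  refine hinf (FiniteDimensional.of_isCompact_closedBall ℝ (r := 1) one_pos (c := (0 : E))
    (IsSeqCompact.isCompact fun u hu => ?_))
  have hu1 : ∀ n, ‖u n‖ ≤ 1 := fun n => mem_closedBall_zero_iff.1 (hu n)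
  obtain ⟨w, φ, hφ, hw⟩ := exists_subseq_tendsto_weak hu1
  have hG := D.compact (fun n => u (φ n)) w ⟨1, fun n => hu1 _⟩ hw
  have hlim : Tendsto (fun n => u (φ n)) atTop (𝓝 w) := by
    rw [tendsto_iff_norm_sub_tendsto_zero] at hG ⊢
    refine squeeze_zero (fun _ => norm_nonneg _) (fun n => ?_) (by simpa using hG.const_mul δ⁻¹)
    rw [le_inv_mul_iff₀ hδ, ← map_sub]
    exact hcon _
  exact ⟨w, isClosed_closedBall.mem_of_tendsto hlim (Eventually.of_forall fun n => hu _), φ, hφ,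
    hlim⟩

/-- The quotient `‖G v‖⁴ / a(v,v)²` attains its maximum. -/
lemma exists_maximizer :
    ∃ u : E, D.a u u = 1 ∧ 0 < ‖D.G u‖ ^ 4 ∧
      ∀ v, ‖D.G v‖ ^ 4 ≤ ‖D.G u‖ ^ 4 * D.a v v ^ 2 := by
  obtain ⟨c, hc, hcoer⟩ := D.coercive
  let S : Set ℝ := (fun v => ‖D.G v‖ ^ 4) '' {v | D.a v v ≤ 1}
  have hbd : ∀ v, D.a v v ≤ 1 → ‖v‖ ≤ √(c⁻¹) := fun v hv => by
    refine Real.le_sqrt_of_sq_le ?_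
    rw [← mul_one c⁻¹, le_inv_mul_iff₀ hc]
    exact (hcoer v).trans hv
  have hSbdd : BddAbove S := by
    refine ⟨(‖D.G‖ * √(c⁻¹)) ^ 4, ?_⟩
    rintro _ ⟨v, hv, rfl⟩
    exact pow_le_pow_left₀ (norm_nonneg _) ((D.G.le_opNorm v).trans (by gcongr; exact hbd v hv)) 4
  have hSne : S.Nonempty := ⟨_, 0, by simp, rfl⟩
  obtain ⟨x, -, hxlim, hxS⟩ := exists_seq_tendsto_sSup hSne hSbdd
  choose u hu hux using hxS
  obtain ⟨w, φ, hφ, hw⟩ := exists_subseq_tendsto_weak (fun n => hbd _ (hu n))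
  have hG := D.compact (fun n => u (φ n)) w ⟨_, fun n => hbd _ (hu _)⟩ hw
  have hwM : ‖D.G w‖ ^ 4 = sSup S := by
    refine tendsto_nhds_unique (hG.norm.pow 4) ((hxlim.comp hφ.tendsto_atTop).congr fun n => ?_)
    exact (hux (φ n)).symm
  have hw1 : D.a w w ≤ 1 := by
    have h1 : ∀ n, 0 ≤ 1 - 2 * D.a w (u (φ n)) + D.a w w := fun n => by
      have h2 := D.a_nonneg (u (φ n) + (-1 : ℝ) • w)
      rw [D.a_add, D.a_smul, map_smul, smul_eq_mul, D.symm (u (φ n)) w] at h2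
      have h3 : D.a (u (φ n)) (u (φ n)) ≤ 1 := hu (φ n)
      linarith
    have h2 : Tendsto (fun n => 1 - 2 * D.a w (u (φ n)) + D.a w w) atTop
        (𝓝 (1 - 2 * D.a w w + D.a w w)) := (((hw (D.a w)).const_mul 2).const_sub 1).add_const _
    linarith [ge_of_tendsto' h2 h1]
  have hmax : ∀ v, ‖D.G v‖ ^ 4 ≤ ‖D.G w‖ ^ 4 * D.a v v ^ 2 := fun v => by
    rcases eq_or_ne v 0 with rfl | hv
    · simp
    · have hpos := D.a_pos hv
      have h1 : ‖D.G ((√(D.a v v))⁻¹ • v)‖ ^ 4 ≤ sSup S := by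
        refine le_csSup hSbdd ⟨_, ?_, rfl⟩
        change D.a _ _ ≤ 1
        rw [D.a_smul, inv_pow, Real.sq_sqrt hpos.le, inv_mul_cancel₀ hpos.ne']
      have h2 : ((√(D.a v v))⁻¹) ^ 4 = (D.a v v ^ 2)⁻¹ := by
        rw [inv_pow, show (4 : ℕ) = 2 * 2 from rfl, pow_mul, Real.sq_sqrt hpos.le]
      rw [D.norm_G_smul, h2, inv_mul_le_iff₀ (by positivity), ← hwM] at h1
      linarith
  have hwpos : 0 < ‖D.G w‖ ^ 4 := by
    obtain ⟨v, hv⟩ := D.nontrivial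
    have h1 : 0 < ‖D.G v‖ ^ 4 := pow_pos (norm_pos_iff.2 hv) 4
    by_contra hcon
    have h2 := (hmax v).trans (mul_nonpos_of_nonpos_of_nonneg (not_lt.1 hcon) (sq_nonneg _))
    linarith
  refine ⟨w, le_antisymm hw1 ?_, hwpos, hmax⟩
  have h1 := hmax w
  have h2 : 1 ≤ D.a w w ^ 2 := by
    by_contra hcon
    nlinarith
  by_contra hcon
  nlinarith [D.a_nonneg w]

/-- A ground state exists; it minimises the functional on the Nehari manifold and it is a saddle
point. -/
theorem exists_groundState (hinf : ¬ FiniteDimensional ℝ E) {κ : ℝ} (hκ : 0 < κ) :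
    ∃ u : E, u ≠ 0 ∧ (∀ v, D.a u v = κ * D.b u v) ∧ D.a u u = κ * ‖D.G u‖ ^ 4 ∧ 0 < D.J κ u ∧
      (∀ v, v ≠ 0 → D.a v v = κ * ‖D.G v‖ ^ 4 → D.J κ u ≤ D.J κ v) ∧
      IsSaddleCriticalPoint (D.J κ) u := by
  obtain ⟨u₀, h1, hM0, hmax⟩ := D.exists_maximizer
  have hb := D.b_eq_of_maximizer h1 hmax
  obtain ⟨M, hM⟩ : ∃ M, M = ‖D.G u₀‖ ^ 4 := ⟨_, rfl⟩
  rw [← hM] at hM0 hmax hb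
  set t := √((κ * M)⁻¹) with ht
  have hκM : 0 < κ * M := by positivity
  have ht0 : 0 < t := Real.sqrt_pos.2 (inv_pos.2 hκM)
  have ht2 : t ^ 2 = (κ * M)⁻¹ := Real.sq_sqrt (inv_pos.2 hκM).le
  have ht2' : κ * M * t ^ 2 = 1 := by rw [ht2]; exact mul_inv_cancel₀ hκM.ne'
  obtain ⟨u, hu⟩ : ∃ u, u = t • u₀ := ⟨_, rfl⟩
  have hu₀ : u₀ ≠ 0 := by
    rintro rfl
    simp at h1
  have hu0 : u ≠ 0 := hu ▸ smul_ne_zero ht0.ne' hu₀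
  have hweak : ∀ v, D.a u v = κ * D.b u v := fun v => by
    rw [hu, D.b_smul_left, hb, map_smul, smul_apply, smul_eq_mul]
    linear_combination (-t * D.a u₀ v) * ht2'
  have hself : D.a u u = κ * ‖D.G u‖ ^ 4 := by rw [hweak, D.b_self]
  have hauu : D.a u u = t ^ 2 := by rw [hu, D.a_smul, h1, mul_one]
  have hJ : D.J κ u = 1 / 4 * t ^ 2 := by rw [D.J_eq_of_nehari hself, hauu]
  refine ⟨u, hu0, hweak, hself, by rw [hJ]; positivity, fun v hv hvN => ?_,
    D.hasFDerivAt_J hκ hweak, fun V hV => ?_⟩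
  · rw [hJ, D.J_eq_of_nehari hvN, ht2]
    have hpos := D.a_pos hv
    have h2 := mul_le_mul_of_nonneg_left (hmax v) hκ.le
    rw [← hvN] at h2
    have h3 : 1 ≤ D.a v v * (κ * M) := by
      refine le_of_mul_le_mul_left (a := D.a v v) ?_ hpos
      linarith
    have h4 : (κ * M)⁻¹ ≤ D.a v v := by rwa [inv_le_iff_one_le_mul₀ hκM]
    linarith
  · obtain ⟨ε, hε, hball⟩ := Metric.mem_nhds_iff.1 hV
    have hun : 0 < ‖u‖ := norm_pos_iff.2 hu0
    -- the energy decreases along the ray through `u`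
    obtain ⟨s, hs0, hs⟩ : ∃ s : ℝ, 0 < s ∧ s * ‖u‖ < ε :=
      ⟨ε / ‖u‖ / 2, by positivity, by field_simp; linarith⟩
    refine ⟨(1 + s) • u, hball ?_, ?_⟩
    · rw [mem_ball, dist_eq_norm, add_smul, one_smul, add_sub_cancel_left, norm_smul,
        Real.norm_of_nonneg hs0.le]
      exact hs
    have hlow : D.J κ ((1 + s) • u) < D.J κ u := by
      have e : D.J κ ((1 + s) • u) - D.J κ u = -(1 / 4) * D.a u u * (s * (2 + s)) ^ 2 := by
        rw [J, J, D.a_smul, D.norm_G_smul]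
        linear_combination (1 / 4) * ((1 + s) ^ 4 - 1) * hself
      have : 0 < D.a u u * (s * (2 + s)) ^ 2 := mul_pos (D.a_pos hu0) (by positivity)
      linarith
    -- it increases in directions in which the quartic part is negligible
    obtain ⟨c, hc, hcoer⟩ := D.coercive
    obtain ⟨C, hC0, hC⟩ := D.J_add_sub hκ hweak
    obtain ⟨B, hB⟩ : ∃ B, B = C * (‖D.G u‖ ^ 2 + 1) + 1 := ⟨_, rfl⟩
    have hB0 : 0 < B := by rw [hB]; positivity
    obtain ⟨δ, hδ0, hδ1, hδ⟩ : ∃ δ : ℝ, 0 < δ ∧ δ ≤ 1 ∧ B * δ ^ 2 < 1 / 2 * c := by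
      refine ⟨min 1 (c / B / 4), by positivity, min_le_left _ _, ?_⟩
      have h5 : (min 1 (c / B / 4)) ^ 2 ≤ 1 * (c / B / 4) := by
        rw [pow_two]
        exact mul_le_mul (min_le_left _ _) (min_le_right _ _) (by positivity) zero_le_one
      calc B * (min 1 (c / B / 4)) ^ 2 ≤ B * (1 * (c / B / 4)) := by gcongr
        _ = c / 4 := by field_simp
        _ < 1 / 2 * c := by linarith
    obtain ⟨v, hv⟩ := D.exists_norm_G_lt hinf hδ0
    have hvn : 0 < ‖v‖ := by
      rcases (norm_nonneg v).eq_or_lt with h0 | h0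
      · rw [← h0, mul_zero] at hv
        exact absurd hv (not_lt.2 (norm_nonneg _))
      · exact h0
    obtain ⟨τ, hτ0, hτε, hτ1⟩ : ∃ τ : ℝ, 0 < τ ∧ τ * ‖v‖ < ε ∧ τ * ‖v‖ ≤ 1 := by
      refine ⟨min (ε / 2) 1 / ‖v‖, by positivity, ?_, ?_⟩
      · rw [div_mul_cancel₀ _ hvn.ne']
        exact (min_le_left _ _).trans_lt (by linarith)
      · rw [div_mul_cancel₀ _ hvn.ne']
        exact min_le_right _ _
    have hnτ : ‖τ • v‖ = τ * ‖v‖ := by rw [norm_smul, Real.norm_of_nonneg hτ0.le]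
    refine ⟨u + τ • v, hball ?_, hlow, ?_⟩
    · rw [mem_ball, dist_eq_norm, add_sub_cancel_left, hnτ]
      exact hτε
    obtain ⟨z, hz⟩ : ∃ z, z = τ • v := ⟨_, rfl⟩
    rw [← hz] at hnτ ⊢
    have hGz : ‖D.G z‖ ≤ δ * ‖z‖ := by
      rw [hnτ, hz, map_smul, norm_smul, Real.norm_of_nonneg hτ0.le, mul_left_comm]
      gcongr
    have hz0 : 0 < ‖z‖ := by rw [hnτ]; positivity
    have hGz1 : ‖D.G z‖ ≤ 1 := hGz.trans (mul_le_one₀ hδ1 hz0.le (hnτ ▸ hτ1))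
    have hG2 : ‖D.G z‖ ^ 2 ≤ δ ^ 2 * ‖z‖ ^ 2 := by
      rw [← mul_pow]
      exact pow_le_pow_left₀ (norm_nonneg _) hGz 2
    have hG4 : ‖D.G z‖ ^ 4 ≤ ‖D.G z‖ ^ 2 :=
      pow_le_pow_of_le_one (norm_nonneg _) hGz1 (by norm_num)
    have h6 := (abs_le.1 (hC z)).1
    have h7 : C * (‖D.G u‖ ^ 2 * ‖D.G z‖ ^ 2 + ‖D.G z‖ ^ 4) ≤ B * (δ ^ 2 * ‖z‖ ^ 2) := by
      calc _ ≤ C * (‖D.G u‖ ^ 2 * ‖D.G z‖ ^ 2 + ‖D.G z‖ ^ 2) := by gcongr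
        _ = C * (‖D.G u‖ ^ 2 + 1) * ‖D.G z‖ ^ 2 := by ring
        _ ≤ B * (δ ^ 2 * ‖z‖ ^ 2) := by
          refine mul_le_mul ?_ hG2 (by positivity) hB0.le
          rw [hB]
          linarith
    have h8 : B * (δ ^ 2 * ‖z‖ ^ 2) < 1 / 2 * D.a z z := by
      calc B * (δ ^ 2 * ‖z‖ ^ 2) = B * δ ^ 2 * ‖z‖ ^ 2 := by ring
        _ < 1 / 2 * c * ‖z‖ ^ 2 := by gcongr
        _ ≤ _ := by linarith [hcoer z]
    linarith

end Complete

end QuarticProblem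

/-! ### The quartic functional on `L⁴` -/

section Quartic

variable {V : Type*} [NormedAddCommGroup V]
  {α : Type*} [MeasurableSpace α] {μ : Measure α}

lemma integrable_norm_pow_four {f : α → V} (hf : MemLp f 4 μ) :
    Integrable (fun x => ‖f x‖ ^ 4) μ :=
  MemLp.integrable_norm_pow (p := 4) (by exact_mod_cast hf) (by norm_num)

lemma memLp_norm_sq {f : α → V} (hf : MemLp f 4 μ) : MemLp (fun x => ‖f x‖ ^ 2) 2 μ := by
  refine (memLp_two_iff_integrable_sq (hf.1.norm.pow 2)).2 ?_
  refine (integrable_norm_pow_four hf).congr (Eventually.of_forall fun x => ?_)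
  change ‖f x‖ ^ 4 = (‖f x‖ ^ 2) ^ 2
  ring

lemma eLpNorm_four_toReal_pow {f : α → V} (hf : MemLp f 4 μ) :
    (eLpNorm f 4 μ).toReal ^ 4 = ∫ x, ‖f x‖ ^ 4 ∂μ := by
  have h := hf.eLpNorm_eq_integral_rpow_norm (by norm_num) (by norm_num)
  have h0 : 0 ≤ ∫ x, ‖f x‖ ^ 4 ∂μ := integral_nonneg fun x => by positivity
  simp only [ENNReal.toReal_ofNat, Real.rpow_ofNat] at h
  rw [h, ENNReal.toReal_ofReal (by positivity), ← Real.rpow_natCast, ← Real.rpow_mul h0]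
  norm_num

instance : Fact ((1 : ℝ≥0∞) ≤ 4) := ⟨by norm_num⟩

lemma norm_pow_four_eq (f : Lp V 4 μ) : ‖f‖ ^ 4 = ∫ x, ‖f x‖ ^ 4 ∂μ := by
  rw [Lp.norm_def, eLpNorm_four_toReal_pow (Lp.memLp f)]

variable [InnerProductSpace ℝ V]

lemma abs_norm_add_pow_four_sub_le (p q : V) :
    |‖p + q‖ ^ 4 - ‖p‖ ^ 4 - 4 * (‖p‖ ^ 2 * inner ℝ p q)|
      ≤ 8 * (‖p‖ ^ 2 * ‖q‖ ^ 2) + 3 * ‖q‖ ^ 4 := by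
  have h1 : ‖p + q‖ ^ 4 = (‖p‖ ^ 2 + 2 * inner ℝ p q + ‖q‖ ^ 2) ^ 2 := by
    rw [← norm_add_sq_real]
    ring
  have h2 : (inner ℝ p q) ^ 2 ≤ ‖p‖ ^ 2 * ‖q‖ ^ 2 := by
    rw [← mul_pow, ← sq_abs]
    exact pow_le_pow_left₀ (abs_nonneg _) (abs_real_inner_le_norm p q) 2
  rw [h1, abs_le]
  constructor <;> nlinarith [sq_nonneg (inner ℝ p q + ‖q‖ ^ 2), sq_nonneg (inner ℝ p q - ‖q‖ ^ 2),
    sq_nonneg (inner ℝ p q), sq_nonneg (‖q‖ ^ 2), sq_nonneg (‖p‖ ^ 2)]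

lemma integrable_norm_sq_mul_inner {f g : α → V} (hf : MemLp f 4 μ) (hg : MemLp g 4 μ) :
    Integrable (fun x => ‖f x‖ ^ 2 * inner ℝ (f x) (g x)) μ := by
  refine ((integrable_norm_pow_four hf).add (integrable_norm_pow_four hg)).mono'
    ((hf.1.norm.pow 2).mul (hf.1.inner hg.1)) (Eventually.of_forall fun x => ?_)
  rw [norm_mul, norm_pow, norm_norm, Real.norm_eq_abs]
  have h1 := abs_real_inner_le_norm (f x) (g x)
  have h2 : ‖f x‖ ^ 2 * |inner ℝ (f x) (g x)| ≤ ‖f x‖ ^ 2 * (‖f x‖ * ‖g x‖) := by gcongr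
  refine h2.trans ?_
  change _ ≤ ‖f x‖ ^ 4 + ‖g x‖ ^ 4
  nlinarith [sq_nonneg (‖f x‖ ^ 2 - ‖f x‖ * ‖g x‖), sq_nonneg (‖f x‖ ^ 2 - ‖g x‖ ^ 2),
    sq_nonneg (‖f x‖ - ‖g x‖), sq_nonneg (‖f x‖ ^ 2), sq_nonneg (‖g x‖ ^ 2),
    mul_nonneg (sq_nonneg ‖f x‖) (sq_nonneg (‖f x‖ - ‖g x‖))]

/-- A quarter of the derivative of the fourth power of the norm of `L⁴`. -/
def quarticDeriv (f g : Lp V 4 μ) : ℝ := ∫ x, ‖f x‖ ^ 2 * inner ℝ (f x) (g x) ∂μ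

lemma quarticDeriv_self (f : Lp V 4 μ) : quarticDeriv f f = ‖f‖ ^ 4 := by
  rw [norm_pow_four_eq, quarticDeriv]
  congr 1 with x
  rw [real_inner_self_eq_norm_sq]
  ring

lemma quarticDeriv_smul_right (s : ℝ) (f g : Lp V 4 μ) :
    quarticDeriv f (s • g) = s * quarticDeriv f g := by
  rw [quarticDeriv, quarticDeriv, ← integral_const_mul]
  refine integral_congr_ae ?_
  filter_upwards [Lp.coeFn_smul s g] with x hx
  rw [hx, Pi.smul_apply, real_inner_smul_right]
  ring

lemma quarticDeriv_smul_left (s : ℝ) (f g : Lp V 4 μ) :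
    quarticDeriv (s • f) g = s ^ 3 * quarticDeriv f g := by
  rw [quarticDeriv, quarticDeriv, ← integral_const_mul]
  refine integral_congr_ae ?_
  filter_upwards [Lp.coeFn_smul s f] with x hx
  rw [hx, Pi.smul_apply, real_inner_smul_left, norm_smul, mul_pow, Real.norm_eq_abs, sq_abs]
  ring

lemma abs_norm_pow_four_sub_le (f g : Lp V 4 μ) :
    |‖f + g‖ ^ 4 - ‖f‖ ^ 4 - 4 * quarticDeriv f g| ≤ 8 * (‖f‖ ^ 2 * ‖g‖ ^ 2 + ‖g‖ ^ 4) := by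
  have hf := Lp.memLp f
  have hg := Lp.memLp g
  have i1 := integrable_norm_pow_four (Lp.memLp (f + g))
  have i2 := integrable_norm_pow_four hf
  have i3 := (integrable_norm_sq_mul_inner hf hg).const_mul 4
  have i4 := integrable_norm_pow_four hg
  have n2 : ∀ h : Lp V 4 μ, l2norm μ (fun x => ‖h x‖ ^ 2) = ‖h‖ ^ 2 := fun h => by
    have h1 : l2norm μ (fun x => ‖h x‖ ^ 2) ^ 2 = (‖h‖ ^ 2) ^ 2 := by
      rw [l2norm_sq (memLp_norm_sq (Lp.memLp h)), ← pow_mul, norm_pow_four_eq]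
      congr 1 with x
      ring
    exact (pow_left_inj₀ (l2norm_nonneg _) (by positivity) (by norm_num)).1 h1
  have i5 : Integrable (fun x => ‖f x‖ ^ 2 * ‖g x‖ ^ 2) μ :=
    (memLp_norm_sq hf).integrable_mul (memLp_norm_sq hg)
  have h5 : ∫ x, ‖f x‖ ^ 2 * ‖g x‖ ^ 2 ∂μ ≤ ‖f‖ ^ 2 * ‖g‖ ^ 2 := by
    rw [← n2, ← n2]
    exact (le_abs_self _).trans (abs_integral_mul_le (memLp_norm_sq hf) (memLp_norm_sq hg))
  have e : ‖f + g‖ ^ 4 - ‖f‖ ^ 4 - 4 * quarticDeriv f g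
      = ∫ x, (‖(f + g : Lp V 4 μ) x‖ ^ 4 - ‖f x‖ ^ 4
        - 4 * (‖f x‖ ^ 2 * inner ℝ (f x) (g x))) ∂μ := by
    have i12 : Integrable (fun x => ‖(f + g : Lp V 4 μ) x‖ ^ 4 - ‖f x‖ ^ 4) μ := i1.sub i2
    rw [integral_sub i12 i3, integral_sub i1 i2, integral_const_mul, norm_pow_four_eq,
      norm_pow_four_eq, quarticDeriv]
  rw [e]
  have hb : |∫ x, (‖(f + g : Lp V 4 μ) x‖ ^ 4 - ‖f x‖ ^ 4
        - 4 * (‖f x‖ ^ 2 * inner ℝ (f x) (g x))) ∂μ|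
      ≤ ∫ x, (8 * (‖f x‖ ^ 2 * ‖g x‖ ^ 2) + 3 * ‖g x‖ ^ 4) ∂μ := by
    rw [← Real.norm_eq_abs]
    refine norm_integral_le_of_norm_le ((i5.const_mul 8).add (i4.const_mul 3)) ?_
    filter_upwards [Lp.coeFn_add f g] with x hx
    rw [hx, Pi.add_apply, Real.norm_eq_abs]
    exact abs_norm_add_pow_four_sub_le _ _
  refine hb.trans ?_
  rw [integral_add (i5.const_mul 8) (i4.const_mul 3), integral_const_mul, integral_const_mul,
    ← norm_pow_four_eq]
  nlinarith [pow_nonneg (norm_nonneg g) 4]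

end Quartic

/-! ### The gradient as a compact map into `L⁴` -/

section Gradient

variable {N : ℕ} {Ω : Opens (Space N)}

lemma HasCkHolderBoundary.forall_exists_inwardCone {k : ℕ} (hk : 1 ≤ k) {η : ℝ≥0}
    (hreg : HasCkHolderBoundary k η (Ω : Set (Space N))) :
    ∀ x ∈ closure (Ω : Set (Space N)), ∃ (r : ℝ) (ν : Space N) (s : ℝ), 0 < r ∧ 0 < s ∧
      HasInwardCone (Ω : Set (Space N)) x r ν s :=
  fun _ hx => hreg.exists_inwardCone hk Ω.isOpen hx

lemma eLpNorm_jet_le (U : JetSpace 2 Ω) (α : JetIndex N 2) :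
    eLpNorm (U α) 2 (volume.restrict (Ω : Set (Space N))) ≤ ENNReal.ofReal ‖U‖ := by
  rw [← ENNReal.ofReal_toReal (Lp.memLp (U α)).2.ne, ← Lp.norm_def]
  exact ENNReal.ofReal_le_ofReal (PiLp.norm_apply_le U α)

lemma eLpNorm_sum_norm_jetHessian_le (U : JetSpace 2 Ω) (i : Fin N) :
    eLpNorm (fun y => ∑ j, ‖jetHessian U i j y‖) 2 (volume.restrict (Ω : Set (Space N)))
      ≤ ENNReal.ofReal (N * ‖U‖) := by
  have h1 := eLpNorm_sum_le (μ := volume.restrict (Ω : Set (Space N))) (p := 2)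
    (s := Finset.univ) (f := fun j y => ‖jetHessian U i j y‖)
    (fun j _ => (Lp.memLp (U (secondIndex i j))).1.norm) (by norm_num)
  have e : (∑ j, fun y => ‖jetHessian U i j y‖) = fun y => ∑ j, ‖jetHessian U i j y‖ := by
    ext y
    simp
  rw [e] at h1
  refine h1.trans ?_
  calc _ ≤ ∑ _j : Fin N, ENNReal.ofReal ‖U‖ := by
        refine Finset.sum_le_sum fun j _ => ?_
        rw [eLpNorm_norm]
        exact eLpNorm_jet_le U (secondIndex i j)
    _ = _ := by
        rw [Finset.sum_const, Finset.card_univ, Fintype.card_fin, nsmul_eq_mul,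
          ENNReal.ofReal_mul (Nat.cast_nonneg N), ENNReal.ofReal_natCast]

lemma aestronglyMeasurable_grad (U : JetSpace 2 Ω) :
    AEStronglyMeasurable (grad U) (volume.restrict (Ω : Set (Space N))) :=
  ((memLp_piLp_iff (p := 2)).2 fun i => Lp.memLp (U (firstIndex N 1 i))).1

lemma eLpNorm_grad_le (U : JetSpace 2 Ω) :
    eLpNorm (grad U) 4 (volume.restrict (Ω : Set (Space N)))
      ≤ ∑ i, eLpNorm (jetGrad U i) 4 (volume.restrict (Ω : Set (Space N))) := by
  have h1 := eLpNorm_sum_le (μ := volume.restrict (Ω : Set (Space N))) (p := 4)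
    (s := Finset.univ) (f := fun i y => ‖jetGrad U i y‖)
    (fun i _ => (Lp.memLp (U (firstIndex N 1 i))).1.norm) (by norm_num)
  simp only [eLpNorm_norm] at h1
  refine (eLpNorm_mono_real fun x => ?_).trans h1
  rw [Finset.sum_apply, EuclideanSpace.norm_eq]
  refine Real.sqrt_le_iff.2 ⟨Finset.sum_nonneg fun _ _ => norm_nonneg _, ?_⟩
  exact Finset.sum_sq_le_sq_sum_of_nonneg fun i _ => norm_nonneg _

/-- The Sobolev embedding `W^{2,2}(Ω) → W^{1,4}(Ω)` in dimension at most three. -/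
lemma exists_eLpNorm_grad_le (hN : N ≤ 3) {k : ℕ} (hk : 1 ≤ k) {η : ℝ≥0}
    (hbdd : Bornology.IsBounded (Ω : Set (Space N)))
    (hreg : HasCkHolderBoundary k η (Ω : Set (Space N))) :
    ∃ C : ℝ, 0 ≤ C ∧ ∀ U ∈ sobolev 2 Ω,
      eLpNorm (grad U) 4 (volume.restrict (Ω : Set (Space N))) ≤ ENNReal.ofReal (C * ‖U‖) := by
  obtain ⟨C, hC⟩ := exists_eLpNorm_four_le hN Ω.isOpen hbdd (hreg.forall_exists_inwardCone hk)
  refine ⟨N * (C * (1 + N)), by positivity, fun U hU => (eLpNorm_grad_le U).trans ?_⟩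
  calc _ ≤ ∑ _i : Fin N, ENNReal.ofReal (C * (1 + N) * ‖U‖) := by
        refine Finset.sum_le_sum fun i _ => (hC _ _ (Lp.memLp _) (fun j => Lp.memLp _)
          fun j => hasWeakDeriv_jetGrad hbdd hU i j).trans ?_
        calc _ ≤ (C : ℝ≥0∞) * (ENNReal.ofReal ‖U‖ + ENNReal.ofReal (N * ‖U‖)) := by
              gcongr
              · exact eLpNorm_jet_le U _
              · exact eLpNorm_sum_norm_jetHessian_le U i
          _ = _ := by
              rw [← ENNReal.ofReal_add (norm_nonneg _) (by positivity),
                ← ENNReal.ofReal_coe_nnreal, ← ENNReal.ofReal_mul (NNReal.coe_nonneg C)]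
              congr 1
              ring
    _ = _ := by
        rw [Finset.sum_const, Finset.card_univ, Fintype.card_fin, nsmul_eq_mul,
          ← ENNReal.ofReal_natCast, ← ENNReal.ofReal_mul (Nat.cast_nonneg N)]
        congr 1
        ring

lemma memLp_grad (hN : N ≤ 3) {k : ℕ} (hk : 1 ≤ k) {η : ℝ≥0}
    (hbdd : Bornology.IsBounded (Ω : Set (Space N)))
    (hreg : HasCkHolderBoundary k η (Ω : Set (Space N))) {U : JetSpace 2 Ω}
    (hU : U ∈ sobolev 2 Ω) : MemLp (grad U) 4 (volume.restrict (Ω : Set (Space N))) := by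
  obtain ⟨C, -, hC⟩ := exists_eLpNorm_grad_le hN hk hbdd hreg
  exact ⟨aestronglyMeasurable_grad U, (hC U hU).trans_lt ENNReal.ofReal_lt_top⟩

lemma jetGrad_add_ae (U V : JetSpace 2 Ω) (i : Fin N) :
    jetGrad (U + V) i =ᵐ[volume.restrict (Ω : Set (Space N))]
      fun x => jetGrad U i x + jetGrad V i x :=
  Lp.coeFn_add (U (firstIndex N 1 i)) (V (firstIndex N 1 i))

lemma grad_add_ae (U V : JetSpace 2 Ω) :
    grad (U + V) =ᵐ[volume.restrict (Ω : Set (Space N))] fun x => grad U x + grad V x := by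
  filter_upwards [ae_all_iff.2 fun i => jetGrad_add_ae U V i] with x hx
  ext i
  exact hx i

lemma grad_smul_ae (c : ℝ) (U : JetSpace 2 Ω) :
    grad (c • U) =ᵐ[volume.restrict (Ω : Set (Space N))] fun x => c • grad U x := by
  filter_upwards [ae_all_iff.2 fun i => Lp.coeFn_smul c (U (firstIndex N 1 i))] with x hx
  ext i
  exact hx i

/-- Weak convergence in `W^{2,2}(Ω)` implies convergence of the gradients in `L⁴(Ω)`. -/
lemma tendsto_eLpNorm_grad (hN : N ≤ 3) {k : ℕ} (hk : 1 ≤ k) {η : ℝ≥0}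
    (hbdd : Bornology.IsBounded (Ω : Set (Space N)))
    (hreg : HasCkHolderBoundary k η (Ω : Set (Space N))) {U : ℕ → JetSpace 2 Ω}
    (hU : ∀ n, U n ∈ sobolev 2 Ω) {R : ℝ} (hR : ∀ n, ‖U n‖ ≤ R)
    (hweak : ∀ ℓ : JetSpace 2 Ω →L[ℝ] ℝ, Tendsto (fun n => ℓ (U n)) atTop (𝓝 0)) :
    Tendsto (fun n => eLpNorm (grad (U n)) 4 (volume.restrict (Ω : Set (Space N)))) atTop
      (𝓝 0) := by
  have hR0 : 0 ≤ R := (norm_nonneg _).trans (hR 0)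
  have hcomp : ∀ i, Tendsto (fun n => eLpNorm (jetGrad (U n) i) 4
      (volume.restrict (Ω : Set (Space N)))) atTop (𝓝 0) := by
    intro i
    refine tendsto_eLpNorm_four_of_weak hN Ω.isOpen hbdd (hreg.forall_exists_inwardCone hk)
      (K := Real.toNNReal ((1 + N) * R)) (g := fun n => jetHessian (U n) i)
      (fun n => Lp.memLp _) (fun n j => Lp.memLp _) (fun n j => hasWeakDeriv_jetGrad hbdd (hU n) i j)
      (fun n => (eLpNorm_jet_le (U n) _).trans (ENNReal.ofReal_le_ofReal ?_))
      (fun n => (eLpNorm_sum_norm_jetHessian_le (U n) i).trans (ENNReal.ofReal_le_ofReal ?_))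
      (fun h hh => ?_)
    · nlinarith [hR n, (Nat.cast_nonneg N : (0 : ℝ) ≤ N)]
    · nlinarith [hR n, (Nat.cast_nonneg N : (0 : ℝ) ≤ N)]
    · have := hweak (pairing (firstIndex N 1 i) hh)
      simp only [pairing_apply] at this
      exact this
  have hsum := tendsto_finsetSum Finset.univ fun i _ => hcomp i
  rw [Finset.sum_const_zero] at hsum
  exact tendsto_of_tendsto_of_tendsto_of_le_of_le tendsto_const_nhds hsum
    (fun _ => zero_le) (fun n => eLpNorm_grad_le (U n))

end Gradient

section InfiniteDimension

variable {N : ℕ} {Ω : Opens (Space N)}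

lemma eq_zero_of_testJet_zeroIndex {k : ℕ} {φ : 𝓓(Ω, ℝ)}
    (h : testJet k Ω φ (zeroIndex N k) = 0) : φ = 0 := by
  have h1 := testJet_zeroIndex_ae (k := k) φ
  rw [h] at h1
  have h2 := Lp.coeFn_zero ℝ 2 (volume.restrict (Ω : Set (Space N)))
  have h3 : (φ : Space N → ℝ) =ᵐ[volume] (fun _ => 0) := by
    have h4 : ∀ᵐ x ∂(volume.restrict (Ω : Set (Space N))), φ x = 0 := by
      filter_upwards [h1, h2] with x hx1 hx2
      rw [← hx1]
      exact hx2
    rw [ae_restrict_iff' Ω.isOpen.measurableSet] at h4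
    filter_upwards [h4] with x hx
    by_cases hxΩ : x ∈ Ω
    · exact hx hxΩ
    · exact image_eq_zero_of_notMem_tsupport fun h => hxΩ (φ.tsupport_subset h)
  have h5 := (Continuous.ae_eq_iff_eq volume φ.continuous continuous_const).1 h3
  exact TestFunction.ext fun x => congrFun h5 x

lemma injective_testJet (k : ℕ) : Function.Injective (testJet k Ω) :=
  (injective_iff_map_eq_zero _).2 fun φ hφ => eq_zero_of_testJet_zeroIndex (k := k) (by rw [hφ]; rfl)

lemma exists_testFunction_eq_one {c : Space N} (hc : c ∈ Ω) :
    ∃ (φ : 𝓓(Ω, ℝ)) (r : ℝ), 0 < r ∧ ∀ x ∈ closedBall c r, φ x = 1 := by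
  obtain ⟨r, hr, hball⟩ := Metric.isOpen_iff.1 Ω.isOpen c hc
  let χ : ContDiffBump c := ⟨r / 3, r / 2, by positivity, by linarith⟩
  exact ⟨⟨χ, χ.contDiff, χ.hasCompactSupport, by
    rw [χ.tsupport_eq]
    exact (closedBall_subset_ball (by change r / 2 < r; linarith)).trans hball⟩, r / 3,
    by positivity, fun x hx => χ.one_of_mem_closedBall hx⟩

/-- Products of a fixed test function with the polynomials in one coordinate. -/
def mulPolynomial (φ : 𝓓(Ω, ℝ)) (i : Fin N) : Polynomial ℝ →ₗ[ℝ] 𝓓(Ω, ℝ) where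
  toFun p := ⟨fun x => φ x * p.eval (x i),
    φ.contDiff.mul (p.contDiff_aeval (𝕜 := ℝ) _ |>.comp (by fun_prop)),
    φ.hasCompactSupport.mul_right, tsupport_mul_subset_left.trans φ.tsupport_subset⟩
  map_add' p q := by
    ext x
    change φ x * (p + q).eval (x i) = φ x * p.eval (x i) + φ x * q.eval (x i)
    rw [Polynomial.eval_add, mul_add]
  map_smul' c p := by
    ext x
    change φ x * (c • p).eval (x i) = c * (φ x * p.eval (x i))
    rw [Polynomial.eval_smul, smul_eq_mul]
    ring

/-- The products of a test function with the polynomials in one coordinate span an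
infinite-dimensional subspace. -/
lemma not_finiteDimensional_workingSpace (hN : 1 ≤ N) (hne : (Ω : Set (Space N)).Nonempty)
    (bc : BoundaryCondition) : ¬ FiniteDimensional ℝ (workingSpace bc Ω) := by
  intro hfin
  obtain ⟨c, hc⟩ := hne
  let i : Fin N := ⟨0, hN⟩
  obtain ⟨φ, r, hr, hφ⟩ := exists_testFunction_eq_one hc
  have hinj : Function.Injective (mulPolynomial φ i) := by
    refine (injective_iff_map_eq_zero _).2 fun p hp => p.eq_zero_of_infinite_isRoot ?_
    refine (Set.Ioo_infinite (a := c i) (b := c i + r) (by linarith)).mono fun t ht => ?_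
    have h1 : φ (c + EuclideanSpace.single i (t - c i)) = 1 := by
      refine hφ _ ?_
      rw [mem_closedBall, dist_eq_norm, add_sub_cancel_left, PiLp.norm_single,
        Real.norm_of_nonneg (by linarith [ht.1])]
      linarith [ht.2]
    have h2 := DFunLike.congr_fun hp (c + EuclideanSpace.single i (t - c i))
    change φ _ * p.eval ((c + EuclideanSpace.single i (t - c i)) i) = 0 at h2
    rw [h1, one_mul] at h2
    simpa using h2
  let T : Polynomial ℝ →ₗ[ℝ] workingSpace bc Ω :=
    ((testJet 2 Ω).comp (mulPolynomial φ i)).codRestrict _ fun p => testJet_mem_workingSpace bc _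
  have hT : Function.Injective T := fun p q h =>
    hinj (injective_testJet 2 (congrArg Subtype.val h))
  exact Polynomial.not_finite (Module.Finite.of_injective T hT)

end InfiniteDimension

/-! ### The variational problem on the working space -/

section Problem

variable {N : ℕ} {Ω : Opens (Space N)}

/-- The derivative of order `α` as a continuous linear map on the working space. -/
def derivCLM (bc : BoundaryCondition) (α : JetIndex N 2) :
    workingSpace bc Ω →L[ℝ] Lp ℝ 2 (volume.restrict (Ω : Set (Space N))) :=
  (PiLp.proj 2 (fun _ : JetIndex N 2 => Lp ℝ 2 (volume.restrict (Ω : Set (Space N)))) α).comp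
    (workingSpace bc Ω).subtypeL

/-- The Laplacian as a continuous linear map on the working space. -/
def lapCLM (bc : BoundaryCondition) :
    workingSpace bc Ω →L[ℝ] Lp ℝ 2 (volume.restrict (Ω : Set (Space N))) :=
  ∑ i, derivCLM bc ⟨2, fun _ => i⟩

lemma lapCLM_ae (bc : BoundaryCondition) (u : workingSpace bc Ω) :
    lapCLM bc u =ᵐ[volume.restrict (Ω : Set (Space N))] lap (u : JetSpace 2 Ω) := by
  rw [lapCLM, sum_apply]
  filter_upwards [Lp.coeFn_finsetSum Finset.univ fun i => derivCLM bc ⟨2, fun _ => i⟩ u] with x hx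
  rw [hx, Finset.sum_apply]
  rfl

/-- The bilinear form `⟨T u, T v⟩`. -/
def innerForm {E H : Type*} [NormedAddCommGroup E] [NormedSpace ℝ E] [NormedAddCommGroup H]
    [InnerProductSpace ℝ H] (T : E →L[ℝ] H) : E →L[ℝ] E →L[ℝ] ℝ :=
  (isBoundedBilinearMap_inner (𝕜 := ℝ) (E := H)).toContinuousLinearMap.bilinearComp T T

lemma innerForm_apply {E H : Type*} [NormedAddCommGroup E] [NormedSpace ℝ E]
    [NormedAddCommGroup H] [InnerProductSpace ℝ H] (T : E →L[ℝ] H) (u v : E) :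
    innerForm T u v = inner ℝ (T u) (T v) := rfl

/-- The quadratic part of the energy. -/
def quadraticForm (bc : BoundaryCondition) (Ω : Opens (Space N)) (ω : ℝ) :
    workingSpace bc Ω →L[ℝ] workingSpace bc Ω →L[ℝ] ℝ :=
  innerForm (lapCLM bc) + ω ^ 2 • ∑ i, innerForm (derivCLM bc (firstIndex N 1 i))

lemma quadraticForm_apply (bc : BoundaryCondition) (ω : ℝ) (u v : workingSpace bc Ω) :
    quadraticForm bc Ω ω u v
      = (∫ x in (Ω : Set (Space N)), lap (u : JetSpace 2 Ω) x * lap (v : JetSpace 2 Ω) x)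
        + ω ^ 2 * ∫ x in (Ω : Set (Space N)),
          inner ℝ (grad (u : JetSpace 2 Ω) x) (grad (v : JetSpace 2 Ω) x) := by
  have e1 : inner ℝ (lapCLM bc u) (lapCLM bc v)
      = ∫ x in (Ω : Set (Space N)), lap (u : JetSpace 2 Ω) x * lap (v : JetSpace 2 Ω) x := by
    rw [L2.inner_def]
    refine integral_congr_ae ?_
    filter_upwards [lapCLM_ae bc u, lapCLM_ae bc v] with x h1 h2
    rw [h1, h2]
    simp [mul_comm]
  have e2 : ∑ i, inner ℝ (derivCLM bc (firstIndex N 1 i) u) (derivCLM bc (firstIndex N 1 i) v)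
      = ∫ x in (Ω : Set (Space N)),
        inner ℝ (grad (u : JetSpace 2 Ω) x) (grad (v : JetSpace 2 Ω) x) := by
    simp only [L2.inner_def, PiLp.inner_apply]
    rw [← integral_finsetSum _ fun i _ => L2.integrable_inner (𝕜 := ℝ) _ _]
    rfl
  rw [← e1, ← e2]
  simp only [quadraticForm, add_apply, smul_apply, sum_apply, smul_eq_mul, innerForm_apply]

lemma quadraticForm_self (bc : BoundaryCondition) (ω : ℝ) (u : workingSpace bc Ω) :
    quadraticForm bc Ω ω u u = (∫ x in (Ω : Set (Space N)), lap (u : JetSpace 2 Ω) x ^ 2)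
        + ω ^ 2 * ∫ x in (Ω : Set (Space N)), ‖grad (u : JetSpace 2 Ω) x‖ ^ 2 := by
  rw [quadraticForm_apply]
  simp only [real_inner_self_eq_norm_sq, pow_two]

lemma quadraticForm_symm (bc : BoundaryCondition) (ω : ℝ) (u v : workingSpace bc Ω) :
    quadraticForm bc Ω ω u v = quadraticForm bc Ω ω v u := by
  rw [quadraticForm_apply, quadraticForm_apply]
  congr 2
  · ext x
    rw [mul_comm]
  · congr 1 with x
    rw [real_inner_comm]

/-- Coercivity. The Laplacian alone suffices, so `ω = 0` is allowed. -/
lemma exists_quadraticForm_ge (hN : 1 ≤ N) {k : ℕ} (hk : 3 ≤ k) {η : ℝ≥0}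
    (hbdd : Bornology.IsBounded (Ω : Set (Space N)))
    (hreg : HasCkHolderBoundary k η (Ω : Set (Space N))) (bc : BoundaryCondition) (ω : ℝ) :
    ∃ c : ℝ, 0 < c ∧ ∀ u : workingSpace bc Ω, c * ‖u‖ ^ 2 ≤ quadraticForm bc Ω ω u u := by
  obtain ⟨C, hC0, hC⟩ := exists_norm_le_l2norm_lap hN hk hbdd hreg
  refine ⟨((C + 1) ^ 2)⁻¹, by positivity, fun u => ?_⟩
  have h1 : ‖u‖ ≤ (C + 1) * l2norm (volume.restrict (Ω : Set (Space N))) (lap (u : JetSpace 2 Ω)) :=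
    (hC _ (workingSpace_le_navier bc u.2)).trans
      (mul_le_mul_of_nonneg_right (by linarith) (l2norm_nonneg _))
  have hm : MemLp (lap (u : JetSpace 2 Ω)) 2 (volume.restrict (Ω : Set (Space N))) :=
    memLp_finsetSum _ fun i _ => Lp.memLp _
  have h2 : 0 ≤ ω ^ 2 * ∫ x in (Ω : Set (Space N)), ‖grad (u : JetSpace 2 Ω) x‖ ^ 2 :=
    mul_nonneg (sq_nonneg _) (integral_nonneg fun x => sq_nonneg _)
  rw [inv_mul_le_iff₀ (by positivity), quadraticForm_self, ← l2norm_sq hm]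
  calc ‖u‖ ^ 2 ≤ ((C + 1) * l2norm (volume.restrict (Ω : Set (Space N)))
        (lap (u : JetSpace 2 Ω))) ^ 2 := pow_le_pow_left₀ (norm_nonneg _) h1 2
    _ = (C + 1) ^ 2 * l2norm (volume.restrict (Ω : Set (Space N))) (lap (u : JetSpace 2 Ω)) ^ 2 :=
        mul_pow _ _ 2
    _ ≤ _ := by gcongr; linarith

/-- The gradient as a continuous linear map from the working space to `L⁴`. -/
lemma exists_gradCLM (hN : N ≤ 3) {k : ℕ} (hk : 1 ≤ k) {η : ℝ≥0}
    (hbdd : Bornology.IsBounded (Ω : Set (Space N)))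
    (hreg : HasCkHolderBoundary k η (Ω : Set (Space N))) (bc : BoundaryCondition) :
    ∃ G : workingSpace bc Ω →L[ℝ] Lp (Space N) 4 (volume.restrict (Ω : Set (Space N))),
      ∀ u, G u =ᵐ[volume.restrict (Ω : Set (Space N))] grad (u : JetSpace 2 Ω) := by
  have hs : ∀ u : workingSpace bc Ω, (u : JetSpace 2 Ω) ∈ sobolev 2 Ω := fun u =>
    (workingSpace_le_navier bc u.2).1
  have hm : ∀ u : workingSpace bc Ω, MemLp (grad (u : JetSpace 2 Ω)) 4
      (volume.restrict (Ω : Set (Space N))) := fun u => memLp_grad hN hk hbdd hreg (hs u)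
  obtain ⟨C, hC0, hC⟩ := exists_eLpNorm_grad_le hN hk hbdd hreg
  let T : workingSpace bc Ω →ₗ[ℝ] Lp (Space N) 4 (volume.restrict (Ω : Set (Space N))) :=
    { toFun := fun u => (hm u).toLp _
      map_add' := fun u v => by
        rw [← MemLp.toLp_add]
        exact MemLp.toLp_congr _ _ (grad_add_ae _ _)
      map_smul' := fun c u => by
        rw [RingHom.id_apply, ← MemLp.toLp_const_smul]
        exact MemLp.toLp_congr _ _ (grad_smul_ae _ _) }
  refine ⟨T.mkContinuous C fun u => ?_, fun u => (hm u).coeFn_toLp⟩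
  change ‖(hm u).toLp _‖ ≤ _
  rw [Lp.norm_toLp]
  exact ENNReal.toReal_le_of_le_ofReal (by positivity) (hC _ (hs u))

/-- The gradient is a compact map from the working space to `L⁴`. -/
lemma tendsto_gradCLM (hN : N ≤ 3) {k : ℕ} (hk : 1 ≤ k) {η : ℝ≥0}
    (hbdd : Bornology.IsBounded (Ω : Set (Space N)))
    (hreg : HasCkHolderBoundary k η (Ω : Set (Space N))) {bc : BoundaryCondition}
    {G : workingSpace bc Ω →L[ℝ] Lp (Space N) 4 (volume.restrict (Ω : Set (Space N)))}
    (hG : ∀ u, G u =ᵐ[volume.restrict (Ω : Set (Space N))] grad (u : JetSpace 2 Ω))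
    {u : ℕ → workingSpace bc Ω} {w : workingSpace bc Ω} {R : ℝ} (hR : ∀ n, ‖u n‖ ≤ R)
    (hw : ∀ ℓ : workingSpace bc Ω →L[ℝ] ℝ, Tendsto (fun n => ℓ (u n)) atTop (𝓝 (ℓ w))) :
    Tendsto (fun n => G (u n)) atTop (𝓝 (G w)) := by
  have h1 := tendsto_eLpNorm_grad hN hk hbdd hreg
    (U := fun n => ((u n - w : workingSpace bc Ω) : JetSpace 2 Ω))
    (fun n => (workingSpace_le_navier bc (u n - w).2).1) (R := R + ‖w‖)
    (fun n => (norm_sub_le (u n) w).trans (by linarith [hR n])) (fun ℓ => by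
      have h2 := hw (ℓ.comp (workingSpace bc Ω).subtypeL)
      have h3 := h2.sub_const (ℓ.comp (workingSpace bc Ω).subtypeL w)
      rw [sub_self] at h3
      refine h3.congr fun n => ?_
      rw [← map_sub]
      rfl)
  have h4 := (ENNReal.tendsto_toReal ENNReal.zero_ne_top).comp h1
  rw [ENNReal.toReal_zero] at h4
  rw [tendsto_iff_norm_sub_tendsto_zero]
  refine h4.congr fun n => ?_
  rw [← map_sub, Lp.norm_def, eLpNorm_congr_ae (hG _)]
  rfl

/-- The gradient map is not zero: a test function with zero gradient vanishes by the Poincaré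
inequality. -/
lemma exists_gradCLM_ne_zero (hN : 1 ≤ N) (hne : (Ω : Set (Space N)).Nonempty)
    (hbdd : Bornology.IsBounded (Ω : Set (Space N))) {bc : BoundaryCondition}
    {G : workingSpace bc Ω →L[ℝ] Lp (Space N) 4 (volume.restrict (Ω : Set (Space N)))}
    (hG : ∀ u, G u =ᵐ[volume.restrict (Ω : Set (Space N))] grad (u : JetSpace 2 Ω)) :
    ∃ u, G u ≠ 0 := by
  obtain ⟨c, hc⟩ := hne
  obtain ⟨φ, r, hr, hφ⟩ := exists_testFunction_eq_one (Ω := Ω) hc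
  refine ⟨⟨testJet 2 Ω φ, testJet_mem_workingSpace bc φ⟩, fun h0 => ?_⟩
  obtain ⟨P, -, hP⟩ := exists_l2norm_zeroIndex_le hbdd (⟨0, hN⟩ : Fin N)
  have h1 := hP (testJet 1 Ω φ) (Submodule.le_topologicalClosure _ ⟨φ, rfl⟩)
  have h2 := hG ⟨testJet 2 Ω φ, testJet_mem_workingSpace bc φ⟩
  rw [h0] at h2
  have h3 : testJet 1 Ω φ (firstIndex N 0 ⟨0, hN⟩) = 0 := by
    refine Lp.ext ?_
    filter_upwards [h2, Lp.coeFn_zero (Space N) 4 (volume.restrict (Ω : Set (Space N))),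
      Lp.coeFn_zero ℝ 2 (volume.restrict (Ω : Set (Space N)))] with x hx hx0 hx1
    rw [hx0] at hx
    rw [hx1]
    exact (congrArg (fun y : Space N => y ⟨0, hN⟩) hx).symm
  rw [h3, norm_zero, mul_zero] at h1
  have h4 : φ = 0 := eq_zero_of_testJet_zeroIndex (norm_le_zero_iff.1 h1)
  have h5 := hφ c (mem_closedBall_self hr.le)
  rw [h4] at h5
  exact zero_ne_one h5

/-- The energy on the working space is a functional of the kind treated by `QuarticProblem`. -/
lemma exists_quarticProblem (hN1 : 1 ≤ N) (hN3 : N ≤ 3) {k : ℕ} (hk : 3 ≤ k) {η : ℝ≥0}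
    (hne : (Ω : Set (Space N)).Nonempty) (hbdd : Bornology.IsBounded (Ω : Set (Space N)))
    (hreg : HasCkHolderBoundary k η (Ω : Set (Space N))) (bc : BoundaryCondition) (ω : ℝ) :
    ∃ D : QuarticProblem (workingSpace bc Ω)
        (Lp (Space N) 4 (volume.restrict (Ω : Set (Space N)))),
      D.a = quadraticForm bc Ω ω ∧
      (∀ u, D.G u =ᵐ[volume.restrict (Ω : Set (Space N))] grad (u : JetSpace 2 Ω)) ∧
      ∀ u v, D.b u v = quarticDeriv (D.G u) (D.G v) := by
  have hk1 : 1 ≤ k := by omega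
  obtain ⟨G, hG⟩ := exists_gradCLM hN3 hk1 hbdd hreg bc
  let D : QuarticProblem (workingSpace bc Ω)
      (Lp (Space N) 4 (volume.restrict (Ω : Set (Space N)))) :=
    { a := quadraticForm bc Ω ω
      G := G
      b := fun u v => quarticDeriv (G u) (G v)
      symm := quadraticForm_symm bc ω
      coercive := exists_quadraticForm_ge hN1 hk hbdd hreg bc ω
      b_self := fun u => quarticDeriv_self _
      b_smul_right := fun s u v => by
        rw [G.map_smul]
        exact quarticDeriv_smul_right s _ _
      b_smul_left := fun s u v => by
        rw [G.map_smul]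
        exact quarticDeriv_smul_left s _ _
      expansion := ⟨8, by norm_num, fun u v => by
        rw [G.map_add]
        exact abs_norm_pow_four_sub_le _ _⟩
      compact := fun u w ⟨R, hR⟩ hw => tendsto_gradCLM hN3 hk1 hbdd hreg hG hR hw
      nontrivial := exists_gradCLM_ne_zero hN1 hne hbdd hG }
  exact ⟨D, rfl, hG, fun u v => rfl⟩

end Problem

end Zakharov

end

theorem proposition5 (N : ℕ) (hN1 : 1 ≤ N) (hN3 : N ≤ 3)
    (Ω : Opens (Zakharov.Space N))
    (hconn : IsConnected (Ω : Set (Zakharov.Space N)))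
    (hbdd : Bornology.IsBounded (Ω : Set (Zakharov.Space N)))
    (η : ℝ≥0) (hη0 : 0 < η) (hη1 : η < 1)
    (hreg : Zakharov.HasCkHolderBoundary 4 η (Ω : Set (Zakharov.Space N)))
    (bc : Zakharov.BoundaryCondition)
    (hball : bc = Zakharov.BoundaryCondition.navier →
      Zakharov.UniformOuterBall (Ω : Set (Zakharov.Space N)))
    (ω κ : ℝ) (hκ : 0 < κ) :
    (∀ v : Zakharov.workingSpace bc Ω,
      IntegrableOn (fun x => ‖Zakharov.grad (v : Zakharov.JetSpace 2 Ω) x‖ ^ 4)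
        (Ω : Set (Zakharov.Space N))) ∧
    ∃ u : Zakharov.workingSpace bc Ω,
      Zakharov.IsGroundState bc ω κ u ∧
      0 < Zakharov.energy ω κ (u : Zakharov.JetSpace 2 Ω) ∧
      Zakharov.IsSaddleCriticalPoint
        (fun v : Zakharov.workingSpace bc Ω => Zakharov.energy ω κ (v : Zakharov.JetSpace 2 Ω)) u ∧
      u ∈ Zakharov.nehari bc ω κ ∧
      ∀ v ∈ Zakharov.nehari (Ω := Ω) bc ω κ,
        Zakharov.energy ω κ (u : Zakharov.JetSpace 2 Ω) ≤
          Zakharov.energy ω κ (v : Zakharov.JetSpace 2 Ω) := by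
  refine ⟨fun v => Zakharov.integrable_norm_pow_four
    (Zakharov.memLp_grad hN3 (by norm_num : 1 ≤ 4) hbdd hreg
    (Zakharov.workingSpace_le_navier bc v.2).1), ?_⟩
  obtain ⟨D, ha, hG, hb⟩ := Zakharov.exists_quarticProblem hN1 hN3 (by norm_num : 3 ≤ 4)
    hconn.nonempty hbdd hreg bc ω
  have hG4 : ∀ u, ‖D.G u‖ ^ 4 = ∫ x in (Ω : Set (Zakharov.Space N)),
      ‖Zakharov.grad (u : Zakharov.JetSpace 2 Ω) x‖ ^ 4 := fun u => by
    rw [Zakharov.norm_pow_four_eq]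
    refine integral_congr_ae ?_
    filter_upwards [hG u] with x hx
    rw [hx]
  have hb' : ∀ u v, D.b u v = ∫ x in (Ω : Set (Zakharov.Space N)),
      ‖Zakharov.grad (u : Zakharov.JetSpace 2 Ω) x‖ ^ 2 *
        inner ℝ (Zakharov.grad (u : Zakharov.JetSpace 2 Ω) x)
          (Zakharov.grad (v : Zakharov.JetSpace 2 Ω) x) := fun u v => by
    rw [hb, Zakharov.quarticDeriv]
    refine integral_congr_ae ?_
    filter_upwards [hG u, hG v] with x hx hx'
    rw [hx, hx']
  have hJ : (fun v : Zakharov.workingSpace bc Ω =>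
      Zakharov.energy ω κ (v : Zakharov.JetSpace 2 Ω)) = D.J κ := by
    ext v
    rw [Zakharov.QuarticProblem.J, ha, Zakharov.quadraticForm_self, hG4, Zakharov.energy]
    ring
  have hweak : ∀ v : Zakharov.workingSpace bc Ω,
      Zakharov.IsWeakSolution bc ω κ v ↔ ∀ φ, D.a v φ = κ * D.b v φ := fun v => by
    simp only [Zakharov.IsWeakSolution, ha, Zakharov.quadraticForm_apply, hb', sub_eq_zero]
  have hnehari : ∀ v : Zakharov.workingSpace bc Ω,
      v ∈ Zakharov.nehari bc ω κ ↔ v ≠ 0 ∧ D.a v v = κ * ‖D.G v‖ ^ 4 := fun v => by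
    simp only [Zakharov.nehari, mem_ofPred_eq, Zakharov.nehariFunctional, ha, Zakharov.quadraticForm_self,
      hG4, sub_eq_zero]
  have hcomplete : CompleteSpace (Zakharov.workingSpace bc Ω) :=
    (Zakharov.isClosed_workingSpace bc).completeSpace_coe
  have hsep : SeparableSpace (Zakharov.workingSpace bc Ω) := by
    have : Fact ((2 : ℝ≥0∞) ≠ ⊤) := ⟨by norm_num⟩
    have : SecondCountableTopology (Lp ℝ 2 (volume.restrict (Ω : Set (Zakharov.Space N)))) :=
      inferInstance
    have : SecondCountableTopology (Zakharov.JetSpace 2 Ω) := inferInstance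
    have : SecondCountableTopology (Zakharov.workingSpace bc Ω) := inferInstance
    infer_instance
  obtain ⟨u, hu0, hu, hself, hpos, hmin, hsaddle⟩ := D.exists_groundState
    (Zakharov.not_finiteDimensional_workingSpace hN1 hconn.nonempty bc) hκ
  have hJv : ∀ v : Zakharov.workingSpace bc Ω,
      Zakharov.energy ω κ (v : Zakharov.JetSpace 2 Ω) = D.J κ v := congrFun hJ
  refine ⟨u, ⟨hu0, (hweak u).2 hu, fun v hv hvw => ?_⟩, ?_, ?_, (hnehari u).2 ⟨hu0, hself⟩,
    fun v hv => ?_⟩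
  · rw [hJv, hJv]
    refine hmin v hv ?_
    rw [(hweak v).1 hvw, D.b_self]
  · rwa [hJv]
  · rwa [hJ]
  · rw [hJv, hJv]
    exact hmin v ((hnehari v).1 hv).1 ((hnehari v).1 hv).2
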